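/- **Definitions.** Let $G$ be a finite group and let $\overline G$ be its hypergroup of conjugacy classes: for classes $C,D,E$ the structure constant $n_{CD}^E$ is the probability that $gh\in E$ for independent uniform $g\in C$, $h\in D$; the weight of $C$ is $w_C=|C|$. Its characters are the nonzero functions $\mathcal X:\overline G\to\mathbb C$ with $\mathcal X(C)\mathcal X(D)=\sum_E n_{CD}^E\mathcal X(E)$ and $\mathcal X(C^{-1})=\overline{\mathcal X(C)}$; the weight of $\mathcal X$ is $w_{\mathcal X}=|G|/\sum_C w_C|\mathcal X(C)|^2$, and the set of characters is $\overline G^*$. The quantum Fourier transform (QFT) over $\overline G$ is $$|C\rangle\mapsto\sum_{\mathcal X\in\overline G^*}\sqrt{\tfrac{w_{\mathcal X}w_C}{|G|}}\;\mathcal X(C)\,|\mathcal X\rangle .$$ For a normal subgroup $N$ let $\overline N_G\subseteq\overline G$ be the set of classes contained in $N$; the coset $C\,\overline N_G$ is the set of all classes $E$ with $n_{CD}^E\neq0$ for some $D\in\overline N_G$. A function $\overline f:\overline G\to\{0,1\}^*$ hides $\overline N_G$ if $\overline f(C)=\overline f(D)\iff C\,\overline N_G=D\,\overline N_G$. The CC-HSHP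 is the problem of determining $\overline N_G$ from oracle access to $\overline f$; the answer is given as a list of characters $\mathcal X_1,\dots,\mathcal X_T$ of $\overline G$ with $\overline N_G=\{C:\mathcal X_i(C)=1\text{ for all }i\}$. One round of AKR (Amini–Kalantar–Roozbehani) sampling is: prepare $|\mathcal X_1\rangle$ for the trivial character $\mathcal X_1$, apply the inverse QFT over $\overline G$, evaluate $\overline f$ into a second register and measure that register, apply the QFT to the first register, and measure a character $\mathcal X$. The machine model is a quantum random access machine: a program with loops and branching over registers that hold natural numbers (constants, addition, truncated subtraction and reading the input cost one step each), which may apply to addressed qubits (initially $|0\rangle$) elementary two-qubit gates from a fixed but arbitrary library, their inverses, Pauli $X$ gates and single-qubit measurements (one step each), and oracle queries ($l+m+1$ steps each, where $l$ and $m$ are the lengths of questions and answers). A circuit computes the QFT over $\overline G$ with accuracy $\varepsilon$ if, for classes and characters labeled injectively by $l$-bit strings and with ancillas starting in and returned to $|0\rangle$, it agrees with the QFT on the span of the class states up to operator norm error $\varepsilon$. **Theorem (CC-HSHP is easy, I).** There are one program $P$ and one polynomial $p$ with the following property. Let $G$ be a finite group; let its conjugacy classes and the characters of $\overline G$ be labeled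 injectively by $l$-bit strings; let $\mathcal C$ be a circuit of $s$ gates (over any gate library) that computes the QFT over $\overline G$ with accuracy $\varepsilon\ge0$. Let $N\lhd G$ be a normal subgroup with $G/N$ abelian, let $\overline f:\overline G\to\{0,1\}^*$ be a function with values of length at most $m$ that hides $\overline N_G$, and let $k\ge0$ be an integer. Given $l,m,k$, the description of $\mathcal C$, the label of the trivial character, and an oracle for $\overline f$ (which may answer arbitrarily on strings that are not labels of classes), $P$ makes at most $p(l+m+k+s)$ steps, and 1. for every set $S$ of sequences of $l+k$ characters, the probability that $P$ outputs (the labels of) a sequence in $S$ differs by at most $4(l+k)\varepsilon$ from the probability that $l+k$ independent rounds of AKR return a sequence in $S$; 2. with probability at least $1-2^{-k}$, the sequence $\mathcal X_1,\dots,\mathcal X_{l+k}$ returned by $l+k$ independent rounds of AKR satisfies $\overline N_G=\{C:\mathcal X_i(C)=1\text{ for all }i\}$; 3. with probability at least $1-2^{-k}-4(l+k)\varepsilon$, $P$ outputs (the labels of) a sequence of $l+k$ characters with this property. In particular, if $l$, $m$ and $s$ are polynomial in $\log|G|$, the CC-HSHP is solved in time polynomial in $\log|G|$ and $k$, with success probability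 at least $1-2^{-k}$ when the QFT circuit is exact. -/

import Mathlib

namespace HSHP

/-! ### Finite abelian hypergroups -/

/-- A finite abelian hypergroup on the set `T`: the basis `T` of a commutative `*`-algebra with
product `a b = ∑ c, n a b c • c`, identity `one` and involution `inv`.
With `w x = 1 / n x (inv x) one`, the two reversibility fields read
`n x y z / w z = n (inv x) z y / w y = n z (inv y) x / w x`. -/
structure AbelianHypergroup (T : Type*) [Fintype T] where
  n : T → T → T → ℝ
  one : T
  inv : T → T
  n_nonneg : ∀ a b c, 0 ≤ n a b c
  n_comm : ∀ a b c, n a b c = n b a c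
  n_assoc : ∀ a b c d, ∑ e, n a b e * n e c d = ∑ e, n b c e * n a e d
  one_n_self : ∀ a, n one a a = 1
  one_n_ne : ∀ a b, b ≠ a → n one a b = 0
  inv_inv : ∀ a, inv (inv a) = a
  n_inv : ∀ a b c, n (inv a) (inv b) (inv c) = n a b c
  anti : ∀ a b, n a b one ≠ 0 ↔ b = inv a
  normalized : ∀ a b, ∑ c, n a b c = 1
  reversible_left : ∀ x y z,
    n x y z * n z (inv z) one = n (inv x) z y * n y (inv y) one
  reversible_right : ∀ x y z,
    n x y z * n z (inv z) one = n z (inv y) x * n x (inv x) one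

namespace AbelianHypergroup

variable {T : Type*} [Fintype T] (H : AbelianHypergroup T)

/-- The weight `w_a` of an element. -/
noncomputable def weight (a : T) : ℝ := 1 / H.n a (H.inv a) H.one

/-- The total weight `ϖ_T`. -/
noncomputable def totalWeight : ℝ := ∑ a, H.weight a

/-- The coset `a N`, the set of all possible outcomes of products `a b` with `b ∈ N`. -/
def coset (N : Set T) (a : T) : Set T := {x | ∃ b ∈ N, H.n a b x ≠ 0}

/-- `f` hides `N`: its values agree exactly on pairs of elements with the same coset of `N`. -/
def Hides {L : Type*} (f : T → L) (N : Set T) : Prop :=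
  ∀ a b, f a = f b ↔ H.coset N a = H.coset N b

/-- Characters of a hypergroup. -/
structure IsCharacter (X : T → ℂ) : Prop where
  ne_zero : X ≠ 0
  mul : ∀ a b, X a * X b = ∑ c, (H.n a b c : ℂ) * X c
  inv : ∀ a, X (H.inv a) = star (X a)

/-- The set `T*` of characters. -/
def Dual : Type _ := {X : T → ℂ // H.IsCharacter X}

theorem isCharacter_one : H.IsCharacter (fun _ => 1) where
  ne_zero h := by
    have := congrFun h H.one
    simp at this
  mul a b := by
    have := H.normalized a b
    simp only [mul_one]
    exact_mod_cast this.symm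
  inv a := by simp

/-- The trivial character. -/
def trivialChar : H.Dual := ⟨fun _ => 1, H.isCharacter_one⟩

instance : Finite H.Dual := by
  classical
  have hfin : ∀ a : T,
      (spectrum ℂ (Matrix.of fun b c => (H.n a b c : ℂ))).Finite := fun a =>
    Matrix.finite_spectrum _
  have key : {X : T → ℂ | H.IsCharacter X} ⊆
      Set.pi Set.univ fun a => spectrum ℂ (Matrix.of fun b c => (H.n a b c : ℂ)) := by
    intro X hX a _
    change X a ∈ spectrum ℂ (Matrix.of fun b c => (H.n a b c : ℂ))
    rw [← Matrix.spectrum_toLin', ← Module.End.hasEigenvalue_iff_mem_spectrum]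
    refine Module.End.hasEigenvalue_of_hasEigenvector (x := X) ⟨?_, hX.ne_zero⟩
    rw [Module.End.mem_eigenspace_iff]
    ext b
    simp [Matrix.mulVec, dotProduct, hX.mul]
  exact ((Set.Finite.pi' hfin).subset (by
    intro X hX a
    exact key hX a (Set.mem_univ a))).to_subtype

noncomputable instance : Fintype H.Dual := Fintype.ofFinite _

/-- The weight of a character in the dual hypergroup, that is, the reciprocal of the coefficient
of the trivial character in `X * conj X`, which equals `(∑ a, w_a |X a|²) / ϖ_T`.
(For the hypergroup of conjugacy classes of a group and `X = χ / d` this is `d²`.) -/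
noncomputable def dualWeight (X : H.Dual) : ℝ :=
  H.totalWeight / ∑ a, H.weight a * ‖X.1 a‖ ^ 2

/-- The matrix entry of the quantum Fourier transform of `T` in row `X` and column `a`,
`√(w_X w_a / ϖ) X(a)`. -/
noncomputable def qft (X : H.Dual) (a : T) : ℂ :=
  (Real.sqrt (H.dualWeight X * H.weight a / H.totalWeight) : ℂ) * X.1 a

/-- The set of elements in the kernels of all the given characters. -/
def commonKernel {t : ℕ} (X : Fin t → H.Dual) : Set T := {a | ∀ i, (X i).1 a = 1}

open scoped Classical in
/-- The probability that one round of the Amini-Kalantar-Roozbehani (AKR) sampling procedure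
with oracle `f` returns `X`: apply the inverse QFT to `|trivial character⟩`,
evaluate `f` into a second register, measure that register (outcome `l`), apply the QFT to the
first register and measure it. -/
noncomputable def akrProb {L : Type*} (f : T → L) (X : H.Dual) : ℝ :=
  ∑ l ∈ Finset.univ.image f,
    ‖∑ a, if f a = l then H.qft X a * star (H.qft H.trivialChar a) else 0‖ ^ 2

/-- The probability that `t` independent AKR rounds return a sequence in `S`. -/
noncomputable def akrLaw {L : Type*} (f : T → L) {t : ℕ} (S : Set (Fin t → H.Dual)) : ℝ :=
  ∑ X : Fin t → H.Dual, S.indicator (fun X => ∏ i, H.akrProb f (X i)) X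

end AbelianHypergroup

/-! ### The hypergroup of conjugacy classes of a finite group -/

section ClassHypergroup

variable {G : Type*} [Group G]

/-- The number of pairs `(g, h)` with `g ∈ C`, `h ∈ D` and `g h ∈ E`. -/
noncomputable def classCount (C D E : ConjClasses G) : ℕ :=
  Nat.card {p : G × G // ConjClasses.mk p.1 = C ∧ ConjClasses.mk p.2 = D ∧
    ConjClasses.mk (p.1 * p.2) = E}

/-- The number of elements of a class. -/
noncomputable def classSize (C : ConjClasses G) : ℕ := Nat.card {g : G // ConjClasses.mk g = C}

/-- The class of inverses. -/
def classInv : ConjClasses G → ConjClasses G :=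
  Quotient.map (fun g => g⁻¹) (by
    intro a b h
    obtain ⟨c, hc⟩ := isConj_iff.1 h
    exact isConj_iff.2 ⟨c, by rw [← hc]; group⟩)

theorem mk_inv (g : G) : ConjClasses.mk g⁻¹ = classInv (ConjClasses.mk g) := rfl

theorem classInv_classInv (C : ConjClasses G) : classInv (classInv C) = C := by
  obtain ⟨g, rfl⟩ := ConjClasses.exists_rep C
  rw [← mk_inv, ← mk_inv, _root_.inv_inv]

theorem mk_inv_eq (g : G) (C : ConjClasses G) :
    ConjClasses.mk g⁻¹ = C ↔ ConjClasses.mk g = classInv C := by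
  rw [mk_inv]
  constructor
  · rintro rfl; rw [classInv_classInv]
  · intro h; rw [h, classInv_classInv]

theorem mk_conj (g h : G) : ConjClasses.mk (h * g * h⁻¹) = ConjClasses.mk g :=
  ConjClasses.mk_eq_mk_iff_isConj.2 (isConj_iff.2 ⟨h⁻¹, by group⟩)

theorem mk_mul_comm (g h : G) : ConjClasses.mk (g * h) = ConjClasses.mk (h * g) := by
  rw [← mk_conj (h * g) g]; congr 1; group

theorem mk_eq_one_iff (g : G) : ConjClasses.mk g = ConjClasses.mk 1 ↔ g = 1 := by
  rw [ConjClasses.mk_eq_mk_iff_isConj, isConj_comm, isConj_one_right]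

theorem classSize_inv (C : ConjClasses G) : classSize (classInv C) = classSize C :=
  Nat.card_congr ((Equiv.inv G).subtypeEquiv fun g => by
    rw [Equiv.inv_apply, mk_inv_eq])

theorem classCount_comm (C D E : ConjClasses G) : classCount C D E = classCount D C E :=
  Nat.card_congr
    { toFun := fun p => ⟨(p.1.2, p.1.2⁻¹ * p.1.1 * p.1.2), p.2.2.1, by
        have := mk_conj p.1.1 p.1.2⁻¹
        rw [_root_.inv_inv] at this
        exact this.trans p.2.1, by
        refine Eq.trans (congrArg ConjClasses.mk ?_) p.2.2.2; simp only; group⟩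
      invFun := fun p => ⟨(p.1.1 * p.1.2 * p.1.1⁻¹, p.1.1), by
        rw [mk_conj]; exact p.2.2.1, p.2.1, by
        refine Eq.trans (congrArg ConjClasses.mk ?_) p.2.2.2; simp only; group⟩
      left_inv := fun p => by ext <;> simp only <;> group
      right_inv := fun p => by ext <;> simp only <;> group }

theorem classCount_inv (C D E : ConjClasses G) :
    classCount (classInv C) (classInv D) (classInv E) = classCount C D E := by
  rw [classCount_comm C D E]
  exact Nat.card_congr
    { toFun := fun p => ⟨(p.1.2⁻¹, p.1.1⁻¹), (mk_inv_eq _ _).2 p.2.2.1, (mk_inv_eq _ _).2 p.2.1, by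
        simp only; rw [← mul_inv_rev, mk_inv_eq]; exact p.2.2.2⟩
      invFun := fun p => ⟨(p.1.2⁻¹, p.1.1⁻¹), by simp only; rw [mk_inv, p.2.2.1],
        by simp only; rw [mk_inv, p.2.1], by
        simp only; rw [← mul_inv_rev, mk_inv, p.2.2.2]⟩
      left_inv := fun p => by ext <;> simp
      right_inv := fun p => by ext <;> simp }

theorem classCount_left (C D E : ConjClasses G) :
    classCount C D E = classCount (classInv C) E D :=
  Nat.card_congr
    { toFun := fun p => ⟨(p.1.1⁻¹, p.1.1 * p.1.2), by simp only; rw [mk_inv, p.2.1], p.2.2.2, by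
        simpa using p.2.2.1⟩
      invFun := fun p => ⟨(p.1.1⁻¹, p.1.1 * p.1.2), (mk_inv_eq _ _).2 p.2.1, p.2.2.2, by
        simpa using p.2.2.1⟩
      left_inv := fun p => by ext <;> simp
      right_inv := fun p => by ext <;> simp }

theorem classCount_right (C D E : ConjClasses G) :
    classCount C D E = classCount E (classInv D) C :=
  Nat.card_congr
    { toFun := fun p => ⟨(p.1.1 * p.1.2, p.1.2⁻¹), p.2.2.2, by simp only; rw [mk_inv, p.2.2.1], by
        simpa using p.2.1⟩
      invFun := fun p => ⟨(p.1.1 * p.1.2, p.1.2⁻¹), p.2.2.2, (mk_inv_eq _ _).2 p.2.2.1, by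
        simpa using p.2.1⟩
      left_inv := fun p => by ext <;> simp
      right_inv := fun p => by ext <;> simp }

open scoped Classical in
theorem classCount_one_left (C D : ConjClasses G) :
    classCount (ConjClasses.mk 1) C D = if D = C then classSize C else 0 := by
  split_ifs with h
  · subst h
    exact Nat.card_congr
      { toFun := fun p => ⟨p.1.2, p.2.2.1⟩
        invFun := fun g => ⟨(1, g.1), rfl, g.2, by simpa using g.2⟩
        left_inv := fun p => by
          ext
          · exact ((mk_eq_one_iff _).1 p.2.1).symm
          · rfl
        right_inv := fun p => rfl }
  · have : IsEmpty {p : G × G // ConjClasses.mk p.1 = ConjClasses.mk 1 ∧ ConjClasses.mk p.2 = C ∧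
        ConjClasses.mk (p.1 * p.2) = D} := ⟨fun p => h (by
      have h2 := p.2.2.2
      rw [(mk_eq_one_iff _).1 p.2.1, one_mul] at h2
      exact h2.symm.trans p.2.2.1)⟩
    exact Nat.card_of_isEmpty

theorem classSize_one : classSize (ConjClasses.mk (1 : G)) = 1 := by
  rw [classSize, Nat.card_eq_one_iff_unique]
  exact ⟨⟨fun a b => Subtype.ext (((mk_eq_one_iff _).1 a.2).trans ((mk_eq_one_iff _).1 b.2).symm)⟩,
    ⟨⟨1, rfl⟩⟩⟩

open scoped Classical in
theorem classCount_eq_sum [Fintype G] (C D E : ConjClasses G) : (classCount C D E : ℝ) =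
    ∑ g : G, ∑ h : G, if ConjClasses.mk g = C ∧ ConjClasses.mk h = D ∧
      ConjClasses.mk (g * h) = E then 1 else 0 := by
  rw [← Fintype.sum_prod_type', classCount, Nat.card_eq_fintype_card, Fintype.card_subtype,
    Finset.sum_boole]

theorem classSize_pos [Finite G] (C : ConjClasses G) : 0 < classSize C := by
  obtain ⟨g, rfl⟩ := ConjClasses.exists_rep C
  have : Nonempty {g' : G // ConjClasses.mk g' = ConjClasses.mk g} := ⟨⟨g, rfl⟩⟩
  exact Nat.card_pos

open scoped Classical in
theorem classCount_to_one (C D : ConjClasses G) :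
    classCount C D (ConjClasses.mk 1) = if D = classInv C then classSize C else 0 := by
  rw [classCount_right, classCount_one_left, classSize_inv]
  have : (C = classInv D) ↔ (D = classInv C) :=
    ⟨fun h => by rw [h, classInv_classInv], fun h => by rw [h, classInv_classInv]⟩
  by_cases h : D = classInv C
  · rw [if_pos h, if_pos (this.2 h), h, classSize_inv]
  · rw [if_neg h, if_neg (fun h' => h (this.1 h'))]

open scoped Classical in
theorem sum_classCount_mul [Fintype G] [Fintype (ConjClasses G)] (C D : ConjClasses G)
    (φ : ConjClasses G → ℝ) : ∑ E, (classCount C D E : ℝ) * φ E =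
    ∑ g : G, ∑ h : G, if ConjClasses.mk g = C ∧ ConjClasses.mk h = D then
      φ (ConjClasses.mk (g * h)) else 0 := by
  simp_rw [classCount_eq_sum, Finset.sum_mul]
  rw [Finset.sum_comm]
  refine Finset.sum_congr rfl fun g _ => ?_
  rw [Finset.sum_comm]
  refine Finset.sum_congr rfl fun h _ => ?_
  by_cases h1 : ConjClasses.mk g = C ∧ ConjClasses.mk h = D
  · rw [if_pos h1, Finset.sum_eq_single (ConjClasses.mk (g * h))]
    · simp [h1.1, h1.2]
    · intro E _ hE
      rw [if_neg (fun hh => hE hh.2.2.symm), zero_mul]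
    · simp
  · rw [if_neg h1]
    refine Finset.sum_eq_zero fun E _ => ?_
    rw [if_neg (fun hh => h1 ⟨hh.1, hh.2.1⟩), zero_mul]

variable [Finite G]

open scoped Classical in
/-- For a fixed `e`, the number of `f ∈ F` with `e f ∈ H` is the average over the class of `e`. -/
theorem classCount_div_size [Fintype G] (e : G) (F H : ConjClasses G) :
    (classCount (ConjClasses.mk e) F H : ℝ) / classSize (ConjClasses.mk e) =
    ∑ f : G, if ConjClasses.mk f = F ∧ ConjClasses.mk (e * f) = H then 1 else 0 := by
  have hconst : ∀ g : G, ConjClasses.mk g = ConjClasses.mk e →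
      (∑ f : G, if ConjClasses.mk f = F ∧ ConjClasses.mk (g * f) = H then (1 : ℝ) else 0) =
      ∑ f : G, if ConjClasses.mk f = F ∧ ConjClasses.mk (e * f) = H then 1 else 0 := by
    intro g hg
    obtain ⟨c, rfl⟩ := isConj_iff.1 (ConjClasses.mk_eq_mk_iff_isConj.1 hg.symm)
    refine Fintype.sum_equiv (MulAut.conj c).symm.toEquiv _ _ fun f => ?_
    have h1 : ConjClasses.mk ((MulAut.conj c).symm f) = ConjClasses.mk f := by
      have := mk_conj f c⁻¹
      simpa using this
    have h2 : ConjClasses.mk (e * (MulAut.conj c).symm f) = ConjClasses.mk (c * e * c⁻¹ * f) := by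
      rw [← mk_conj (e * (MulAut.conj c).symm f) c]
      congr 1
      simp only [MulAut.conj_symm_apply]
      group
    simp only [MulEquiv.toEquiv_eq_coe, EquivLike.coe_coe, h1, h2]
  have hs : (0 : ℝ) < classSize (ConjClasses.mk e) := by exact_mod_cast classSize_pos _
  rw [div_eq_iff hs.ne', classCount_eq_sum]
  have : ∀ g : G, (∑ h : G, if ConjClasses.mk g = ConjClasses.mk e ∧ ConjClasses.mk h = F ∧
      ConjClasses.mk (g * h) = H then (1 : ℝ) else 0) =
      if ConjClasses.mk g = ConjClasses.mk e then
        ∑ f : G, if ConjClasses.mk f = F ∧ ConjClasses.mk (e * f) = H then 1 else 0 else 0 := by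
    intro g
    by_cases hg : ConjClasses.mk g = ConjClasses.mk e
    · rw [if_pos hg, ← hconst g hg]
      simp [hg]
    · simp [hg]
  simp_rw [this]
  rw [← Finset.sum_filter, Finset.sum_const, nsmul_eq_mul, mul_comm, classSize,
    Nat.card_eq_fintype_card, Fintype.card_subtype]

theorem sum_classCount [Fintype (ConjClasses G)] (C D : ConjClasses G) :
    ∑ E, (classCount C D E : ℝ) = classSize C * classSize D := by
  classical
  cases nonempty_fintype G
  have := sum_classCount_mul C D (fun _ => 1)
  simp only [mul_one] at this
  rw [this, classSize, classSize, Nat.card_eq_fintype_card, Nat.card_eq_fintype_card,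
    Fintype.card_subtype, Fintype.card_subtype, ← Finset.sum_boole, ← Finset.sum_boole,
    Finset.sum_mul_sum]
  refine Finset.sum_congr rfl fun g _ => Finset.sum_congr rfl fun h _ => ?_
  by_cases h1 : ConjClasses.mk g = C <;> by_cases h2 : ConjClasses.mk h = D <;> simp [h1, h2]

open scoped Classical in
theorem classCount_assoc_aux [Fintype G] [Fintype (ConjClasses G)] (C D F H : ConjClasses G) :
    ∑ E, (classCount C D E : ℝ) * (classCount E F H / classSize E) =
    ∑ g : G, ∑ h : G, ∑ f : G, if ConjClasses.mk g = C ∧ ConjClasses.mk h = D ∧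
      ConjClasses.mk f = F ∧ ConjClasses.mk (g * h * f) = H then (1 : ℝ) else 0 := by
  rw [sum_classCount_mul]
  refine Finset.sum_congr rfl fun g _ => Finset.sum_congr rfl fun h _ => ?_
  rw [classCount_div_size]
  by_cases h1 : ConjClasses.mk g = C ∧ ConjClasses.mk h = D
  · simp [h1.1, h1.2]
  · rw [if_neg h1]
    exact (Finset.sum_eq_zero fun f _ => if_neg fun hh => h1 ⟨hh.1, hh.2.1⟩).symm

theorem classCount_assoc [Fintype (ConjClasses G)] (C D F H : ConjClasses G) :
    ∑ E, (classCount C D E : ℝ) * (classCount E F H / classSize E) =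
    ∑ E, (classCount D F E : ℝ) * (classCount C E H / classSize E) := by
  classical
  cases nonempty_fintype G
  simp_rw [classCount_comm C _ H]
  rw [classCount_assoc_aux, classCount_assoc_aux, Finset.sum_comm]
  refine Finset.sum_congr rfl fun h _ => ?_
  rw [Finset.sum_comm]
  refine Finset.sum_congr rfl fun f _ => Finset.sum_congr rfl fun g _ => ?_
  rw [mk_mul_comm (h * f) g, mul_assoc]
  congr 1
  exact propext ⟨fun ⟨a, b, c, d⟩ => ⟨b, c, a, d⟩, fun ⟨b, c, a, d⟩ => ⟨a, b, c, d⟩⟩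

variable (G) in
/-- The hypergroup of conjugacy classes of `G`. The structure constant `n C D E` is the probability
that `g h ∈ E` for independent uniform `g ∈ C` and `h ∈ D`. -/
noncomputable def classHypergroup [Fintype (ConjClasses G)] :
    AbelianHypergroup (ConjClasses G) where
  n C D E := classCount C D E / (classSize C * classSize D)
  one := ConjClasses.mk 1
  inv := classInv
  n_nonneg _ _ _ := by positivity
  n_comm C D E := by rw [classCount_comm, mul_comm (classSize C : ℝ)]
  n_assoc C D F H := by
    have hC : (classSize C : ℝ) ≠ 0 := by exact_mod_cast (classSize_pos C).ne'
    have hD : (classSize D : ℝ) ≠ 0 := by exact_mod_cast (classSize_pos D).ne'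
    have hF : (classSize F : ℝ) ≠ 0 := by exact_mod_cast (classSize_pos F).ne'
    have h1 : ∀ E : ConjClasses G, (classCount C D E : ℝ) / (classSize C * classSize D) *
        (classCount E F H / (classSize E * classSize F)) =
        (classCount C D E * (classCount E F H / classSize E)) /
          (classSize C * classSize D * classSize F) := by
      intro E
      field_simp
    have h2 : ∀ E : ConjClasses G, (classCount D F E : ℝ) / (classSize D * classSize F) *
        (classCount C E H / (classSize C * classSize E)) =
        (classCount D F E * (classCount C E H / classSize E)) /
          (classSize C * classSize D * classSize F) := by
      intro E
      field_simp
    simp_rw [h1, h2, ← Finset.sum_div, classCount_assoc]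
  one_n_self C := by
    classical
    have hC : (classSize C : ℝ) ≠ 0 := by exact_mod_cast (classSize_pos C).ne'
    rw [classCount_one_left, if_pos rfl, classSize_one, Nat.cast_one, one_mul, div_self hC]
  one_n_ne C D h := by
    classical
    rw [classCount_one_left, if_neg h, Nat.cast_zero, zero_div]
  inv_inv := classInv_classInv
  n_inv C D E := by rw [classCount_inv, classSize_inv, classSize_inv]
  anti C D := by
    classical
    have hC : (classSize C : ℝ) ≠ 0 := by exact_mod_cast (classSize_pos C).ne'
    have hD : (classSize D : ℝ) ≠ 0 := by exact_mod_cast (classSize_pos D).ne'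
    rw [classCount_to_one]
    by_cases h : D = classInv C
    · simp [h, hC, classSize_inv]
    · simp [h]
  normalized C D := by
    have hC : (classSize C : ℝ) ≠ 0 := by exact_mod_cast (classSize_pos C).ne'
    have hD : (classSize D : ℝ) ≠ 0 := by exact_mod_cast (classSize_pos D).ne'
    rw [← Finset.sum_div, sum_classCount, div_self (mul_ne_zero hC hD)]
  reversible_left C D E := by
    classical
    have hD : (classSize D : ℝ) ≠ 0 := by exact_mod_cast (classSize_pos D).ne'
    have hE : (classSize E : ℝ) ≠ 0 := by exact_mod_cast (classSize_pos E).ne'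
    rw [classCount_left C D E, classCount_to_one, classCount_to_one, if_pos rfl, if_pos rfl,
      classSize_inv, classSize_inv, classSize_inv]
    field_simp
  reversible_right C D E := by
    classical
    have hC : (classSize C : ℝ) ≠ 0 := by exact_mod_cast (classSize_pos C).ne'
    have hE : (classSize E : ℝ) ≠ 0 := by exact_mod_cast (classSize_pos E).ne'
    rw [classCount_right C D E, classCount_to_one, classCount_to_one, if_pos rfl, if_pos rfl,
      classSize_inv, classSize_inv, classSize_inv]
    field_simp

/-- The subset of the class hypergroup that corresponds to a normal subgroup `N`: the set of
conjugacy classes contained in `N`. -/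
def normalClasses (N : Subgroup G) : Set (ConjClasses G) := {C | C.carrier ⊆ (N : Set G)}

end ClassHypergroup

/-! ### Quantum memory, gates and circuits

The quantum memory is an unlimited supply of qubits numbered by `ℕ`, all but finitely many of which
are `|0⟩`. The computational basis vector `|S⟩` has the qubits in `S` equal to `1` and the others
equal to `0`. -/

/-- (Not necessarily normalized) pure states of the quantum memory. -/
abbrev QState : Type := Finset ℕ →₀ ℂ

/-- The squared norm of a state. -/
noncomputable def normSq (ψ : QState) : ℝ := ψ.sum fun _ c => ‖c‖ ^ 2

/-- The basis vector `|S⟩`. -/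
noncomputable def ket (S : Finset ℕ) : QState := Finsupp.single S 1

/-- The set obtained from `S` when bit `q` is set to `v`. -/
def setBit (S : Finset ℕ) (q : ℕ) (v : Bool) : Finset ℕ := if v then insert q S else S.erase q

/-- The `l`-bit string `x` stored in the qubits `0, …, l - 1`, all other qubits being `0`. -/
def bitsToSet {l : ℕ} (x : Fin l → Bool) : Finset ℕ :=
  (Finset.univ.filter fun i => x i = true).map Fin.valEmbedding

/-- The `l`-bit string stored in the qubits `a, …, a + l - 1` of `S`. -/
def readBits (l a : ℕ) (S : Finset ℕ) : Fin l → Bool := fun i => decide (a + (i : ℕ) ∈ S)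

/-- The two-qubit gate `U` applied to the qubits `a` and `b` (nothing happens if `a = b`). -/
noncomputable def applyGate (U : Matrix.unitaryGroup (Bool × Bool) ℂ) (a b : ℕ) :
    QState →ₗ[ℂ] QState :=
  if a = b then LinearMap.id
  else Finsupp.linearCombination ℂ fun S => ∑ v : Bool × Bool,
    U.1 v (decide (a ∈ S), decide (b ∈ S)) • ket (setBit (setBit S a v.1) b v.2)

/-- The Pauli `X` gate on qubit `q`. -/
noncomputable def applyX (q : ℕ) : QState →ₗ[ℂ] QState :=
  Finsupp.lmapDomain ℂ ℂ fun S => symmDiff S {q}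

/-- A library of elementary two-qubit gates. One-qubit gates are the gates of the form `V ⊗ 1`. -/
abbrev GateLibrary : Type := ℕ → Matrix.unitaryGroup (Bool × Bool) ℂ

/-- A circuit is a list of gates `(g, a, b)`: gate number `g` of the library on qubits `a`, `b`. -/
abbrev Circuit : Type := List (ℕ × ℕ × ℕ)

/-- The operator of a circuit; the gates are applied from left to right. -/
noncomputable def Circuit.apply (lib : GateLibrary) (C : Circuit) (ψ : QState) : QState :=
  C.foldl (fun φ g => applyGate (lib g.1) g.2.1 g.2.2 φ) ψ

/-- The circuit `C` computes the QFT over `T` to accuracy `ε`. Elements and characters are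
represented by the `l`-bit strings `encT a` and `encX X`, stored in the first `l` qubits; all other
qubits are ancillas that start in `|0⟩` and are returned to `|0⟩`. The error is measured in the
operator norm on the span of the vectors `|encT a⟩`. -/
def ComputesQFT {T : Type*} [Fintype T] (H : AbelianHypergroup T) {l : ℕ}
    (encT : T ↪ (Fin l → Bool)) (encX : H.Dual ↪ (Fin l → Bool)) (lib : GateLibrary) (C : Circuit)
    (ε : ℝ) : Prop :=
  ∀ φ : T → ℂ,
    normSq (C.apply lib (∑ a, φ a • ket (bitsToSet (encT a))) -
      ∑ X : H.Dual, (∑ a, H.qft X a * φ a) • ket (bitsToSet (encX X))) ≤ ε ^ 2 * ∑ a, ‖φ a‖ ^ 2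

/-! ### A quantum random access machine with an oracle -/

/-- Programs. The classical control has registers holding natural numbers, a read-only input tape
and a write-only output tape of bits. -/
inductive Program : Type
  | skip
  /-- first `c`, then `d` -/
  | seq (c d : Program)
  /-- register `r` := constant `v` -/
  | const (r v : ℕ)
  /-- register `r` := register `s` + register `t` -/
  | add (r s t : ℕ)
  /-- register `r` := register `s` - register `t` (truncated at 0) -/
  | sub (r s t : ℕ)
  /-- register `r` := the entry of the input whose position is in register `s` -/
  | read (r s : ℕ)
  /-- if register `r` is zero then `c` else `d` -/
  | ifZero (r : ℕ) (c d : Program)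
  /-- repeat `c` as many times as register `r` says when the loop is entered -/
  | loop (r : ℕ) (c : Program)
  /-- library gate with number in register `g` on the qubits with addresses in `a` and `b` -/
  | gate (g a b : ℕ)
  /-- the inverse of that gate -/
  | gateInv (g a b : ℕ)
  /-- Pauli `X` on the qubit whose address is in register `a` -/
  | flip (a : ℕ)
  /-- oracle query; the addresses of the first qubits of the question and of the answer are in
  registers `a` and `b` -/
  | query (a b : ℕ)
  /-- measure the qubit whose address is in register `a` and store the result in register `r` -/
  | measure (a r : ℕ)
  /-- write a bit on the output tape: `0` if register `r` is zero and `1` otherwise -/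
  | output (r : ℕ)

/-- What a program is run with: a gate library, an input, and an oracle that answers `l`-bit
questions by bit strings, of which only the first `m` bits are used. -/
structure Environment where
  lib : GateLibrary
  input : List ℕ
  l : ℕ
  m : ℕ
  oracle : (Fin l → Bool) → List Bool

/-- A branch of a computation: the contents of the registers, the output written so far, the quantum
state and the number of steps made. The squared norm of the quantum state is the probability of the
branch. -/
structure Branch where
  reg : ℕ → ℕ
  out : List Bool
  ψ : QState
  time : ℕ

/-- The answer `y` to a question, written on `m + 1` qubits starting at `b` as `y 1 0 … 0`
(so that strings of different lengths are distinguished). -/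
def answerSet (m b : ℕ) (y : List Bool) : Finset ℕ :=
  ((Finset.range (m + 1)).filter fun j => (y.take m ++ [true]).getD j false = true).map
    (addLeftEmbedding b)

/-- The oracle query `|x⟩|z⟩ ↦ |x⟩|z ⊕ f(x)⟩` with `x` in the qubits `a, …, a + l - 1` and `z` in
the qubits `b, …, b + m`; nothing happens if these blocks overlap. -/
noncomputable def applyQuery (env : Environment) (a b : ℕ) : QState →ₗ[ℂ] QState :=
  if a + env.l ≤ b ∨ b + (env.m + 1) ≤ a then
    Finsupp.lmapDomain ℂ ℂ fun S =>
      symmDiff S (answerSet env.m b (env.oracle (readBits env.l a S)))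
  else LinearMap.id

/-- Set a register. -/
def Branch.set (s : Branch) (r v : ℕ) : Branch := { s with reg := Function.update s.reg r v }

/-- Charge `t` steps. -/
def Branch.tick (s : Branch) (t : ℕ) : Branch := { s with time := s.time + t }

/-- The branches that result from running a program on a branch. Every command costs one step,
a query costs `l + m + 1` steps. -/
noncomputable def Program.run (env : Environment) : Program → Branch → List Branch
  | .skip, s => [s.tick 1]
  | .seq c d, s => (c.run env s).flatMap (d.run env)
  | .const r v, s => [(s.set r v).tick 1]
  | .add r a b, s => [(s.set r (s.reg a + s.reg b)).tick 1]
  | .sub r a b, s => [(s.set r (s.reg a - s.reg b)).tick 1]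
  | .read r a, s => [(s.set r (env.input.getD (s.reg a) 0)).tick 1]
  | .ifZero r c d, s => if s.reg r = 0 then c.run env (s.tick 1) else d.run env (s.tick 1)
  | .loop r c, s => (fun L => L.flatMap (c.run env))^[s.reg r] [s.tick 1]
  | .gate g a b, s =>
      [{ s with ψ := applyGate (env.lib (s.reg g)) (s.reg a) (s.reg b) s.ψ }.tick 1]
  | .gateInv g a b, s =>
      [{ s with ψ := applyGate (env.lib (s.reg g))⁻¹ (s.reg a) (s.reg b) s.ψ }.tick 1]
  | .flip a, s => [{ s with ψ := applyX (s.reg a) s.ψ }.tick 1]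
  | .query a b, s =>
      [{ s with ψ := applyQuery env (s.reg a) (s.reg b) s.ψ }.tick (env.l + env.m + 1)]
  | .measure a r, s =>
      [({ s with ψ := s.ψ.filter fun S => s.reg a ∉ S }.set r 0).tick 1,
       ({ s with ψ := s.ψ.filter fun S => s.reg a ∈ S }.set r 1).tick 1]
  | .output r, s => [{ s with out := s.out ++ [decide (s.reg r ≠ 0)] }.tick 1]

/-- All branches of the run of a program, started with registers `0`, empty output and all qubits
in state `|0⟩`. -/
noncomputable def Program.branches (P : Program) (env : Environment) : List Branch :=
  P.run env { reg := fun _ => 0, out := [], ψ := ket ∅, time := 0 }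

open scoped Classical in
/-- The probability that the output of a program belongs to `E`. -/
noncomputable def Program.prob (P : Program) (env : Environment) (E : Set (List Bool)) : ℝ :=
  ((P.branches env).map fun s => if s.out ∈ E then normSq s.ψ else 0).sum

/-! ### Input and output of algorithms for the hidden subhypergroup problem -/

section Problem

variable {T : Type*} [Fintype T] {H : AbelianHypergroup T} {l : ℕ}

/-- The input: the length `l` of labels of elements and characters, the bound `m` on the length of
answers of the oracle, the confidence parameter `k`, the number of gates of the QFT circuit `C`,
the label of the trivial character and the gates of `C`. -/
def problemInput (encX : H.Dual ↪ (Fin l → Bool)) (m k : ℕ) (C : Circuit) : List ℕ :=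
  [l, m, k, C.length] ++ (List.ofFn (encX H.trivialChar)).map Bool.toNat ++
    C.flatMap fun g => [g.1, g.2.1, g.2.2]

/-- The output tape that lists the labels of the characters `X 0, …, X (t - 1)`. -/
def labels (encX : H.Dual ↪ (Fin l → Bool)) {t : ℕ} (X : Fin t → H.Dual) : List Bool :=
  (List.ofFn X).flatMap fun Y => List.ofFn (encX Y)

end Problem

end HSHP

namespace HSHP
-- Characters and unitarity of the Fourier transform of an abelian hypergroup.
namespace AbelianHypergroup

variable {T : Type*} [Fintype T] (H : AbelianHypergroup T)

/-! The Fourier matrix is unitary. Its rows are orthonormal because translation by `inv c` is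
adjoint to translation by `c`, so that distinct characters are eigenvectors with distinct
eigenvalues (`sum_weight_mul_star`). They span because the translations commute and are closed under
adjoints, hence are simultaneously diagonalizable, and a common eigenvector is a multiple of a
weighted character (`span_qftRow`).

Since `G ⧸ N` is abelian, classes map to `G ⧸ N` by a map `π` that turns possible products into
products, and the cosets of the subhypergroup are the fibres of `π`. The oracle measurement
therefore projects onto a fibre. The Fourier amplitude of `X` over the fibre of `x` satisfies `X c *
A x = A (π c * x)` (`mul_fibreAmplitude`). If `π c = 1`, every character that can occur is 1 at `c`.
If `π c ≠ 1`, the mean of `X c` is a sum of inner products of states on disjoint fibres, hence 0; as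
`‖X c‖ ≤ 1`, the event `X c = 1` has probability at most 1/2. With at most `2 ^ l` classes, a union
bound over `l + k` independent rounds leaves failure probability at most `2 ^ (-k)`.

An approximate circuit is used twice in a round. Unitarity turns its error on the exact initial
superposition into an error `ε` of the inverse; the second use costs `ε` again, without a factor for
the number of oracle values, because the parts with different answers are orthogonal. Unit vectors
at distance `2 * ε` have outcome expectations within `4 * ε` (`abs_expect_roundState_sub_le`).

The program is analysed backwards, as a transformer of functions of output and quantum state
(`Implements`). Each round measures and resets every qubit it has touched, so it acts on the future
payoff through one averaging operator (`roundEffect_eq`). Replacing this operator by that of AKR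
round by round adds the errors (`abs_iterate_sub_iterate_le`). The time bound is static: loop
counters are never overwritten after the header (`time_le_cost`). -/

theorem n_inv_one_pos (a : T) : 0 < H.n a (H.inv a) H.one :=
  lt_of_le_of_ne (H.n_nonneg _ _ _) (Ne.symm ((H.anti a _).2 rfl))

theorem weight_pos (a : T) : 0 < H.weight a := one_div_pos.2 (H.n_inv_one_pos a)

/-- Left reversibility with denominators cleared. It makes translation by `inv x` the adjoint of
translation by `x` for the weighted inner product; orthogonality and completeness of the characters
both rest on this. -/
theorem weight_mul_n (x y z : T) : H.weight y * H.n x y z = H.weight z * H.n (H.inv x) z y := by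
  have h := H.reversible_left x y z
  have hy := (H.n_inv_one_pos y).ne'
  have hz := (H.n_inv_one_pos z).ne'
  rw [weight, weight]
  field_simp
  linarith

theorem totalWeight_pos : 0 < H.totalWeight :=
  Finset.sum_pos (fun a _ => H.weight_pos a) ⟨H.one, Finset.mem_univ _⟩

variable {H}

theorem IsCharacter.map_one {X : T → ℂ} (hX : H.IsCharacter X) : X H.one = 1 := by
  classical
  obtain ⟨a, ha⟩ := Function.ne_iff.1 hX.ne_zero
  have h := hX.mul H.one a
  rw [Finset.sum_eq_single a (fun b _ hb => by rw [H.one_n_ne a b hb]; simp) (by simp),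
    H.one_n_self] at h
  exact mul_right_cancel₀ ha (by simpa using h)

/-- Where `‖X c‖` is maximal, `X a * X c` is a convex combination of values of norm at most `‖X c‖`,
and `‖X c‖` can be cancelled because `X` is 1 at the identity. -/
theorem IsCharacter.norm_le_one {X : T → ℂ} (hX : H.IsCharacter X) (a : T) : ‖X a‖ ≤ 1 := by
  obtain ⟨c, -, hc⟩ := Finset.exists_max_image Finset.univ (fun b => ‖X b‖) ⟨a, Finset.mem_univ _⟩
  have hpos : 0 < ‖X c‖ := by
    have := hc H.one (Finset.mem_univ _)
    rw [hX.map_one, norm_one] at this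
    linarith
  have h : ‖X a‖ * ‖X c‖ ≤ 1 * ‖X c‖ := by
    rw [← norm_mul, hX.mul, ← H.normalized a c, Finset.sum_mul]
    refine (norm_sum_le _ _).trans (Finset.sum_le_sum fun b _ => ?_)
    rw [norm_mul, Complex.norm_real, Real.norm_of_nonneg (H.n_nonneg _ _ _)]
    exact mul_le_mul_of_nonneg_left (hc b (Finset.mem_univ _)) (H.n_nonneg _ _ _)
  exact le_of_mul_le_mul_right h hpos

/-- Multiplication by a character value moves inside weighted sums by translation. -/
theorem IsCharacter.mul_sum_weight {X : T → ℂ} (hX : H.IsCharacter X) (c : T) (φ : T → ℂ) :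
    X c * ∑ a, (H.weight a : ℂ) * X a * φ a =
      ∑ b, (H.weight b : ℂ) * X b * ∑ a, (H.n (H.inv c) b a : ℂ) * φ a := by
  simp_rw [Finset.mul_sum]
  rw [Finset.sum_comm (f := fun b a => (H.weight b : ℂ) * X b * ((H.n (H.inv c) b a : ℂ) * φ a))]
  refine Finset.sum_congr rfl fun a _ => ?_
  have h1 : X c * ((H.weight a : ℂ) * X a * φ a) = (H.weight a : ℂ) * φ a * (X c * X a) := by ring
  rw [h1, hX.mul, Finset.mul_sum]
  refine Finset.sum_congr rfl fun b _ => ?_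
  have h2 : (H.weight a : ℂ) * H.n c a b = H.weight b * H.n (H.inv c) b a := by
    exact_mod_cast H.weight_mul_n c a b
  linear_combination (φ a * X b) * h2

/-- In `mul_sum_weight` with `φ = star Y`, the translation moved onto `Y` comes out as the factor `Y
c`. Multiplying the pairing by `X c` or by `Y c` thus gives the same result, so it vanishes once
these differ. -/
theorem IsCharacter.sum_weight_mul_star {X Y : T → ℂ} (hX : H.IsCharacter X)
    (hY : H.IsCharacter Y) (h : X ≠ Y) : ∑ a, (H.weight a : ℂ) * X a * star (Y a) = 0 := by
  obtain ⟨c, hc⟩ := Function.ne_iff.1 h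
  have h1 := hX.mul_sum_weight c (fun a => star (Y a))
  have h2 : ∀ b, ∑ a, (H.n (H.inv c) b a : ℂ) * star (Y a) = Y c * star (Y b) := by
    intro b
    have := congrArg star (hY.mul (H.inv c) b)
    rw [star_mul', hY.inv, star_star, star_sum] at this
    rw [this]
    refine Finset.sum_congr rfl fun a _ => ?_
    rw [star_mul', Complex.star_def, Complex.conj_ofReal]
  simp_rw [h2] at h1
  have h3 : ∑ b, (H.weight b : ℂ) * X b * (Y c * star (Y b)) =
      Y c * ∑ a, (H.weight a : ℂ) * X a * star (Y a) := by
    rw [Finset.mul_sum]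
    exact Finset.sum_congr rfl fun b _ => by ring
  rw [h3, ← sub_eq_zero, ← sub_mul] at h1
  exact (mul_eq_zero.1 h1).resolve_left (sub_ne_zero.2 hc)

variable (H)

theorem sum_weight_norm_sq_pos (X : H.Dual) : 0 < ∑ a, H.weight a * ‖X.1 a‖ ^ 2 := by
  refine Finset.sum_pos' (fun a _ => mul_nonneg (H.weight_pos a).le (sq_nonneg _))
    ⟨H.one, Finset.mem_univ _, ?_⟩
  rw [X.2.map_one, norm_one]
  simpa using H.weight_pos _

theorem dualWeight_pos (X : H.Dual) : 0 < H.dualWeight X :=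
  div_pos H.totalWeight_pos (H.sum_weight_norm_sq_pos X)

theorem qft_eq (X : H.Dual) (a : T) : H.qft X a =
    Real.sqrt (H.dualWeight X / H.totalWeight) * Real.sqrt (H.weight a) * X.1 a := by
  rw [qft, ← Complex.ofReal_mul,
    ← Real.sqrt_mul (div_nonneg (H.dualWeight_pos X).le H.totalWeight_pos.le)]
  congr 3
  ring

theorem ofReal_sqrt_weight_sq (a : T) :
    (Real.sqrt (H.weight a) : ℂ) * Real.sqrt (H.weight a) = H.weight a := by
  rw [← Complex.ofReal_mul, Real.mul_self_sqrt (H.weight_pos a).le]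

open scoped Classical in
theorem sum_qft_mul_star (X Y : H.Dual) :
    ∑ a, H.qft X a * star (H.qft Y a) = if X = Y then 1 else 0 := by
  have h1 : ∑ a, H.qft X a * star (H.qft Y a) =
      (Real.sqrt (H.dualWeight X / H.totalWeight) * Real.sqrt (H.dualWeight Y / H.totalWeight) : ℂ)
        * ∑ a, (H.weight a : ℂ) * X.1 a * star (Y.1 a) := by
    rw [Finset.mul_sum]
    refine Finset.sum_congr rfl fun a _ => ?_
    rw [qft_eq, qft_eq]
    simp only [star_mul', Complex.star_def, Complex.conj_ofReal]
    rw [← H.ofReal_sqrt_weight_sq a]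
    ring
  rw [h1]
  split_ifs with h
  · subst h
    have h2 : ∑ a, (H.weight a : ℂ) * X.1 a * star (X.1 a) =
        ((∑ a, H.weight a * ‖X.1 a‖ ^ 2 : ℝ) : ℂ) := by
      push_cast
      refine Finset.sum_congr rfl fun a _ => ?_
      rw [mul_assoc, Complex.star_def, Complex.mul_conj, Complex.normSq_eq_norm_sq]
      push_cast
      ring
    rw [h2, ← Complex.ofReal_mul, ← Complex.ofReal_mul, ← Complex.ofReal_one]
    congr 1
    rw [Real.mul_self_sqrt (div_nonneg (H.dualWeight_pos X).le H.totalWeight_pos.le), dualWeight]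
    have := (H.sum_weight_norm_sq_pos X).ne'
    have := H.totalWeight_pos.ne'
    field_simp
  · rw [X.2.sum_weight_mul_star Y.2 (fun hh => h (Subtype.ext hh)), mul_zero]

/-- Translation by `c` on functions on `T`, normalized so that translation by `inv c` is its
adjoint. -/
noncomputable def translation (c : T) : Matrix T T ℂ := fun a b =>
  (Real.sqrt (H.weight a) * H.n c a b / Real.sqrt (H.weight b) : ℝ)

/-- The square roots of the weights turn the weighted inner product into the standard one, so this
is `weight_mul_n`. -/
theorem translation_conjTranspose (c : T) :
    (H.translation c).conjTranspose = H.translation (H.inv c) := by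
  ext a b
  rw [Matrix.conjTranspose_apply, translation, translation, Complex.star_def, Complex.conj_ofReal]
  congr 1
  have ha := (Real.sqrt_pos.2 (H.weight_pos a)).ne'
  have hb := (Real.sqrt_pos.2 (H.weight_pos b)).ne'
  have h := H.weight_mul_n c b a
  rw [div_eq_div_iff ha hb]
  have h1 := Real.mul_self_sqrt (H.weight_pos a).le
  have h2 := Real.mul_self_sqrt (H.weight_pos b).le
  linear_combination h + H.n c b a * h2 - H.n (H.inv c) a b * h1

/-- By associativity the entries of the product are governed by `∑ e, n c d e * n a e f`, which is
symmetric in `c` and `d`. -/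
theorem translation_mul_comm (c d : T) :
    H.translation c * H.translation d = H.translation d * H.translation c := by
  have key : ∀ c d a f, (H.translation c * H.translation d) a f =
      (Real.sqrt (H.weight a) * (∑ e, H.n c d e * H.n a e f) / Real.sqrt (H.weight f) : ℝ) := by
    intro c d a f
    rw [Matrix.mul_apply, ← H.n_assoc a c d f, Finset.mul_sum, Finset.sum_div, Complex.ofReal_sum]
    refine Finset.sum_congr rfl fun b _ => ?_
    rw [translation, translation, ← Complex.ofReal_mul, H.n_comm a c b, H.n_comm b d f]
    congr 1
    have hb := (Real.sqrt_pos.2 (H.weight_pos b)).ne'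
    have hf := (Real.sqrt_pos.2 (H.weight_pos f)).ne'
    field_simp
  ext a f
  rw [key, key]
  simp_rw [H.n_comm c d]

/-- The hermitian and antihermitian parts of the translations. -/
noncomputable def translationPart (p : T × Bool) : Matrix T T ℂ :=
  if p.2 then Complex.I • (H.translation p.1 - H.translation (H.inv p.1))
  else H.translation p.1 + H.translation (H.inv p.1)

theorem isHermitian_translationPart (p : T × Bool) : (H.translationPart p).IsHermitian := by
  obtain ⟨c, b⟩ := p
  rw [Matrix.IsHermitian]
  cases b
  · simp [translationPart, translation_conjTranspose, H.inv_inv, add_comm]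
  · simp only [translationPart, if_true, Matrix.conjTranspose_smul, Matrix.conjTranspose_sub,
      translation_conjTranspose, H.inv_inv, Complex.star_def, Complex.conj_I, neg_smul, ← smul_neg,
      neg_sub]

theorem translationPart_commute (p q : T × Bool) :
    Commute (H.translationPart p) (H.translationPart q) := by
  have h : ∀ c d, Commute (H.translation c) (H.translation d) := H.translation_mul_comm
  obtain ⟨c, b⟩ := p
  obtain ⟨d, e⟩ := q
  cases b <;> cases e <;> simp only [translationPart, if_true, Bool.false_eq_true, if_false]
  · exact ((h _ _).add_right (h _ _)).add_left ((h _ _).add_right (h _ _))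
  · exact (((h _ _).sub_right (h _ _)).add_left ((h _ _).sub_right (h _ _))).smul_right _
  · exact (((h _ _).add_right (h _ _)).sub_left ((h _ _).add_right (h _ _))).smul_left _
  · exact ((((h _ _).sub_right (h _ _)).sub_left ((h _ _).sub_right (h _ _))).smul_right
      _).smul_left _

theorem translation_eq (c : T) : H.translation c = (1 / 2 : ℂ) •
    (H.translationPart (c, false) - Complex.I • H.translationPart (c, true)) := by
  simp only [translationPart, if_true, Bool.false_eq_true, if_false, smul_smul, Complex.I_mul_I]
  ext a b
  simp only [Matrix.smul_apply, Matrix.sub_apply, Matrix.add_apply, smul_eq_mul]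
  ring

open scoped ComplexOrder in
/-- A common eigenvector of all translations is proportional to a character. -/
theorem exists_smul_of_translation_eigenvector {φ : T → ℂ} (hφ : φ ≠ 0) {lam : T → ℂ}
    (h : ∀ c, (H.translation c).mulVec φ = lam c • φ) :
    H.IsCharacter lam ∧ ∀ a, φ a = φ H.one / Real.sqrt (H.weight H.one) *
      (Real.sqrt (H.weight a) * lam a) := by
  have hs : ∀ a, (Real.sqrt (H.weight a) : ℂ) ≠ 0 := fun a => by
    exact_mod_cast (Real.sqrt_pos.2 (H.weight_pos a)).ne'
  have h' : ∀ c a, ∑ b, (Real.sqrt (H.weight a) : ℂ) * H.n c a b / Real.sqrt (H.weight b) * φ b =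
      lam c * φ a := by
    intro c a
    have := congrFun (h c) a
    simpa [Matrix.mulVec, dotProduct, translation] using this
  have hform : ∀ a, φ a = φ H.one / Real.sqrt (H.weight H.one) *
      (Real.sqrt (H.weight a) * lam a) := by
    intro c
    -- At the identity only the term `b = c` survives, so the eigenvalue equation determines `φ c`
    -- from `lam c`.
    have h1 := h' c H.one
    rw [Finset.sum_eq_single c (fun b _ hb => by rw [H.n_comm, H.one_n_ne c b hb]; simp) (by simp),
      H.n_comm, H.one_n_self] at h1
    have h2 := hs c
    have h3 := hs H.one
    field_simp at h1 ⊢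
    push_cast at h1
    linear_combination h1
  have h1 : φ H.one ≠ 0 := by
    intro h0
    apply hφ
    ext a
    rw [hform a, h0]
    simp
  refine ⟨⟨?_, ?_, ?_⟩, hform⟩
  · rintro rfl
    have := hform H.one
    simp only [Pi.zero_apply, mul_zero] at this
    exact h1 this
  · intro c a
    have h2 := h' c a
    rw [hform a] at h2
    have h3 : ∀ b, (Real.sqrt (H.weight a) : ℂ) * H.n c a b / Real.sqrt (H.weight b) * φ b =
        (φ H.one / Real.sqrt (H.weight H.one) * Real.sqrt (H.weight a)) * (H.n c a b * lam b) := by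
      intro b
      rw [hform b]
      have := hs b
      field_simp
    simp_rw [h3, ← Finset.mul_sum] at h2
    refine mul_left_cancel₀ (mul_ne_zero (div_ne_zero h1 (hs H.one)) (hs a)) ?_
    rw [h2]
    ring
  · intro c
    -- The same quadratic form is computed twice: directly, and with the translation moved to the
    -- left factor as its adjoint.
    have e1 : star φ ⬝ᵥ (H.translation (H.inv c)).mulVec φ = lam (H.inv c) * (star φ ⬝ᵥ φ) := by
      rw [h, dotProduct_smul, smul_eq_mul]
    have e2 : star φ ⬝ᵥ (H.translation (H.inv c)).mulVec φ = star (lam c) * (star φ ⬝ᵥ φ) := by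
      rw [← translation_conjTranspose, Matrix.dotProduct_mulVec, ← Matrix.star_mulVec, h,
        star_smul, smul_dotProduct, smul_eq_mul]
    exact mul_right_cancel₀ (by rwa [Ne, dotProduct_star_self_eq_zero]) (e1.symm.trans e2)

/-- The rows of the Fourier matrix as vectors. -/
noncomputable def qftRow (X : H.Dual) : EuclideanSpace ℂ T := WithLp.toLp 2 (H.qft X)

theorem orthonormal_qftRow : Orthonormal ℂ H.qftRow := by
  classical
  rw [orthonormal_iff_ite]
  intro X Y
  have := H.sum_qft_mul_star Y X
  simp only [qftRow, EuclideanSpace.inner_toLp_toLp, dotProduct, Pi.star_apply]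
  rw [this]
  simp [eq_comm]

/-- Joint eigenspaces of commuting hermitian operators span the whole space. A joint eigenvector of
all `translationPart`s is one of all translations, hence a multiple of a row. -/
theorem span_qftRow : ⊤ ≤ Submodule.span ℂ (Set.range H.qftRow) := by
  classical
  have hsym : ∀ p, (Matrix.toEuclideanLin (H.translationPart p)).IsSymmetric := fun p =>
    Matrix.isSymmetric_toEuclideanLin_iff.2 (H.isHermitian_translationPart p)
  rw [← LinearMap.IsSymmetric.iSup_iInf_eq_top_of_commute hsym]
  · refine iSup_le fun χ φ hφ => ?_
    by_cases h0 : φ = 0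
    · rw [h0]; exact Submodule.zero_mem _
    have hφ' : ∀ p, (H.translationPart p).mulVec φ.ofLp = χ p • φ.ofLp := by
      intro p
      have := Module.End.mem_eigenspace_iff.1 ((Submodule.mem_iInf _).1 hφ p)
      exact congrArg WithLp.ofLp this
    obtain ⟨hchar, hform⟩ := H.exists_smul_of_translation_eigenvector (φ := φ.ofLp)
      (fun h => h0 (by ext a; exact congrFun h a))
      (lam := fun c => 1 / 2 * (χ (c, false) - Complex.I * χ (c, true))) (fun c => by
        rw [translation_eq, Matrix.smul_mulVec, Matrix.sub_mulVec, Matrix.smul_mulVec,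
          hφ', hφ', smul_smul, ← sub_smul, smul_smul])
    let X : H.Dual := ⟨_, hchar⟩
    have hX : (Real.sqrt (H.dualWeight X / H.totalWeight) : ℂ) ≠ 0 := by
      exact_mod_cast (Real.sqrt_pos.2 (div_pos (H.dualWeight_pos X) H.totalWeight_pos)).ne'
    have : φ = (φ H.one / Real.sqrt (H.weight H.one) /
        Real.sqrt (H.dualWeight X / H.totalWeight)) • H.qftRow X := by
      ext a
      rw [PiLp.smul_apply, smul_eq_mul, qftRow]
      change φ.ofLp a = _ * H.qft X a
      rw [qft_eq, hform a]
      change _ = _ * (_ * X.1 a)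
      change _ * (_ * X.1 a) = _
      field_simp
    rw [this]
    exact Submodule.smul_mem _ _ (Submodule.subset_span ⟨X, rfl⟩)
  · intro p q _
    have := (H.translationPart_commute p q).eq
    simp only [Function.onFun]
    change _ * _ = _ * _
    ext1 φ
    have h1 := congrArg (fun A : Matrix T T ℂ => A.mulVec φ.ofLp) this
    simp only [← Matrix.mulVec_mulVec] at h1
    exact congrArg (WithLp.toLp 2) h1

-- Orthonormality of the columns: the rows form an orthonormal basis, and Parseval's identity is
-- applied to two standard basis vectors.
open scoped Classical in
theorem sum_star_qft_mul (a b : T) :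
    ∑ X, star (H.qft X a) * H.qft X b = if a = b then 1 else 0 := by
  let B := OrthonormalBasis.mk H.orthonormal_qftRow H.span_qftRow
  have h := B.sum_inner_mul_inner (EuclideanSpace.single b 1) (EuclideanSpace.single a 1)
  simp only [B, OrthonormalBasis.coe_mk, EuclideanSpace.inner_single_left,
    EuclideanSpace.inner_single_right] at h
  simp only [qftRow, map_one, one_mul, PiLp.single_apply] at h
  calc _ = ∑ X, H.qft X b * (starRingEnd ℂ) (H.qft X a) :=
        Finset.sum_congr rfl fun X _ => by rw [Complex.star_def, mul_comm]
    _ = _ := by rw [h]; simp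

/-- The Fourier transform preserves inner products. -/
theorem sum_qft_apply_mul_star (φ ψ : T → ℂ) :
    ∑ X, (∑ a, H.qft X a * φ a) * star (∑ b, H.qft X b * ψ b) = ∑ a, φ a * star (ψ a) := by
  classical
  calc _ = ∑ X, ∑ a, ∑ b, (φ a * star (ψ b)) * (star (H.qft X b) * H.qft X a) := by
        refine Finset.sum_congr rfl fun X _ => ?_
        rw [star_sum, Finset.sum_mul_sum]
        refine Finset.sum_congr rfl fun a _ => Finset.sum_congr rfl fun b _ => ?_
        rw [star_mul']
        ring
    _ = ∑ a, ∑ b, (φ a * star (ψ b)) * ∑ X, star (H.qft X b) * H.qft X a := by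
        rw [Finset.sum_comm]
        refine Finset.sum_congr rfl fun a _ => ?_
        rw [Finset.sum_comm]
        simp_rw [Finset.mul_sum]
    _ = _ := by
        simp_rw [sum_star_qft_mul]
        simp

/-- The Fourier transform is isometric. -/
theorem sum_norm_sq_qft (φ : T → ℂ) :
    ∑ X, ‖∑ a, H.qft X a * φ a‖ ^ 2 = ∑ a, ‖φ a‖ ^ 2 := by
  have h := H.sum_qft_apply_mul_star φ φ
  simp only [Complex.star_def, Complex.mul_conj, Complex.normSq_eq_norm_sq] at h
  exact_mod_cast h

end AbelianHypergroup
-- The outcome distribution of exact AKR sampling.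
namespace AbelianHypergroup

variable {T : Type*} [Fintype T] (H : AbelianHypergroup T)

theorem norm_sq_qft_trivialChar_sum : ∑ a, ‖H.qft H.trivialChar a‖ ^ 2 = 1 := by
  classical
  have h := H.sum_qft_mul_star H.trivialChar H.trivialChar
  simp only [Complex.star_def, Complex.mul_conj, Complex.normSq_eq_norm_sq, if_true] at h
  exact_mod_cast h

theorem akrProb_eq {L : Type*} [DecidableEq L] (f : T → L) (X : H.Dual) :
    H.akrProb f X = ∑ y ∈ Finset.univ.image f,
      ‖∑ a, if f a = y then H.qft X a * star (H.qft H.trivialChar a) else 0‖ ^ 2 := by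
  rw [akrProb]
  congr!

theorem sum_image_ite_norm_sq {L : Type*} [DecidableEq L] (f : T → L) (φ : T → ℂ) :
    ∑ y ∈ Finset.univ.image f, ∑ a, ‖if f a = y then φ a else 0‖ ^ 2 = ∑ a, ‖φ a‖ ^ 2 := by
  rw [Finset.sum_comm]
  refine Finset.sum_congr rfl fun a _ => ?_
  rw [Finset.sum_eq_single (f a) (fun y _ hy => by rw [if_neg hy.symm]; simp)
    (fun h => absurd (Finset.mem_image_of_mem f (Finset.mem_univ a)) h), if_pos rfl]

theorem akrProb_nonneg {L : Type*} (f : T → L) (X : H.Dual) : 0 ≤ H.akrProb f X :=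
  Finset.sum_nonneg fun _ _ => sq_nonneg _

/-- The oracle value cuts the unit vector into pieces with disjoint supports, and the Fourier
transform preserves the norm of each piece. -/
theorem sum_akrProb {L : Type*} (f : T → L) : ∑ X, H.akrProb f X = 1 := by
  classical
  rw [← H.norm_sq_qft_trivialChar_sum]
  simp_rw [akrProb]
  rw [Finset.sum_comm]
  have : ∀ y, ∑ X, ‖∑ a, if f a = y then H.qft X a * star (H.qft H.trivialChar a) else 0‖ ^ 2 =
      ∑ a, ‖if f a = y then star (H.qft H.trivialChar a) else 0‖ ^ 2 := by
    intro y
    rw [← H.sum_norm_sq_qft]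
    simp_rw [mul_ite, mul_zero]
  simp_rw [this]
  rw [sum_image_ite_norm_sq]
  simp

theorem sum_prod_akrProb {L : Type*} (f : T → L) (t : ℕ) (u : H.Dual → ℝ) :
    ∑ X : Fin t → H.Dual, ∏ i, (H.akrProb f (X i) * u (X i)) =
      (∑ X, H.akrProb f X * u X) ^ t := by
  rw [Fintype.sum_pow]

variable {A : Type*} [Fintype A] (π : T → A)

open scoped Classical in
/-- The amplitude of `X` after the Fourier transform of the uniform superposition over a fibre
of `π`. -/
noncomputable def fibreAmplitude (x : A) (X : H.Dual) : ℂ :=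
  ∑ a, H.qft X a * if π a = x then star (H.qft H.trivialChar a) else 0

-- Only the fibres of `f` matter, and they are those of `π`. Surjectivity of `π` matches each point
-- of `A` with exactly one value of `f`.
open scoped Classical in
theorem akrProb_eq_sum_fibreAmplitude {L : Type*} (f : T → L) (hπ : Function.Surjective π)
    (hf : ∀ a b, f a = f b ↔ π a = π b) (X : H.Dual) :
    H.akrProb f X = ∑ x, ‖H.fibreAmplitude π x X‖ ^ 2 := by
  rw [akrProb]
  symm
  refine Finset.sum_bij (fun x _ => f (Function.surjInv hπ x)) (fun x _ => by simp) ?_ ?_ ?_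
  · intro x _ y _ h
    simpa only [Function.surjInv_eq] using (hf _ _).1 h
  · intro y hy
    obtain ⟨a, -, rfl⟩ := Finset.mem_image.1 hy
    exact ⟨π a, Finset.mem_univ _, (hf _ _).2 (Function.surjInv_eq hπ _)⟩
  · intro x _
    simp_rw [fibreAmplitude, hf, Function.surjInv_eq, mul_ite, mul_zero]

variable [Group A]

-- Up to a constant the amplitude is the weighted sum of `X` over a fibre. All outcomes of the
-- product of `inv c` and `b` lie over `(π c)⁻¹ * π b`, so translation averages the indicator of the
-- fibre of `x` to that of the fibre of `π c * x`.
omit [Fintype A] in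
open scoped Classical in
theorem mul_fibreAmplitude (hn : ∀ a b c, H.n a b c ≠ 0 → π c = π a * π b)
    (hinv : ∀ a, π (H.inv a) = (π a)⁻¹) (X : H.Dual) (c : T) (x : A) :
    X.1 c * H.fibreAmplitude π x X = H.fibreAmplitude π (π c * x) X := by
  have h1 : ∀ x, H.fibreAmplitude π x X = (Real.sqrt (H.dualWeight X / H.totalWeight) *
      Real.sqrt (H.dualWeight H.trivialChar / H.totalWeight) : ℂ) *
      ∑ a, (H.weight a : ℂ) * X.1 a * if π a = x then 1 else 0 := by
    intro x
    rw [fibreAmplitude, Finset.mul_sum]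
    refine Finset.sum_congr rfl fun a _ => ?_
    rw [qft_eq, qft_eq, ← H.ofReal_sqrt_weight_sq a]
    simp only [star_mul', Complex.star_def, Complex.conj_ofReal, trivialChar, map_one]
    split_ifs
    · ring
    · ring
  rw [h1, h1, mul_left_comm, X.2.mul_sum_weight]
  congr 1
  refine Finset.sum_congr rfl fun b _ => ?_
  congr 1
  split_ifs with h
  · refine Eq.trans ?_ ((Complex.ofReal_sum _ _).symm.trans
      ((congrArg _ (H.normalized (H.inv c) b)).trans Complex.ofReal_one))
    refine Finset.sum_congr rfl fun a _ => ?_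
    by_cases h0 : H.n (H.inv c) b a = 0
    · simp [h0]
    · rw [if_pos (by rw [hn _ _ _ h0, hinv, h, inv_mul_cancel_left]), mul_one]
  · refine Finset.sum_eq_zero fun a _ => ?_
    by_cases h0 : H.n (H.inv c) b a = 0
    · simp [h0]
    · rw [if_neg, mul_zero]
      rw [hn _ _ _ h0, hinv]
      exact fun hh => h (by rw [← hh, mul_inv_cancel_left])

section

variable {L : Type*} {f : T → L} {π} (hπ : Function.Surjective π)
  (hf : ∀ a b, f a = f b ↔ π a = π b) (hn : ∀ a b c, H.n a b c ≠ 0 → π c = π a * π b)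
  (hinv : ∀ a, π (H.inv a) = (π a)⁻¹)

include hπ hf hn hinv

/-- Translation by `c` fixes every fibre, so multiplication by `X c` fixes an amplitude that is not
zero. -/
theorem eq_one_of_akrProb_ne_zero {X : H.Dual} (hX : H.akrProb f X ≠ 0) {c : T} (hc : π c = 1) :
    X.1 c = 1 := by
  classical
  rw [H.akrProb_eq_sum_fibreAmplitude π f hπ hf] at hX
  obtain ⟨x, -, hx⟩ := Finset.exists_ne_zero_of_sum_ne_zero hX
  have h := H.mul_fibreAmplitude π hn hinv X c x
  rw [hc, one_mul] at h
  have hx' : H.fibreAmplitude π x X ≠ 0 := fun h0 => hx (by rw [h0]; simp)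
  exact mul_right_cancel₀ hx' (by rw [h, one_mul])

/-- By `mul_fibreAmplitude` the mean is a sum of inner products of amplitudes over `π c * x` and
over `x`. The Fourier transform preserves inner products, and before it the two states live on
disjoint fibres. -/
theorem sum_akrProb_mul_eq_zero {c : T} (hc : π c ≠ 1) :
    ∑ X, (H.akrProb f X : ℂ) * X.1 c = 0 := by
  classical
  have h1 : ∀ X, (H.akrProb f X : ℂ) * X.1 c =
      ∑ x, H.fibreAmplitude π (π c * x) X * star (H.fibreAmplitude π x X) := by
    intro X
    rw [H.akrProb_eq_sum_fibreAmplitude π f hπ hf, Complex.ofReal_sum, Finset.sum_mul]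
    refine Finset.sum_congr rfl fun x _ => ?_
    rw [← H.mul_fibreAmplitude π hn hinv, mul_assoc, Complex.star_def, Complex.mul_conj,
      Complex.normSq_eq_norm_sq, mul_comm]
  simp_rw [h1]
  rw [Finset.sum_comm]
  refine Finset.sum_eq_zero fun x _ => ?_
  simp_rw [fibreAmplitude]
  rw [sum_qft_apply_mul_star]
  refine Finset.sum_eq_zero fun a _ => ?_
  by_cases h : π a = x
  · rw [if_neg, zero_mul]
    rw [h]
    exact fun hh => hc (by simpa using hh)
  · rw [if_neg h, star_zero, mul_zero]

-- The real part of `X c` has mean 0, is at least `-1`, and equals 1 on the event; so twice the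
-- indicator minus 1 has mean at most 0.
open scoped Classical in
theorem sum_akrProb_eq_one_le_half {c : T} (hc : π c ≠ 1) :
    ∑ X, H.akrProb f X * (if X.1 c = 1 then 1 else 0) ≤ 1 / 2 := by
  have h0 := congrArg Complex.re (H.sum_akrProb_mul_eq_zero hπ hf hn hinv hc)
  rw [Complex.re_sum, Complex.zero_re] at h0
  simp_rw [Complex.re_ofReal_mul] at h0
  have h1 := H.sum_akrProb f
  have h2 : ∑ X, H.akrProb f X * (2 * (if X.1 c = 1 then 1 else 0) - 1) ≤
      ∑ X, H.akrProb f X * (X.1 c).re := by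
    refine Finset.sum_le_sum fun X _ => mul_le_mul_of_nonneg_left ?_ (H.akrProb_nonneg f X)
    split_ifs with h
    · rw [h]; norm_num
    · have := (Complex.abs_re_le_norm (X.1 c)).trans (X.2.norm_le_one c)
      linarith [(abs_le.1 this).1]
  rw [h0] at h2
  simp_rw [mul_sub, mul_one] at h2
  rw [Finset.sum_sub_distrib, h1] at h2
  have h3 : ∑ X, H.akrProb f X * (2 * (if X.1 c = 1 then 1 else 0)) =
      2 * ∑ X, H.akrProb f X * (if X.1 c = 1 then 1 else 0) := by
    rw [Finset.mul_sum]
    exact Finset.sum_congr rfl fun X _ => by ring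
  rw [h3] at h2
  linarith

/-- AKR sampling finds the kernel of `π`, up to a union bound. -/
theorem one_sub_le_akrLaw_commonKernel (t : ℕ) :
    1 - Fintype.card T * (1 / 2 : ℝ) ^ t ≤
      H.akrLaw f {X : Fin t → H.Dual | H.commonKernel X = {a | π a = 1}} := by
  classical
  have h1 : ∑ X : Fin t → H.Dual, ∏ i, H.akrProb f (X i) = 1 := by
    have := H.sum_prod_akrProb f t (fun _ => 1)
    simpa [sum_akrProb] using this
  have hb : ∀ c, π c ≠ 1 → ∑ X : Fin t → H.Dual, ∏ i, (H.akrProb f (X i) *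
      (if (X i).1 c = 1 then 1 else 0)) ≤ (1 / 2 : ℝ) ^ t := by
    intro c hc
    rw [H.sum_prod_akrProb f t (fun X => if X.1 c = 1 then 1 else 0)]
    refine pow_le_pow_left₀ (Finset.sum_nonneg fun X _ => ?_)
      (H.sum_akrProb_eq_one_le_half hπ hf hn hinv hc) t
    exact mul_nonneg (H.akrProb_nonneg f X) (by split_ifs <;> norm_num)
  have hp : ∀ X : Fin t → H.Dual, 0 ≤ ∏ i, H.akrProb f (X i) := fun X =>
    Finset.prod_nonneg fun i _ => H.akrProb_nonneg f _
  have hnn : ∀ (X : Fin t → H.Dual) c, 0 ≤ ∏ i, (H.akrProb f (X i) *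
      (if (X i).1 c = 1 then (1 : ℝ) else 0)) := fun X c =>
    Finset.prod_nonneg fun i _ =>
      mul_nonneg (H.akrProb_nonneg f _) (by split_ifs <;> norm_num)
  -- A sequence of nonzero probability has the kernel of `π` inside its common kernel. It can fail
  -- only if some `c` outside is missed by all its characters; summing over `c` is the union bound.
  have key : ∀ X : Fin t → H.Dual, ∏ i, H.akrProb f (X i) ≤
      ({X : Fin t → H.Dual | H.commonKernel X = {a | π a = 1}}.indicator
        (fun X => ∏ i, H.akrProb f (X i)) X) +
      ∑ c ∈ Finset.univ.filter (fun c => π c ≠ 1), ∏ i, (H.akrProb f (X i) *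
        (if (X i).1 c = 1 then 1 else 0)) := by
    intro X
    have hs : 0 ≤ ∑ c ∈ Finset.univ.filter (fun c => π c ≠ 1), ∏ i, (H.akrProb f (X i) *
        (if (X i).1 c = 1 then (1 : ℝ) else 0)) := Finset.sum_nonneg fun c _ => hnn X c
    by_cases hX : H.commonKernel X = {a | π a = 1}
    · rw [Set.indicator_of_mem (by exact hX)]
      linarith
    rw [Set.indicator_of_notMem (by exact hX), zero_add]
    by_cases hz : ∃ i, H.akrProb f (X i) = 0
    · obtain ⟨i, hi⟩ := hz
      rw [Finset.prod_eq_zero (Finset.mem_univ i) hi]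
      exact hs
    push Not at hz
    obtain ⟨c, hc1, hc2⟩ : ∃ c, π c ≠ 1 ∧ ∀ i, (X i).1 c = 1 := by
      by_contra! hcon
      refine hX (Set.ext fun c => ⟨fun hc => ?_, fun hc i => ?_⟩)
      · by_contra h
        obtain ⟨i, hi⟩ := hcon c h
        exact hi (hc i)
      · exact H.eq_one_of_akrProb_ne_zero hπ hf hn hinv (hz i) hc
    refine le_trans (le_of_eq ?_) (Finset.single_le_sum (fun c _ => hnn X c)
      (Finset.mem_filter.2 ⟨Finset.mem_univ c, hc1⟩))
    exact Finset.prod_congr rfl fun i _ => by rw [if_pos (hc2 i), mul_one]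
  have h2 := Finset.sum_le_sum fun X (_ : X ∈ (Finset.univ : Finset (Fin t → H.Dual))) => key X
  rw [h1, Finset.sum_add_distrib, Finset.sum_comm] at h2
  have h3 : ∑ c ∈ Finset.univ.filter (fun c => π c ≠ 1), ∑ X : Fin t → H.Dual,
      ∏ i, (H.akrProb f (X i) * (if (X i).1 c = 1 then (1 : ℝ) else 0)) ≤
      Fintype.card T * (1 / 2 : ℝ) ^ t := by
    refine (Finset.sum_le_card_nsmul _ _ _ fun c hc => hb c (Finset.mem_filter.1 hc).2).trans ?_
    rw [nsmul_eq_mul]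
    refine mul_le_mul_of_nonneg_right ?_ (by positivity)
    exact_mod_cast Finset.card_le_univ _
  rw [akrLaw]
  linarith

end

end AbelianHypergroup

/-! ### Conjugacy classes over an abelian quotient. -/

section ClassHypergroup

variable {G : Type*} [Group G] (N : Subgroup G) [N.Normal]

/-- The image of a conjugacy class in an abelian quotient. -/
def classQuotient (hN : ∀ x y : G ⧸ N, x * y = y * x) (C : ConjClasses G) : G ⧸ N :=
  Quotient.lift (fun g : G => (g : G ⧸ N)) (by
    intro a b h
    obtain ⟨c, rfl⟩ := isConj_iff.1 h
    simp only [QuotientGroup.mk_mul, QuotientGroup.mk_inv]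
    rw [hN c, mul_inv_cancel_right]) C

variable {N} (hN : ∀ x y : G ⧸ N, x * y = y * x)

theorem classQuotient_surjective : Function.Surjective (classQuotient N hN) := fun x => by
  obtain ⟨g, rfl⟩ := QuotientGroup.mk_surjective x
  exact ⟨ConjClasses.mk g, rfl⟩

theorem classQuotient_inv (C : ConjClasses G) :
    classQuotient N hN (classInv C) = (classQuotient N hN C)⁻¹ := by
  obtain ⟨g, rfl⟩ := ConjClasses.exists_rep C
  rfl

theorem normalClasses_eq : normalClasses N = {C | classQuotient N hN C = 1} := by
  ext C
  constructor
  · intro h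
    obtain ⟨g, rfl⟩ := ConjClasses.exists_rep C
    exact (QuotientGroup.eq_one_iff g).2 (h (ConjClasses.mem_carrier_iff_mk_eq.2 rfl))
  · intro h g hg
    rw [ConjClasses.mem_carrier_iff_mk_eq] at hg
    subst hg
    exact (QuotientGroup.eq_one_iff g).1 h

variable [Finite G] [Fintype (ConjClasses G)]

theorem classHypergroup_n_ne_zero {C D E : ConjClasses G} :
    (classHypergroup G).n C D E ≠ 0 ↔
      ∃ g h : G, ConjClasses.mk g = C ∧ ConjClasses.mk h = D ∧ ConjClasses.mk (g * h) = E := by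
  have hC : (classSize C : ℝ) ≠ 0 := by exact_mod_cast (classSize_pos C).ne'
  have hD : (classSize D : ℝ) ≠ 0 := by exact_mod_cast (classSize_pos D).ne'
  change (classCount C D E : ℝ) / (classSize C * classSize D) ≠ 0 ↔ _
  rw [Ne, div_eq_zero_iff, not_or, Nat.cast_eq_zero, classCount,
    and_iff_left (mul_ne_zero hC hD), ← Ne, Nat.card_ne_zero]
  constructor
  · rintro ⟨⟨p⟩, -⟩
    exact ⟨p.1.1, p.1.2, p.2⟩
  · rintro ⟨g, h, hp⟩
    exact ⟨⟨⟨(g, h), hp⟩⟩, inferInstance⟩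

theorem classQuotient_of_n_ne_zero (C D E : ConjClasses G)
    (h : (classHypergroup G).n C D E ≠ 0) :
    classQuotient N hN E = classQuotient N hN C * classQuotient N hN D := by
  obtain ⟨g, h, rfl, rfl, rfl⟩ := classHypergroup_n_ne_zero.1 h
  rfl

/-- Multiplying by a class inside `N` does not change the image in the quotient. Conversely,
representatives `g` and `e` with equal images differ by `g⁻¹ * e ∈ N`, whose class carries one class
to the other. -/
theorem coset_normalClasses (C : ConjClasses G) :
    (classHypergroup G).coset (normalClasses N) C =
      {E | classQuotient N hN E = classQuotient N hN C} := by
  ext E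
  constructor
  · rintro ⟨D, hD, h⟩
    rw [normalClasses_eq hN] at hD
    rw [Set.mem_ofPred_eq, classQuotient_of_n_ne_zero hN C D E h, hD, mul_one]
  · intro h
    obtain ⟨g, rfl⟩ := ConjClasses.exists_rep C
    obtain ⟨e, rfl⟩ := ConjClasses.exists_rep E
    refine ⟨ConjClasses.mk (g⁻¹ * e), ?_, classHypergroup_n_ne_zero.2
      ⟨g, g⁻¹ * e, rfl, rfl, by rw [mul_inv_cancel_left]⟩⟩
    rw [normalClasses_eq hN, Set.mem_ofPred_eq]
    exact (QuotientGroup.eq_one_iff _).2 (QuotientGroup.eq.1 (Eq.symm h))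

theorem hides_iff_classQuotient {L : Type*} {f : ConjClasses G → L}
    (hf : (classHypergroup G).Hides f (normalClasses N)) (C D : ConjClasses G) :
    f C = f D ↔ classQuotient N hN C = classQuotient N hN D := by
  rw [hf, coset_normalClasses hN, coset_normalClasses hN]
  constructor
  · intro h
    have : C ∈ {E | classQuotient N hN E = classQuotient N hN C} := rfl
    rw [h] at this
    exact this
  · intro h
    rw [h]

include hN in
/-- AKR sampling determines a normal subgroup with abelian quotient. -/
theorem one_sub_le_akrLaw_normalClasses {l : ℕ} (enc : ConjClasses G ↪ (Fin l → Bool))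
    {L : Type*} {f : ConjClasses G → L}
    (hf : (classHypergroup G).Hides f (normalClasses N)) (k : ℕ) :
    1 - (1 / 2 : ℝ) ^ k ≤ (classHypergroup G).akrLaw f
      {X : Fin (l + k) → (classHypergroup G).Dual |
        (classHypergroup G).commonKernel X = normalClasses N} := by
  have := Fintype.ofFinite (G ⧸ N)
  have h := (classHypergroup G).one_sub_le_akrLaw_commonKernel (f := f)
    (classQuotient_surjective hN) (hides_iff_classQuotient hN hf)
    (classQuotient_of_n_ne_zero hN) (classQuotient_inv hN) (l + k)
  rw [← normalClasses_eq hN] at h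
  refine le_trans ?_ h
  -- Injective `l`-bit labels bound the number of terms in the union bound; the `l` extra rounds
  -- compensate for it.
  have hcard : (Fintype.card (ConjClasses G) : ℝ) ≤ 2 ^ l := by
    have := Fintype.card_le_of_embedding enc
    rw [Fintype.card_fun, Fintype.card_bool, Fintype.card_fin] at this
    exact_mod_cast this
  have h2 : (2 : ℝ) ^ l * (1 / 2) ^ (l + k) = (1 / 2) ^ k := by
    rw [pow_add, ← mul_assoc, ← mul_pow]
    norm_num
  rw [← h2]
  gcongr

end ClassHypergroup

/-! ### The quantum memory as an inner product space -/

/-- An orthonormal family indexed by the computational basis. -/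
noncomputable def hilbertKet : HilbertBasis (Finset ℕ) ℂ (lp (fun _ : Finset ℕ => ℂ) 2) :=
  HilbertBasis.ofRepr (LinearIsometryEquiv.refl ℂ _)

/-- The embedding of the quantum memory into the Hilbert space with basis `Finset ℕ`. -/
noncomputable def toHilbert : QState →ₗ[ℂ] lp (fun _ : Finset ℕ => ℂ) 2 :=
  Finsupp.linearCombination ℂ hilbertKet

/-- The expectation of a diagonal observable. -/
noncomputable def expect (ψ : QState) (g : Finset ℕ → ℝ) : ℝ := ψ.sum fun S c => ‖c‖ ^ 2 * g S

theorem normSq_eq_expect (ψ : QState) : normSq ψ = expect ψ fun _ => 1 := by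
  simp [normSq, expect]

theorem expect_const (ψ : QState) (r : ℝ) : expect ψ (fun _ => r) = normSq ψ * r := by
  simp only [normSq, expect, Finsupp.sum, Finset.sum_mul]

theorem norm_toHilbert_sq (ψ : QState) : ‖toHilbert ψ‖ ^ 2 = normSq ψ := by
  have h := hilbertKet.orthonormal.inner_finsupp_eq_sum_left ψ ψ
  rw [inner_self_eq_norm_sq_to_K] at h
  simp only [toHilbert, normSq, Finsupp.sum, Complex.conj_mul'] at h ⊢
  refine Complex.ofReal_injective ?_
  push_cast
  exact h

theorem normSq_smul (c : ℂ) (ψ : QState) : normSq (c • ψ) = ‖c‖ ^ 2 * normSq ψ := by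
  rw [← norm_toHilbert_sq, ← norm_toHilbert_sq, map_smul, norm_smul, mul_pow]

theorem normSq_ket (S : Finset ℕ) : normSq (ket S) = 1 := by
  simp [normSq, ket]

theorem inner_toHilbert_ket (S S' : Finset ℕ) :
    inner ℂ (toHilbert (ket S)) (toHilbert (ket S')) = if S = S' then (1 : ℂ) else 0 := by
  simp only [toHilbert, ket, Finsupp.linearCombination_single, one_smul]
  exact orthonormal_iff_ite.1 hilbertKet.orthonormal S S'

theorem single_eq_smul_ket (S : Finset ℕ) (c : ℂ) : Finsupp.single S c = c • ket S := by
  simp [ket]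

theorem qstate_lhom_ext {f g : QState →ₗ[ℂ] QState} (h : ∀ S, f (ket S) = g (ket S)) : f = g :=
  Finsupp.lhom_ext' fun S => LinearMap.ext_ring (h S)

/-- A left inverse that is also the adjoint gives `⟨f ψ, f ψ⟩ = ⟨ψ, g (f ψ)⟩ = ⟨ψ, ψ⟩`; the adjoint
relation has to be checked on basis vectors only. -/
theorem normSq_apply_of_adjoint {f g : QState →ₗ[ℂ] QState} (hgf : ∀ ψ, g (f ψ) = ψ)
    (h : ∀ S S', inner ℂ (toHilbert (f (ket S))) (toHilbert (ket S')) =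
      inner ℂ (toHilbert (ket S)) (toHilbert (g (ket S')))) (ψ : QState) :
    normSq (f ψ) = normSq ψ := by
  have key : ∀ ψ φ : QState, inner ℂ (toHilbert (f ψ)) (toHilbert φ) =
      inner ℂ (toHilbert ψ) (toHilbert (g φ)) := by
    intro ψ φ
    induction ψ using Finsupp.induction_linear with
    | zero => simp
    | add ψ₁ ψ₂ h₁ h₂ => simp only [map_add, inner_add_left, h₁, h₂]
    | single S c =>
      induction φ using Finsupp.induction_linear with
      | zero => simp
      | add φ₁ φ₂ h₁ h₂ => simp only [map_add, inner_add_right, h₁, h₂]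
      | single S' d =>
        simp only [single_eq_smul_ket, map_smul, inner_smul_left, inner_smul_right, h]
  have h1 := key ψ (f ψ)
  rw [hgf, inner_self_eq_norm_sq_to_K, inner_self_eq_norm_sq_to_K] at h1
  rw [← norm_toHilbert_sq, ← norm_toHilbert_sq]
  exact_mod_cast h1

/-! ### Diagonal observables -/

theorem expect_eq_sum {ψ : QState} {s : Finset (Finset ℕ)} (h : ψ.support ⊆ s)
    (g : Finset ℕ → ℝ) : expect ψ g = ∑ S ∈ s, ‖ψ S‖ ^ 2 * g S :=
  Finsupp.sum_of_support_subset _ h _ (by simp)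

theorem expect_ket (S : Finset ℕ) (g : Finset ℕ → ℝ) : expect (ket S) g = g S := by
  simp [expect, ket]

theorem expect_smul (c : ℂ) (ψ : QState) (g : Finset ℕ → ℝ) :
    expect (c • ψ) g = ‖c‖ ^ 2 * expect ψ g := by
  rw [expect_eq_sum Finsupp.support_smul, expect, Finsupp.sum, Finset.mul_sum]
  refine Finset.sum_congr rfl fun S _ => ?_
  rw [Finsupp.smul_apply, smul_eq_mul, norm_mul, mul_pow, mul_assoc]

theorem expect_sum_of_disjoint {ι : Type*} {s : Finset ι} {ψ : ι → QState}
    (h : ∀ i ∈ s, ∀ j ∈ s, i ≠ j → Disjoint (ψ i).support (ψ j).support) (g : Finset ℕ → ℝ) :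
    expect (∑ i ∈ s, ψ i) g = ∑ i ∈ s, expect (ψ i) g := by
  classical
  induction s using Finset.induction_on with
  | empty => simp [expect]
  | insert i s hi ih =>
    rw [Finset.sum_insert hi, Finset.sum_insert hi, ← ih (fun j hj k hk => h j
      (Finset.mem_insert_of_mem hj) k (Finset.mem_insert_of_mem hk)), expect,
      Finsupp.sum_add_index_of_disjoint]
    · rfl
    · refine Finset.disjoint_of_subset_right Finsupp.support_finsetSum ?_
      rw [Finset.disjoint_biUnion_right]
      exact fun j hj => h i (Finset.mem_insert_self i s) j (Finset.mem_insert_of_mem hj)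
        (fun hij => hi (hij ▸ hj))

theorem expect_mapDomain {e : Finset ℕ → Finset ℕ} (he : Function.Injective e) (ψ : QState)
    (g : Finset ℕ → ℝ) : expect (ψ.mapDomain e) g = expect ψ (g ∘ e) := by
  rw [expect, Finsupp.sum_mapDomain_index_inj he]
  rfl

theorem expect_congr {ψ : QState} {g g' : Finset ℕ → ℝ} (h : ∀ S ∈ ψ.support, g S = g' S) :
    expect ψ g = expect ψ g' :=
  Finset.sum_congr rfl fun S hS => by simp only [h S hS]

theorem expect_filter_add (ψ : QState) (p : Finset ℕ → Prop) [DecidablePred p]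
    (g : Finset ℕ → ℝ) :
    expect (ψ.filter fun S => ¬ p S) g + expect (ψ.filter p) g = expect ψ g := by
  rw [expect_eq_sum (s := ψ.support) (by rw [Finsupp.support_filter]; exact Finset.filter_subset _ _),
    expect_eq_sum (s := ψ.support) (by rw [Finsupp.support_filter]; exact Finset.filter_subset _ _),
    expect, Finsupp.sum, ← Finset.sum_add_distrib]
  refine Finset.sum_congr rfl fun S _ => ?_
  by_cases h : p S <;> simp [h]

/-- Factor the difference of squared moduli at each basis vector and apply Cauchy–Schwarz. This
converts distances of states into distances of outcome distributions. -/
theorem abs_expect_sub_le {ψ φ : QState} {g : Finset ℕ → ℝ} (hg : ∀ S, |g S| ≤ 1) :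
    |expect ψ g - expect φ g| ≤ ‖toHilbert (ψ - φ)‖ * (‖toHilbert ψ‖ + ‖toHilbert φ‖) := by
  classical
  set s := ψ.support ∪ φ.support
  have hψ : ψ.support ⊆ s := Finset.subset_union_left
  have hφ : φ.support ⊆ s := Finset.subset_union_right
  have hd : (ψ - φ).support ⊆ s := Finsupp.support_sub
  have hn : ∀ {χ : QState}, χ.support ⊆ s → ‖toHilbert χ‖ = Real.sqrt (∑ S ∈ s, ‖χ S‖ ^ 2) := by
    intro χ hχ
    have h := expect_eq_sum hχ (fun _ => 1)
    simp only [mul_one] at h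
    rw [← h, ← normSq_eq_expect, ← norm_toHilbert_sq, Real.sqrt_sq (norm_nonneg _)]
  rw [expect_eq_sum hψ, expect_eq_sum hφ, ← Finset.sum_sub_distrib, mul_add, hn hψ, hn hφ, hn hd]
  refine (Finset.abs_sum_le_sum_abs _ _).trans ?_
  have hb : ∀ S ∈ s, |‖ψ S‖ ^ 2 * g S - ‖φ S‖ ^ 2 * g S| ≤
      ‖(ψ - φ) S‖ * ‖ψ S‖ + ‖(ψ - φ) S‖ * ‖φ S‖ := by
    intro S _
    rw [← sub_mul, abs_mul]
    refine (mul_le_of_le_one_right (abs_nonneg _) (hg S)).trans ?_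
    rw [sq_sub_sq, abs_mul, abs_of_nonneg (by positivity), mul_comm, ← mul_add, Finsupp.sub_apply]
    exact mul_le_mul_of_nonneg_right (abs_norm_sub_norm_le _ _) (by positivity)
  refine (Finset.sum_le_sum hb).trans ?_
  rw [Finset.sum_add_distrib]
  exact add_le_add (Real.sum_mul_le_sqrt_mul_sqrt _ _ _) (Real.sum_mul_le_sqrt_mul_sqrt _ _ _)

/-! ### Gates -/

theorem mem_setBit {S : Finset ℕ} {q r : ℕ} {v : Bool} :
    r ∈ setBit S q v ↔ if r = q then v = true else r ∈ S := by
  rw [setBit]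
  split_ifs <;> simp_all

theorem applyGate_self (U : Matrix.unitaryGroup (Bool × Bool) ℂ) (a : ℕ) :
    applyGate U a a = LinearMap.id := by
  rw [applyGate, if_pos rfl]

theorem applyGate_ket (U : Matrix.unitaryGroup (Bool × Bool) ℂ) {a b : ℕ} (h : a ≠ b)
    (S : Finset ℕ) : applyGate U a b (ket S) = ∑ v : Bool × Bool,
      U.1 v (decide (a ∈ S), decide (b ∈ S)) • ket (setBit (setBit S a v.1) b v.2) := by
  rw [applyGate, if_neg h, ket, Finsupp.linearCombination_single, one_smul]

theorem setBit_setBit_setBit {a b : ℕ} (S : Finset ℕ) (v u : Bool × Bool) :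
    setBit (setBit (setBit (setBit S a v.1) b v.2) a u.1) b u.2 =
      setBit (setBit S a u.1) b u.2 := by
  ext r
  simp only [mem_setBit]
  split_ifs <;> rfl

theorem bits_setBit {a b : ℕ} (h : a ≠ b) (S : Finset ℕ) (v : Bool × Bool) :
    (decide (a ∈ setBit (setBit S a v.1) b v.2), decide (b ∈ setBit (setBit S a v.1) b v.2)) =
      v := by
  simp [mem_setBit, h]

theorem setBit_bits {a b : ℕ} (S : Finset ℕ) :
    setBit (setBit S a (decide (a ∈ S))) b (decide (b ∈ S)) = S := by
  ext r
  simp only [mem_setBit]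
  split_ifs with h1 h2
  · simp [h1]
  · simp [h2]
  · rfl

theorem applyGate_mul (U V : Matrix.unitaryGroup (Bool × Bool) ℂ) (a b : ℕ) :
    applyGate U a b ∘ₗ applyGate V a b = applyGate (U * V) a b := by
  by_cases h : a = b
  · subst h; simp [applyGate_self]
  refine qstate_lhom_ext fun S => ?_
  rw [LinearMap.comp_apply, applyGate_ket V h, map_sum, applyGate_ket _ h]
  simp_rw [map_smul, applyGate_ket U h, bits_setBit h, setBit_setBit_setBit, Finset.smul_sum,
    smul_smul]
  rw [Finset.sum_comm]
  refine Finset.sum_congr rfl fun u _ => ?_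
  rw [← Finset.sum_smul]
  congr 1
  rw [Submonoid.coe_mul, Matrix.mul_apply]
  exact Finset.sum_congr rfl fun v _ => mul_comm _ _

theorem applyGate_one (a b : ℕ) : applyGate 1 a b = LinearMap.id := by
  by_cases h : a = b
  · subst h; rw [applyGate_self]
  refine qstate_lhom_ext fun S => ?_
  rw [applyGate_ket _ h, Finset.sum_eq_single (decide (a ∈ S), decide (b ∈ S))]
  · simp only [setBit_bits]
    simp
  · intro v _ hv
    simp [Matrix.one_apply_ne hv]
  · simp

theorem applyGate_inv_apply (U : Matrix.unitaryGroup (Bool × Bool) ℂ) (a b : ℕ) (ψ : QState) :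
    applyGate U⁻¹ a b (applyGate U a b ψ) = ψ := by
  rw [← LinearMap.comp_apply, applyGate_mul, inv_mul_cancel, applyGate_one, LinearMap.id_apply]

theorem applyGate_apply_inv (U : Matrix.unitaryGroup (Bool × Bool) ℂ) (a b : ℕ) (ψ : QState) :
    applyGate U a b (applyGate U⁻¹ a b ψ) = ψ := by
  rw [← LinearMap.comp_apply, applyGate_mul, mul_inv_cancel, applyGate_one, LinearMap.id_apply]

/-- A gate connects only basis states that agree off `a` and `b`. Clearing both bits on either side
puts this condition in a symmetric form, from which the adjoint relation for `U⁻¹` is read off. -/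
theorem inner_applyGate_ket (U : Matrix.unitaryGroup (Bool × Bool) ℂ) {a b : ℕ} (h : a ≠ b)
    (S S' : Finset ℕ) : inner ℂ (toHilbert (ket S')) (toHilbert (applyGate U a b (ket S))) =
      if setBit (setBit S a false) b false = setBit (setBit S' a false) b false then
        U.1 (decide (a ∈ S'), decide (b ∈ S')) (decide (a ∈ S), decide (b ∈ S)) else 0 := by
  rw [applyGate_ket U h, map_sum, inner_sum]
  simp_rw [map_smul, inner_smul_right, inner_toHilbert_ket]
  rw [Finset.sum_eq_single (decide (a ∈ S'), decide (b ∈ S'))]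
  · have : (S' = setBit (setBit S a (decide (a ∈ S'))) b (decide (b ∈ S'))) ↔
        setBit (setBit S a false) b false = setBit (setBit S' a false) b false := by
      constructor
      · intro h'
        rw [h', setBit_setBit_setBit (v := (_, _)) (u := (false, false))]
      · intro h'
        have h2 := congrArg (fun R => setBit (setBit R a (decide (a ∈ S'))) b (decide (b ∈ S'))) h'
        rw [setBit_setBit_setBit S (false, false) (_, _),
          setBit_setBit_setBit S' (false, false) (_, _), setBit_bits] at h2
        exact h2.symm
    simp only [this, mul_ite, mul_one, mul_zero]
  · intro v _ hv
    rw [if_neg, mul_zero]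
    rintro rfl
    exact hv (bits_setBit h S v).symm
  · simp

theorem normSq_applyGate (U : Matrix.unitaryGroup (Bool × Bool) ℂ) (a b : ℕ) (ψ : QState) :
    normSq (applyGate U a b ψ) = normSq ψ := by
  by_cases h : a = b
  · subst h; rw [applyGate_self, LinearMap.id_apply]
  refine normSq_apply_of_adjoint (g := applyGate U⁻¹ a b) (applyGate_inv_apply U a b) ?_ ψ
  intro S S'
  rw [← inner_conj_symm, inner_applyGate_ket U h, inner_applyGate_ket U⁻¹ h]
  rw [apply_ite (starRingEnd ℂ), map_zero]
  refine if_congr eq_comm rfl rfl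

/-! ### States and operators on a set of qubits -/

/-- The states in which all qubits outside `A` are `0`. -/
noncomputable def statesOn (A : Set ℕ) : Submodule ℂ QState :=
  Finsupp.supported ℂ ℂ {S : Finset ℕ | (S : Set ℕ) ⊆ A}

theorem ket_mem_statesOn {A : Set ℕ} {S : Finset ℕ} (h : (S : Set ℕ) ⊆ A) : ket S ∈ statesOn A :=
  Finsupp.single_mem_supported ℂ 1 h

theorem map_mem_statesOn {A A' : Set ℕ} {f : QState →ₗ[ℂ] QState}
    (h : ∀ S : Finset ℕ, (S : Set ℕ) ⊆ A → f (ket S) ∈ statesOn A') {ψ : QState}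
    (hψ : ψ ∈ statesOn A) : f ψ ∈ statesOn A' := by
  rw [statesOn, Finsupp.supported_eq_span_single] at hψ
  induction hψ using Submodule.span_induction with
  | mem x hx => obtain ⟨S, hS, rfl⟩ := hx; exact h S hS
  | zero => rw [map_zero]; exact Submodule.zero_mem _
  | add x y _ _ hx hy => rw [map_add]; exact Submodule.add_mem _ hx hy
  | smul c x _ hx => rw [map_smul]; exact Submodule.smul_mem _ c hx

theorem applyGate_mem_statesOn (U : Matrix.unitaryGroup (Bool × Bool) ℂ) {a b : ℕ} {A : Set ℕ}
    (ha : a ∈ A) (hb : b ∈ A) {ψ : QState} (hψ : ψ ∈ statesOn A) :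
    applyGate U a b ψ ∈ statesOn A := by
  by_cases h : a = b
  · subst h; rwa [applyGate_self, LinearMap.id_apply]
  refine map_mem_statesOn (fun S hS => ?_) hψ
  rw [applyGate_ket U h]
  refine Submodule.sum_mem _ fun v _ => Submodule.smul_mem _ _ (ket_mem_statesOn ?_)
  intro r hr
  rw [Finset.mem_coe, mem_setBit, mem_setBit] at hr
  split_ifs at hr with h1 h2
  · exact h1 ▸ hb
  · exact h2 ▸ ha
  · exact hS hr

/-- Pauli `X` on all qubits in `R`. -/
noncomputable def flipSet (R : Finset ℕ) : QState →ₗ[ℂ] QState :=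
  Finsupp.lmapDomain ℂ ℂ fun S => symmDiff S R

theorem flipSet_ket (R S : Finset ℕ) : flipSet R (ket S) = ket (symmDiff S R) := by
  simp [flipSet, ket, Finsupp.mapDomain_single]

theorem expect_flipSet (R : Finset ℕ) (ψ : QState) (g : Finset ℕ → ℝ) :
    expect (flipSet R ψ) g = expect ψ fun S => g (symmDiff S R) :=
  expect_mapDomain (symmDiff_left_injective R) ψ g

theorem normSq_flipSet (R : Finset ℕ) (ψ : QState) : normSq (flipSet R ψ) = normSq ψ := by
  rw [normSq_eq_expect, expect_flipSet, normSq_eq_expect]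

theorem flipSet_mem_statesOn {R : Finset ℕ} {A : Set ℕ} (hR : (R : Set ℕ) ⊆ A) {ψ : QState}
    (hψ : ψ ∈ statesOn A) : flipSet R ψ ∈ statesOn A := by
  refine map_mem_statesOn (fun S hS => ?_) hψ
  rw [flipSet_ket]
  refine ket_mem_statesOn fun r hr => ?_
  rcases Finset.mem_symmDiff.1 (Finset.mem_coe.1 hr) with h | h
  exacts [hS h.1, hR h.1]

theorem applyGate_flipSet (U : Matrix.unitaryGroup (Bool × Bool) ℂ) {a b : ℕ} {R : Finset ℕ}
    (ha : a ∉ R) (hb : b ∉ R) (ψ : QState) :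
    applyGate U a b (flipSet R ψ) = flipSet R (applyGate U a b ψ) := by
  by_cases h : a = b
  · subst h; simp only [applyGate_self, LinearMap.id_apply]
  rw [← LinearMap.comp_apply, ← LinearMap.comp_apply]
  refine LinearMap.congr_fun (qstate_lhom_ext fun S => ?_) ψ
  rw [LinearMap.comp_apply, LinearMap.comp_apply, flipSet_ket, applyGate_ket U h,
    applyGate_ket U h, map_sum]
  refine Finset.sum_congr rfl fun v _ => ?_
  rw [map_smul, flipSet_ket]
  have h1 : ∀ q, q ∉ R → (q ∈ symmDiff S R ↔ q ∈ S) := fun q hq => by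
    simp [Finset.mem_symmDiff, hq]
  simp only [h1 a ha, h1 b hb]
  congr 2
  ext r
  simp only [mem_setBit, Finset.mem_symmDiff]
  split_ifs with h2 h3
  · subst h2; simp [hb]
  · subst h3; simp [ha]
  · rfl

/-! ### Circuits -/

namespace Circuit

/-- The operator of a circuit as a linear map. -/
noncomputable def toLin (lib : GateLibrary) : Circuit → QState →ₗ[ℂ] QState
  | [] => LinearMap.id
  | g :: C => toLin lib C ∘ₗ applyGate (lib g.1) g.2.1 g.2.2

/-- The inverse of the operator of a circuit. -/
noncomputable def toLinInv (lib : GateLibrary) : Circuit → QState →ₗ[ℂ] QState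
  | [] => LinearMap.id
  | g :: C => applyGate (lib g.1)⁻¹ g.2.1 g.2.2 ∘ₗ toLinInv lib C

/-- The qubits on which the gates of a circuit act. -/
def qubits (C : Circuit) : List ℕ := C.flatMap fun g => [g.2.1, g.2.2]

variable (lib : GateLibrary)

theorem toLin_apply (C : Circuit) (ψ : QState) : toLin lib C ψ = C.apply lib ψ := by
  induction C generalizing ψ with
  | nil => rfl
  | cons g C ih => exact ih _

theorem normSq_toLin (C : Circuit) (ψ : QState) : normSq (toLin lib C ψ) = normSq ψ := by
  induction C generalizing ψ with
  | nil => rfl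
  | cons g C ih => exact (ih _).trans (normSq_applyGate _ _ _ _)

theorem normSq_toLinInv (C : Circuit) (ψ : QState) : normSq (toLinInv lib C ψ) = normSq ψ := by
  induction C with
  | nil => rfl
  | cons g C ih => exact (normSq_applyGate _ _ _ _).trans ih

theorem toLin_toLinInv (C : Circuit) (ψ : QState) : toLin lib C (toLinInv lib C ψ) = ψ := by
  induction C with
  | nil => rfl
  | cons g C ih =>
    simp only [toLin, toLinInv, LinearMap.comp_apply, applyGate_apply_inv]
    exact ih

theorem toLin_mem_statesOn {C : Circuit} {A : Set ℕ} (h : ∀ q ∈ C.qubits, q ∈ A) {ψ : QState}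
    (hψ : ψ ∈ statesOn A) : toLin lib C ψ ∈ statesOn A := by
  induction C generalizing ψ with
  | nil => exact hψ
  | cons g C ih =>
    exact ih (fun q hq => h q (by simp only [qubits, List.flatMap_cons, List.mem_append] at hq ⊢
                                  exact Or.inr hq))
      (applyGate_mem_statesOn _ (h _ (by simp [qubits])) (h _ (by simp [qubits])) hψ)

theorem toLinInv_mem_statesOn {C : Circuit} {A : Set ℕ} (h : ∀ q ∈ C.qubits, q ∈ A) {ψ : QState}
    (hψ : ψ ∈ statesOn A) : toLinInv lib C ψ ∈ statesOn A := by
  induction C with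
  | nil => exact hψ
  | cons g C ih =>
    exact applyGate_mem_statesOn _ (h _ (by simp [qubits])) (h _ (by simp [qubits]))
      (ih (fun q hq => h q (by simp only [qubits, List.flatMap_cons, List.mem_append] at hq ⊢
                               exact Or.inr hq)))

/-- Used with `R` a recorded oracle answer: the circuit acts on each answer's component as if
nothing had been recorded. -/
theorem toLin_flipSet {C : Circuit} {R : Finset ℕ} (h : ∀ q ∈ C.qubits, q ∉ R) (ψ : QState) :
    toLin lib C (flipSet R ψ) = flipSet R (toLin lib C ψ) := by
  induction C generalizing ψ with
  | nil => rfl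
  | cons g C ih =>
    simp only [toLin, LinearMap.comp_apply]
    rw [applyGate_flipSet _ (h _ (by simp [qubits])) (h _ (by simp [qubits]))]
    exact ih (fun q hq => h q (by simp only [qubits, List.flatMap_cons, List.mem_append] at hq ⊢
                                  exact Or.inr hq)) _

end Circuit

/-! ### Oracle queries -/

theorem answerSet_subset (m b : ℕ) (y : List Bool) :
    ∀ q ∈ answerSet m b y, b ≤ q ∧ q < b + (m + 1) := by
  intro q hq
  rw [answerSet, Finset.mem_map] at hq
  obtain ⟨j, hj, rfl⟩ := hq
  have := Finset.mem_range.1 (Finset.mem_filter.1 hj).1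
  simp only [addLeftEmbedding_apply]
  omega

/-- The final `true` marks the end of the string: where the longer string has its marker, the
shorter one already reads the default `false`. -/
theorem eq_of_getD_append_true {y z : List Bool}
    (h : ∀ j, (y ++ [true]).getD j false = (z ++ [true]).getD j false) : y = z := by
  have key : ∀ {y z : List Bool},
      (∀ j, (y ++ [true]).getD j false = (z ++ [true]).getD j false) → y.length ≤ z.length := by
    intro y z h
    by_contra! hlt
    have h1 := h y.length
    rw [List.getD_eq_default (z ++ [true]) _ (by simpa using hlt)] at h1
    simp at h1
  have hlen := le_antisymm (key h) (key fun j => (h j).symm)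
  refine List.ext_getElem hlen fun j h1 h2 => ?_
  have h3 := h j
  rwa [List.getD_append _ _ _ _ h1, List.getD_append _ _ _ _ h2, List.getD_eq_getElem _ _ h1,
    List.getD_eq_getElem _ _ h2] at h3

theorem answerSet_injOn {m : ℕ} (b : ℕ) {y z : List Bool} (hy : y.length ≤ m) (hz : z.length ≤ m)
    (h : answerSet m b y = answerSet m b z) : y = z := by
  rw [answerSet, answerSet, Finset.map_inj, List.take_of_length_le hy,
    List.take_of_length_le hz] at h
  refine eq_of_getD_append_true fun j => ?_
  by_cases hj : j < m + 1
  · have h1 := Finset.ext_iff.1 h j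
    simp only [Finset.mem_filter, Finset.mem_range, hj, true_and] at h1
    exact Bool.eq_iff_iff.2 h1
  · rw [List.getD_eq_default _ _ (by simp; omega), List.getD_eq_default _ _ (by simp; omega)]

theorem readBits_bitsToSet {l : ℕ} (x : Fin l → Bool) : readBits l 0 (bitsToSet x) = x := by
  ext i
  simp [readBits, bitsToSet, Fin.val_inj]

theorem bitsToSet_subset {l : ℕ} (x : Fin l → Bool) : ∀ q ∈ bitsToSet x, q < l := by
  intro q hq
  simp only [bitsToSet, Finset.mem_map, Fin.valEmbedding_apply] at hq
  obtain ⟨i, -, rfl⟩ := hq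
  exact i.2

theorem readBits_symmDiff {l b : ℕ} {R : Finset ℕ} (hR : ∀ q ∈ R, b ≤ q) (hb : l ≤ b)
    (S : Finset ℕ) : readBits l 0 (symmDiff S R) = readBits l 0 S := by
  ext i
  have : (0 + (i : ℕ)) ∉ R := fun h => by have := hR _ h; have := i.2; omega
  rw [zero_add] at this
  simp [readBits, Finset.mem_symmDiff, this]

section Query

variable (env : Environment) {b : ℕ} (hb : env.l ≤ b)

include hb

theorem applyQuery_eq : applyQuery env 0 b = Finsupp.lmapDomain ℂ ℂ fun S =>
    symmDiff S (answerSet env.m b (env.oracle (readBits env.l 0 S))) := by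
  rw [applyQuery, if_pos (Or.inl (by omega))]

theorem applyQuery_ket (S : Finset ℕ) : applyQuery env 0 b (ket S) =
    flipSet (answerSet env.m b (env.oracle (readBits env.l 0 S))) (ket S) := by
  rw [applyQuery_eq env hb, flipSet_ket]
  simp [ket, Finsupp.mapDomain_single]

/-- The answer block lies beyond the question, so a second query undoes the first. This holds for
arbitrary oracle answers, also on strings that are not labels. -/
theorem normSq_applyQuery (ψ : QState) : normSq (applyQuery env 0 b ψ) = normSq ψ := by
  rw [applyQuery_eq env hb, normSq_eq_expect, normSq_eq_expect]
  refine expect_mapDomain (Function.Involutive.injective fun S => ?_) ψ _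
  rw [readBits_symmDiff (fun q hq => (answerSet_subset _ _ _ q hq).1) hb,
    symmDiff_symmDiff_cancel_right]

theorem applyQuery_mem_statesOn {A : Set ℕ} (hA : ∀ q, b ≤ q → q < b + (env.m + 1) → q ∈ A)
    {ψ : QState} (hψ : ψ ∈ statesOn A) : applyQuery env 0 b ψ ∈ statesOn A := by
  refine map_mem_statesOn (fun S hS => ?_) hψ
  rw [applyQuery_ket env hb]
  refine flipSet_mem_statesOn (fun q hq => ?_) (ket_mem_statesOn hS)
  have := answerSet_subset _ _ _ q hq
  exact hA q this.1 this.2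

end Query

/-- States whose answer registers differ have disjoint supports. -/
theorem expect_sum_flipSet {ι : Type*} {s : Finset ι} {b : ℕ} {R : ι → Finset ℕ} {ρ : ι → QState}
    (hR : ∀ i ∈ s, ∀ q ∈ R i, b ≤ q) (hinj : ∀ i ∈ s, ∀ j ∈ s, R i = R j → i = j)
    (hρ : ∀ i ∈ s, ρ i ∈ statesOn (Set.Iio b)) (g : Finset ℕ → ℝ) :
    expect (∑ i ∈ s, flipSet (R i) (ρ i)) g = ∑ i ∈ s, expect (flipSet (R i) (ρ i)) g := by
  refine expect_sum_of_disjoint (fun i hi j hj hij => ?_) g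
  -- Since `ρ i` lives below `b`, the qubits from `b` on show exactly `R i`.
  have key : ∀ i ∈ s, ∀ S ∈ (flipSet (R i) (ρ i)).support, S.filter (b ≤ ·) = R i := by
    intro i hi S hS
    have := Finsupp.mapDomain_support hS
    obtain ⟨S', hS', rfl⟩ := Finset.mem_image.1 this
    have h1 := hρ i hi hS'
    ext q
    rw [Finset.mem_filter, Finset.mem_symmDiff]
    constructor
    · rintro ⟨h2 | h2, h3⟩
      · exact absurd (h1 h2.1) (not_lt.2 h3)
      · exact h2.1
    · intro h2
      have h3 := hR i hi q h2
      exact ⟨Or.inr ⟨h2, fun h4 => absurd (h1 h4) (not_lt.2 h3)⟩, h3⟩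
  rw [Finset.disjoint_left]
  intro S hi' hj'
  exact hij (hinj i hi j hj ((key i hi S hi').symm.trans (key j hj S hj')))

theorem expect_sum_smul_ket {ι : Type*} [Fintype ι] {e : ι → Finset ℕ}
    (he : Function.Injective e) (c : ι → ℂ) (g : Finset ℕ → ℝ) :
    expect (∑ i, c i • ket (e i)) g = ∑ i, ‖c i‖ ^ 2 * g (e i) := by
  rw [expect_sum_of_disjoint]
  · simp_rw [expect_smul, expect_ket]
  · intro i _ j _ hij
    refine Finset.disjoint_of_subset_left Finsupp.support_smul
      (Finset.disjoint_of_subset_right Finsupp.support_smul ?_)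
    refine Finset.disjoint_of_subset_left Finsupp.support_single_subset
      (Finset.disjoint_of_subset_right Finsupp.support_single_subset ?_)
    rw [Finset.disjoint_singleton]
    exact he.ne hij

theorem bitsToSet_injective {l : ℕ} : Function.Injective (bitsToSet (l := l)) := fun x y h => by
  rw [← readBits_bitsToSet x, h, readBits_bitsToSet]

/-! ### One round of AKR sampling with an approximate Fourier transform -/

/-- The state at the end of a round of AKR sampling, before the measurements. -/
noncomputable def roundState (env : Environment) (C : Circuit) (b : ℕ) (x : Fin env.l → Bool) :
    QState :=
  C.toLin env.lib (applyQuery env 0 b (C.toLinInv env.lib (ket (bitsToSet x))))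

section Round

variable {T : Type*} [Fintype T] {H : AbelianHypergroup T} (env : Environment)
  {encT : T ↪ (Fin env.l → Bool)} {encX : H.Dual ↪ (Fin env.l → Bool)} {C : Circuit} {ε : ℝ}
  {f : T → List Bool} {b : ℕ}

theorem normSq_roundState (hb : env.l ≤ b) (x : Fin env.l → Bool) :
    normSq (roundState env C b x) = 1 := by
  rw [roundState, Circuit.normSq_toLin, normSq_applyQuery env hb, Circuit.normSq_toLinInv,
    normSq_ket]

theorem roundState_mem_statesOn (hb : env.l ≤ b) (x : Fin env.l → Bool) {A : Set ℕ}
    (hl : ∀ q < env.l, q ∈ A) (hC : ∀ q ∈ C.qubits, q ∈ A)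
    (hA : ∀ q, b ≤ q → q < b + (env.m + 1) → q ∈ A) : roundState env C b x ∈ statesOn A :=
  Circuit.toLin_mem_statesOn _ hC (applyQuery_mem_statesOn env hb hA
    (Circuit.toLinInv_mem_statesOn _ hC (ket_mem_statesOn fun q hq =>
      hl q (bitsToSet_subset x q hq))))

/-- The part of the uniform superposition over `T` on which `f` takes the value `y`. -/
noncomputable def fibreState (encT : T ↪ (Fin env.l → Bool)) (f : T → List Bool)
    (y : List Bool) : QState :=
  ∑ a, (if f a = y then star (H.qft H.trivialChar a) else 0) • ket (bitsToSet (encT a))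

/-- The Fourier transform of this part. -/
noncomputable def fibreTransform (encX : H.Dual ↪ (Fin env.l → Bool)) (f : T → List Bool)
    (y : List Bool) : QState :=
  ∑ X : H.Dual, (∑ a, H.qft X a * if f a = y then star (H.qft H.trivialChar a) else 0) •
    ket (bitsToSet (encX X))

/-- The state that an exact round of AKR sampling produces. -/
noncomputable def idealState (encX : H.Dual ↪ (Fin env.l → Bool)) (f : T → List Bool) (b : ℕ) :
    QState :=
  ∑ y ∈ Finset.univ.image f, flipSet (answerSet env.m b y) (fibreTransform env encX f y)

theorem fibreTransform_mem_statesOn (hb : env.l ≤ b) (y : List Bool) :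
    fibreTransform env encX f y ∈ statesOn (Set.Iio b) :=
  Submodule.sum_mem _ fun _ _ => Submodule.smul_mem _ _ (ket_mem_statesOn fun q hq =>
    lt_of_lt_of_le (bitsToSet_subset _ q hq) hb)

theorem fibreState_mem_statesOn (hb : env.l ≤ b) (y : List Bool) :
    fibreState (H := H) env encT f y ∈ statesOn (Set.Iio b) :=
  Submodule.sum_mem _ fun _ _ => Submodule.smul_mem _ _ (ket_mem_statesOn fun q hq =>
    lt_of_lt_of_le (bitsToSet_subset _ q hq) hb)

theorem answerSet_image_injOn (hm : ∀ a, (f a).length ≤ env.m)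
    (b : ℕ) (y : List Bool) (hy : y ∈ Finset.univ.image f) (z : List Bool)
    (hz : z ∈ Finset.univ.image f) (h : answerSet env.m b y = answerSet env.m b z) : y = z := by
  obtain ⟨a, -, rfl⟩ := Finset.mem_image.1 hy
  obtain ⟨a', -, rfl⟩ := Finset.mem_image.1 hz
  exact answerSet_injOn b (hm a) (hm a') h

/-- Distinct oracle values leave distinct patterns in the answer block, so their parts contribute
without interference. This plays the role of the oracle measurement in AKR. -/
theorem expect_idealState (hb : env.l ≤ b) (hm : ∀ a, (f a).length ≤ env.m)
    (h : (Fin env.l → Bool) → ℝ) :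
    expect (idealState env encX f b) (fun S => h (readBits env.l 0 S)) =
      ∑ X, H.akrProb f X * h (encX X) := by
  rw [idealState, expect_sum_flipSet (fun y _ q hq => (answerSet_subset _ _ _ q hq).1)
    (answerSet_image_injOn env hm b) (fun y _ => fibreTransform_mem_statesOn env hb y)]
  have h1 : ∀ y S, readBits env.l 0 (symmDiff S (answerSet env.m b y)) = readBits env.l 0 S :=
    fun y => readBits_symmDiff (fun q hq => (answerSet_subset env.m b y q hq).1) hb
  have h2 : Function.Injective fun X => bitsToSet (encX X) :=
    bitsToSet_injective.comp encX.injective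
  simp_rw [expect_flipSet, h1, fibreTransform, expect_sum_smul_ket h2, readBits_bitsToSet,
    AbelianHypergroup.akrProb_eq, Finset.sum_mul]
  rw [Finset.sum_comm]
  simp_rw [mul_ite, mul_zero]

theorem normSq_idealState (hb : env.l ≤ b) (hm : ∀ a, (f a).length ≤ env.m) :
    normSq (idealState env encX f b) = 1 := by
  rw [normSq_eq_expect, expect_idealState env hb hm (fun _ => 1)]
  simp_rw [mul_one]
  exact H.sum_akrProb f

theorem applyQuery_sum_fibreState (hb : env.l ≤ b)
    (hf : ∀ a, env.oracle (encT a) = f a) :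
    applyQuery env 0 b (∑ a, star (H.qft H.trivialChar a) • ket (bitsToSet (encT a))) =
      ∑ y ∈ Finset.univ.image f, flipSet (answerSet env.m b y) (fibreState (H := H) env encT f y) := by
  rw [map_sum]
  simp_rw [fibreState, map_sum]
  rw [Finset.sum_comm]
  refine Finset.sum_congr rfl fun a _ => ?_
  rw [Finset.sum_eq_single (f a) (fun y _ hy => by rw [if_neg hy.symm, zero_smul, map_zero])
    (fun h => absurd (Finset.mem_image_of_mem f (Finset.mem_univ a)) h), if_pos rfl, map_smul,
    map_smul, applyQuery_ket env hb, readBits_bitsToSet, hf]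

theorem norm_toHilbert_le {ψ : QState} (hε : 0 ≤ ε) (h : normSq ψ ≤ ε ^ 2) :
    ‖toHilbert ψ‖ ≤ ε := by
  rw [← norm_toHilbert_sq] at h
  exact le_of_sq_le_sq h hε

theorem norm_toHilbert_eq_one {ψ : QState} (h : normSq ψ = 1) : ‖toHilbert ψ‖ = 1 := by
  rw [← norm_toHilbert_sq] at h
  exact (pow_eq_one_iff_of_nonneg (norm_nonneg _) two_ne_zero).1 h

/-- One `ε` comes from the inverse circuit (`V` against the exact superposition `χ`), the other from
the forward circuit applied to the queried `χ`. -/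
theorem norm_roundState_sub_idealState_le (hε : 0 ≤ ε)
    (hC : ComputesQFT H encT encX env.lib C ε) (hf : ∀ a, env.oracle (encT a) = f a)
    (hm : ∀ a, (f a).length ≤ env.m) (hb : env.l ≤ b) (hq : ∀ q ∈ C.qubits, q < b) :
    ‖toHilbert (roundState env C b (encX H.trivialChar) - idealState env encX f b)‖ ≤ 2 * ε := by
  set χ : QState := ∑ a, star (H.qft H.trivialChar a) • ket (bitsToSet (encT a)) with hχ
  set V : QState := C.toLinInv env.lib (ket (bitsToSet (encX H.trivialChar))) with hV
  -- The exact transform sends `χ` to the label of the trivial character, which the circuit also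
  -- obtains exactly from `V`; the circuit being isometric, its error on `χ` is the distance of `V`
  -- from `χ`.
  have h1 : normSq (V - χ) ≤ ε ^ 2 := by
    have h := hC fun a => star (H.qft H.trivialChar a)
    have h2 : ∑ X : H.Dual, (∑ a, H.qft X a * star (H.qft H.trivialChar a)) •
        ket (bitsToSet (encX X)) = ket (bitsToSet (encX H.trivialChar)) := by
      classical
      simp_rw [AbelianHypergroup.sum_qft_mul_star, ite_smul, one_smul, zero_smul]
      simp
    rw [h2] at h
    simp_rw [norm_star] at h
    rw [H.norm_sq_qft_trivialChar_sum, mul_one, ← Circuit.toLin_apply,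
      ← Circuit.toLin_toLinInv env.lib C (ket (bitsToSet (encX H.trivialChar))), ← map_sub,
      Circuit.normSq_toLin] at h
    have h3 : V - χ = (-1 : ℂ) • (χ - V) := by module
    rw [h3, normSq_smul, norm_neg, norm_one, one_pow, one_mul]
    exact h
  -- The errors for different answers are orthogonal, so their squares add up to `ε ^ 2` times the
  -- squared norm of `χ`, which is 1.
  have h2 : normSq (C.toLin env.lib (applyQuery env 0 b χ) - idealState env encX f b) ≤ ε ^ 2 := by
    rw [hχ, applyQuery_sum_fibreState env hb hf, idealState, map_sum, ← Finset.sum_sub_distrib]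
    have h3 : ∀ y, C.toLin env.lib (flipSet (answerSet env.m b y) (fibreState (H := H) env encT f y)) -
        flipSet (answerSet env.m b y) (fibreTransform env encX f y) =
        flipSet (answerSet env.m b y) (C.toLin env.lib (fibreState (H := H) env encT f y) -
          fibreTransform env encX f y) := by
      intro y
      rw [Circuit.toLin_flipSet _ (fun q hqC hqR => absurd (hq q hqC)
        (not_lt.2 (answerSet_subset _ _ _ q hqR).1)), map_sub]
    simp_rw [h3]
    rw [normSq_eq_expect, expect_sum_flipSet (fun y _ q hq => (answerSet_subset _ _ _ q hq).1)
      (answerSet_image_injOn env hm b) (fun y _ => Submodule.sub_mem _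
        (Circuit.toLin_mem_statesOn _ (fun q hqC => hq q hqC) (fibreState_mem_statesOn env hb y))
        (fibreTransform_mem_statesOn env hb y))]
    simp_rw [← normSq_eq_expect, normSq_flipSet]
    have h4 : ∀ y, normSq (C.toLin env.lib (fibreState (H := H) env encT f y) -
        fibreTransform env encX f y) ≤
        ε ^ 2 * ∑ a, ‖if f a = y then star (H.qft H.trivialChar a) else 0‖ ^ 2 := by
      intro y
      have h := hC fun a => if f a = y then star (H.qft H.trivialChar a) else 0
      rw [Circuit.toLin_apply]
      exact h
    refine (Finset.sum_le_sum fun y _ => h4 y).trans ?_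
    rw [← Finset.mul_sum, AbelianHypergroup.sum_image_ite_norm_sq]
    simp_rw [norm_star]
    rw [H.norm_sq_qft_trivialChar_sum, mul_one]
  have h3 : roundState env C b (encX H.trivialChar) - idealState env encX f b =
      C.toLin env.lib (applyQuery env 0 b (V - χ)) +
        (C.toLin env.lib (applyQuery env 0 b χ) - idealState env encX f b) := by
    rw [roundState, map_sub, map_sub]
    abel
  rw [h3, map_add, two_mul]
  refine (norm_add_le _ _).trans (add_le_add (norm_toHilbert_le hε ?_) (norm_toHilbert_le hε h2))
  rw [Circuit.normSq_toLin, normSq_applyQuery env hb]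
  exact h1

/-- The outcome distribution of a round is close to that of AKR sampling. -/
theorem abs_expect_roundState_sub_le (hε : 0 ≤ ε)
    (hC : ComputesQFT H encT encX env.lib C ε) (hf : ∀ a, env.oracle (encT a) = f a)
    (hm : ∀ a, (f a).length ≤ env.m) (hb : env.l ≤ b) (hq : ∀ q ∈ C.qubits, q < b)
    {h : (Fin env.l → Bool) → ℝ} (hh : ∀ x, |h x| ≤ 1) :
    |expect (roundState env C b (encX H.trivialChar)) (fun S => h (readBits env.l 0 S)) -
      ∑ X, H.akrProb f X * h (encX X)| ≤ 4 * ε := by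
  rw [← expect_idealState env hb hm]
  refine (abs_expect_sub_le fun S => hh _).trans ?_
  rw [norm_toHilbert_eq_one (normSq_roundState env hb _),
    norm_toHilbert_eq_one (normSq_idealState env hb hm)]
  have := norm_roundState_sub_idealState_le env hε hC hf hm hb hq
  linarith

end Round

/-! ### Reasoning about programs -/

section Semantics

variable (env : Environment)

/-- The sum of `Φ` over all branches that result from running `P` on `s`. -/
noncomputable def branchSum (P : Program) (Φ : Branch → ℝ) (s : Branch) : ℝ :=
  ((P.run env s).map Φ).sum

variable {env} {Φ : Branch → ℝ} {s : Branch}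

theorem sum_map_flatMap {α β : Type*} (L : List α) (h : α → List β) (φ : β → ℝ) :
    ((L.flatMap h).map φ).sum = (L.map fun x => ((h x).map φ).sum).sum := by
  induction L with
  | nil => rfl
  | cons x L ih => simp [ih]

theorem branchSum_skip : branchSum env .skip Φ s = Φ (s.tick 1) := by
  simp [branchSum, Program.run]

/-- Programs act on payoffs of branches contravariantly: the payoff after `d` becomes the payoff
that `c` is evaluated against. -/
theorem branchSum_seq (c d : Program) :
    branchSum env (.seq c d) Φ s = branchSum env c (branchSum env d Φ) s := by
  simp only [branchSum, Program.run]
  rw [sum_map_flatMap]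
  rfl

theorem branchSum_const (r v : ℕ) :
    branchSum env (.const r v) Φ s = Φ ((s.set r v).tick 1) := by
  simp [branchSum, Program.run]

theorem branchSum_add (r a b : ℕ) :
    branchSum env (.add r a b) Φ s = Φ ((s.set r (s.reg a + s.reg b)).tick 1) := by
  simp [branchSum, Program.run]

theorem branchSum_sub (r a b : ℕ) :
    branchSum env (.sub r a b) Φ s = Φ ((s.set r (s.reg a - s.reg b)).tick 1) := by
  simp [branchSum, Program.run]

theorem branchSum_read (r a : ℕ) :
    branchSum env (.read r a) Φ s = Φ ((s.set r (env.input.getD (s.reg a) 0)).tick 1) := by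
  simp [branchSum, Program.run]

theorem branchSum_ifZero (r : ℕ) (c d : Program) : branchSum env (.ifZero r c d) Φ s =
    if s.reg r = 0 then branchSum env c Φ (s.tick 1) else branchSum env d Φ (s.tick 1) := by
  simp only [branchSum, Program.run]
  split_ifs <;> rfl

theorem branchSum_loop (r : ℕ) (c : Program) :
    branchSum env (.loop r c) Φ s = (branchSum env c)^[s.reg r] Φ (s.tick 1) := by
  simp only [branchSum, Program.run]
  have : ∀ n L, (((fun L : List Branch => L.flatMap (c.run env))^[n] L).map Φ).sum =
      (L.map ((branchSum env c)^[n] Φ)).sum := by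
    intro n
    induction n with
    | zero => intro L; rfl
    | succ n ih =>
      intro L
      rw [Function.iterate_succ_apply, Function.iterate_succ_apply', ih, sum_map_flatMap]
      rfl
  rw [this]
  simp

theorem branchSum_gate (g a b : ℕ) : branchSum env (.gate g a b) Φ s =
    Φ ({ s with ψ := applyGate (env.lib (s.reg g)) (s.reg a) (s.reg b) s.ψ }.tick 1) := by
  simp [branchSum, Program.run]

theorem branchSum_gateInv (g a b : ℕ) : branchSum env (.gateInv g a b) Φ s =
    Φ ({ s with ψ := applyGate (env.lib (s.reg g))⁻¹ (s.reg a) (s.reg b) s.ψ }.tick 1) := by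
  simp [branchSum, Program.run]

theorem branchSum_flip (a : ℕ) : branchSum env (.flip a) Φ s =
    Φ ({ s with ψ := flipSet {s.reg a} s.ψ }.tick 1) := by
  simp [branchSum, Program.run, flipSet, applyX]

theorem branchSum_query (a b : ℕ) : branchSum env (.query a b) Φ s =
    Φ ({ s with ψ := applyQuery env (s.reg a) (s.reg b) s.ψ }.tick (env.l + env.m + 1)) := by
  simp [branchSum, Program.run]

theorem branchSum_measure (a r : ℕ) : branchSum env (.measure a r) Φ s =
    Φ (({ s with ψ := s.ψ.filter fun S => s.reg a ∉ S }.set r 0).tick 1) +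
      Φ (({ s with ψ := s.ψ.filter fun S => s.reg a ∈ S }.set r 1).tick 1) := by
  simp [branchSum, Program.run]

theorem branchSum_output (r : ℕ) : branchSum env (.output r) Φ s =
    Φ ({ s with out := s.out ++ [decide (s.reg r ≠ 0)] }.tick 1) := by
  simp [branchSum, Program.run]

theorem Branch.tick_reg (s : Branch) (t : ℕ) : (s.tick t).reg = s.reg := rfl
theorem Branch.set_reg (s : Branch) (r v : ℕ) : (s.set r v).reg = Function.update s.reg r v := rfl

/-- A sequence of programs. -/
def Program.block (L : List Program) : Program := L.foldr .seq .skip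

/-- Functions of the output and the quantum state. -/
abbrev Valuation : Type := List Bool → QState → ℝ

variable (env) in
/-- On branches whose registers satisfy `pre`, the program `P` transforms valuations by `τ`,
and it leads to registers that satisfy `post`. -/
def Implements (pre post : (ℕ → ℕ) → Prop) (P : Program) (τ : Valuation → Valuation) : Prop :=
  ∀ (Φ : Branch → ℝ) (F : Valuation), (∀ s, post s.reg → Φ s = F s.out s.ψ) →
    ∀ s, pre s.reg → branchSum env P Φ s = τ F s.out s.ψ

namespace Implements

variable {A B D : (ℕ → ℕ) → Prop} {P Q : Program} {σ τ : Valuation → Valuation}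

theorem seq (h : Implements env A B P τ) (h' : Implements env B D Q σ) :
    Implements env A D (.seq P Q) fun F => τ (σ F) := fun Φ F hΦ s hs => by
  rw [branchSum_seq]
  exact h _ _ (h' Φ F hΦ) s hs

theorem skip : Implements env A A .skip fun F => F := fun Φ F hΦ s hs => by
  rw [branchSum_skip]
  exact hΦ _ hs

theorem block_nil : Implements env A A (.block []) fun F => F := skip

theorem block_cons {L : List Program} (h : Implements env A B P τ)
    (h' : Implements env B D (.block L) σ) :
    Implements env A D (.block (P :: L)) fun F => τ (σ F) := seq h h'

theorem weaken {A' B' : (ℕ → ℕ) → Prop} (h : Implements env A B P τ) (hA : ∀ ρ, A' ρ → A ρ)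
    (hB : ∀ ρ, B ρ → B' ρ) : Implements env A' B' P τ := fun Φ F hΦ s hs =>
  h Φ F (fun s hs => hΦ s (hB _ hs)) s (hA _ hs)

theorem const {r v : ℕ} (h : ∀ ρ, A ρ → B (Function.update ρ r v)) :
    Implements env A B (.const r v) fun F => F := fun Φ F hΦ s hs => by
  rw [branchSum_const]
  exact hΦ _ (h _ hs)

theorem add {r a b : ℕ} (h : ∀ ρ, A ρ → B (Function.update ρ r (ρ a + ρ b))) :
    Implements env A B (.add r a b) fun F => F := fun Φ F hΦ s hs => by
  rw [branchSum_add]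
  exact hΦ _ (h _ hs)

theorem sub {r a b : ℕ} (h : ∀ ρ, A ρ → B (Function.update ρ r (ρ a - ρ b))) :
    Implements env A B (.sub r a b) fun F => F := fun Φ F hΦ s hs => by
  rw [branchSum_sub]
  exact hΦ _ (h _ hs)

theorem read {r a : ℕ} (h : ∀ ρ, A ρ → B (Function.update ρ r (env.input.getD (ρ a) 0))) :
    Implements env A B (.read r a) fun F => F := fun Φ F hΦ s hs => by
  rw [branchSum_read]
  exact hΦ _ (h _ hs)

theorem ifZero {r : ℕ} (p : Prop) [Decidable p] (hp : ∀ ρ, A ρ → (ρ r = 0 ↔ p))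
    (h : p → Implements env A B P τ) (h' : ¬ p → Implements env A B Q σ) :
    Implements env A B (.ifZero r P Q) (if p then τ else σ) := fun Φ F hΦ s hs => by
  rw [branchSum_ifZero]
  by_cases hr : p
  · rw [if_pos ((hp _ hs).2 hr), if_pos hr]
    exact h hr Φ F hΦ _ hs
  · rw [if_neg (fun hh => hr ((hp _ hs).1 hh)), if_neg hr]
    exact h' hr Φ F hΦ _ hs

/-- The list `xs` is a trace of the passes still to come, and the invariant is indexed by it. Each
pass consumes the head; since effects compose backwards, they accumulate as a `foldr`. -/
theorem loop {ι : Type*} {I : List ι → (ℕ → ℕ) → Prop} {τ : ι → Valuation → Valuation} {r : ℕ}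
    (h : ∀ x xs, Implements env (I (x :: xs)) (I xs) P (τ x)) (xs : List ι)
    (hA : ∀ ρ, A ρ → I xs ρ ∧ ρ r = xs.length) :
    Implements env A (I []) (.loop r P) fun F => xs.foldr τ F := fun Φ F hΦ s hs => by
  rw [branchSum_loop, (hA _ hs).2]
  have key : ∀ xs, ∀ s, I xs s.reg →
      (branchSum env P)^[xs.length] Φ s = xs.foldr τ F s.out s.ψ := by
    intro xs
    induction xs with
    | nil => exact hΦ
    | cons x xs ih =>
      intro s hs
      rw [List.length_cons, Function.iterate_succ_apply']
      exact h x xs _ _ ih s hs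
  exact key xs _ (hA _ hs).1

/-- Allows a proof about a loop body to fix register values found at entry, such as the current
input position, as constants. -/
theorem of_forall (h : ∀ ρ, A ρ → ∃ A' : (ℕ → ℕ) → Prop, A' ρ ∧ Implements env A' B P τ) :
    Implements env A B P τ := fun Φ F hΦ s hs => by
  obtain ⟨A', h1, h2⟩ := h _ hs
  exact h2 Φ F hΦ s h1

theorem init_loop {ι : Type*} {I : List ι → (ℕ → ℕ) → Prop} {τ : ι → Valuation → Valuation}
    {r : ℕ} (xs : List ι)
    (hP : Implements env A (fun ρ => I xs ρ ∧ ρ r = xs.length) P fun F => F)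
    (hQ : ∀ x xs, Implements env (I (x :: xs)) (I xs) Q (τ x)) (hB : ∀ ρ, I [] ρ → B ρ) :
    Implements env A B (.block [P, .loop r Q]) fun F => xs.foldr τ F :=
  hP.block_cons (block_cons ((loop hQ xs fun _ h => h).weaken (fun _ h => h) hB) block_nil)

theorem gate {g a b g' a' b' : ℕ} (h : ∀ ρ, A ρ → ρ g = g' ∧ ρ a = a' ∧ ρ b = b') :
    Implements env A A (.gate g a b)
      fun F out ψ => F out (applyGate (env.lib g') a' b' ψ) := fun Φ F hΦ s hs => by
  obtain ⟨rfl, rfl, rfl⟩ := h _ hs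
  rw [branchSum_gate]
  exact hΦ _ hs

theorem gateInv {g a b g' a' b' : ℕ} (h : ∀ ρ, A ρ → ρ g = g' ∧ ρ a = a' ∧ ρ b = b') :
    Implements env A A (.gateInv g a b)
      fun F out ψ => F out (applyGate (env.lib g')⁻¹ a' b' ψ) := fun Φ F hΦ s hs => by
  obtain ⟨rfl, rfl, rfl⟩ := h _ hs
  rw [branchSum_gateInv]
  exact hΦ _ hs

theorem flip {a a' : ℕ} (h : ∀ ρ, A ρ → ρ a = a') :
    Implements env A A (.flip a) fun F out ψ => F out (flipSet {a'} ψ) := fun Φ F hΦ s hs => by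
  obtain rfl := h _ hs
  rw [branchSum_flip]
  exact hΦ _ hs

theorem query {a b a' b' : ℕ} (h : ∀ ρ, A ρ → ρ a = a' ∧ ρ b = b') :
    Implements env A A (.query a b)
      fun F out ψ => F out (applyQuery env a' b' ψ) := fun Φ F hΦ s hs => by
  obtain ⟨rfl, rfl⟩ := h _ hs
  rw [branchSum_query]
  exact hΦ _ hs

end Implements

/-- The effect of measuring qubit `q` and resetting it. -/
noncomputable def resetEffect (q : ℕ) (F : Valuation) : Valuation := fun out ψ =>
  F out (ψ.filter fun S => q ∉ S) + F out (flipSet {q} (ψ.filter fun S => q ∈ S))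

/-- The effect of measuring qubit `q`, writing the result on the output tape, and resetting it. -/
noncomputable def measureEffect (q : ℕ) (F : Valuation) : Valuation := fun out ψ =>
  F (out ++ [false]) (ψ.filter fun S => q ∉ S) +
    F (out ++ [true]) (flipSet {q} (ψ.filter fun S => q ∈ S))

/-- Reset the qubit with address in register `r`, using register `12`. -/
def resetQubit (r : ℕ) : Program :=
  .block [.measure r 12, .ifZero 12 .skip (.flip r)]

/-- Measure the qubit with address in register `r`, write the result on the output tape and reset
the qubit, using register `12`. -/
def measureQubit (r : ℕ) : Program :=
  .block [.measure r 12, .output 12, .ifZero 12 .skip (.flip r)]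

/-- Register 12 receives the outcome, so the address must be kept elsewhere and the invariant must
not see that register. -/
theorem implements_resetQubit {A : (ℕ → ℕ) → Prop} {r q : ℕ} (hr : r ≠ 12)
    (h : ∀ ρ, A ρ → ρ r = q) (hA : ∀ ρ v, A ρ → A (Function.update ρ 12 v)) :
    Implements env A A (resetQubit r) (resetEffect q) := fun Φ F hΦ s hs => by
  obtain rfl := h _ hs
  simp only [resetQubit, Program.block, List.foldr, branchSum_seq, branchSum_measure,
    branchSum_ifZero, branchSum_skip, branchSum_flip, Branch.tick_reg, Branch.set_reg,
    Function.update_self, if_true, one_ne_zero, if_false, Function.update_of_ne hr]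
  rw [hΦ _ (hA _ _ hs), hΦ _ (hA _ _ hs)]
  rfl

theorem implements_measureQubit {A : (ℕ → ℕ) → Prop} {r q : ℕ} (hr : r ≠ 12)
    (h : ∀ ρ, A ρ → ρ r = q) (hA : ∀ ρ v, A ρ → A (Function.update ρ 12 v)) :
    Implements env A A (measureQubit r) (measureEffect q) := fun Φ F hΦ s hs => by
  obtain rfl := h _ hs
  simp only [measureQubit, Program.block, List.foldr, branchSum_seq, branchSum_measure,
    branchSum_output,
    branchSum_ifZero, branchSum_skip, branchSum_flip, Branch.tick_reg, Branch.set_reg,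
    Function.update_self, if_true, one_ne_zero, if_false, Function.update_of_ne hr]
  rw [hΦ _ (hA _ _ hs), hΦ _ (hA _ _ hs)]
  simp [Branch.tick, Branch.set, measureEffect]

end Semantics

/-! ### The effect of measurements -/

theorem filter_notMem_mem_statesOn {A : Set ℕ} {ψ : QState} (hψ : ψ ∈ statesOn A) (q : ℕ) :
    ψ.filter (fun S => q ∉ S) ∈ statesOn (A \ {q}) := by
  intro S hS r hr
  rw [Finset.mem_coe, Finsupp.support_filter, Finset.mem_filter] at hS
  refine ⟨hψ hS.1 hr, ?_⟩
  rintro rfl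
  exact hS.2 hr

theorem flipSet_filter_mem_statesOn {A : Set ℕ} {ψ : QState} (hψ : ψ ∈ statesOn A) (q : ℕ) :
    flipSet {q} (ψ.filter fun S => q ∈ S) ∈ statesOn (A \ {q}) := by
  intro S hS r hr
  obtain ⟨S', hS', rfl⟩ := Finset.mem_image.1 (Finsupp.mapDomain_support hS)
  rw [Finsupp.support_filter, Finset.mem_filter] at hS'
  rcases Finset.mem_symmDiff.1 (Finset.mem_coe.1 hr) with h | h
  · exact ⟨hψ hS'.1 h.1, fun hh => h.2 (by simpa using hh)⟩
  · rw [Finset.mem_singleton.1 h.1] at h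
    exact absurd hS'.2 h.2

/-- Either outcome leaves the qubit at 0, so it drops out of `A`, and the squared norms of the two
branches add up to that of `ψ`. The outcomes are therefore summed out. -/
theorem foldr_resetEffect {F : Valuation} {κ : List Bool → ℝ} (qs : List ℕ) {A : Set ℕ}
    (hF : ∀ out, ∀ ψ ∈ statesOn (A \ {q | q ∈ qs}), F out ψ = normSq ψ * κ out)
    (out : List Bool) {ψ : QState} (hψ : ψ ∈ statesOn A) :
    qs.foldr resetEffect F out ψ = normSq ψ * κ out := by
  induction qs generalizing A ψ with
  | nil => exact hF out ψ (by simpa using hψ)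
  | cons q qs ih =>
    have h : (A \ {q}) \ {r | r ∈ qs} = A \ {r | r ∈ q :: qs} := by
      ext r
      simp [and_assoc]
    rw [List.foldr_cons, resetEffect,
      ih (A := A \ {q}) (by rwa [h]) (filter_notMem_mem_statesOn hψ q),
      ih (A := A \ {q}) (by rwa [h]) (flipSet_filter_mem_statesOn hψ q), normSq_flipSet, ← add_mul,
      normSq_eq_expect, normSq_eq_expect, expect_filter_add ψ (fun S => q ∈ S), ← normSq_eq_expect]

/-- Resetting qubit `i` leaves the later bits alone, so measuring one by one gives the joint
distribution of all bits in the original state. -/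
theorem foldr_measureEffect {F : Valuation} {κ : List Bool → ℝ} (i n : ℕ) {A : Set ℕ}
    (hF : ∀ out, ∀ ψ ∈ statesOn (A \ {q | q ∈ List.range' i n}), F out ψ = normSq ψ * κ out)
    (out : List Bool) {ψ : QState} (hψ : ψ ∈ statesOn A) :
    (List.range' i n).foldr measureEffect F out ψ =
      expect ψ fun S => κ (out ++ (List.range' i n).map fun q => decide (q ∈ S)) := by
  induction n generalizing A ψ i out with
  | zero =>
    rw [List.range'_zero, List.foldr_nil, hF out ψ (by simpa using hψ), ← expect_const]
    simp
  | succ n ih =>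
    have h : (A \ {i}) \ {r | r ∈ List.range' (i + 1) n} = A \ {r | r ∈ List.range' i (n + 1)} := by
      ext r
      simp [List.range'_succ, and_assoc]
    rw [List.range'_succ, List.foldr_cons, measureEffect,
      ih (A := A \ {i}) (i + 1) (by rwa [h]) _ (filter_notMem_mem_statesOn hψ i),
      ih (A := A \ {i}) (i + 1) (by rwa [h]) _ (flipSet_filter_mem_statesOn hψ i), expect_flipSet,
      ← expect_filter_add ψ (fun S => i ∈ S)]
    congr 1
    · refine expect_congr fun S hS => ?_
      rw [Finsupp.support_filter, Finset.mem_filter] at hS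
      simp [hS.2]
    · refine expect_congr fun S hS => ?_
      rw [Finsupp.support_filter, Finset.mem_filter] at hS
      have : (List.range' (i + 1) n).map (fun q => decide (q ∈ symmDiff S {i})) =
          (List.range' (i + 1) n).map fun q => decide (q ∈ S) := by
        refine List.map_congr_left fun q hq => ?_
        have hq' : q ≠ i := by
          have := List.mem_range'_1.1 hq
          omega
        simp [Finset.mem_symmDiff, hq']
      rw [this]
      simp [hS.2]

theorem map_range'_eq_ofFn_readBits (l : ℕ) (S : Finset ℕ) :
    ((List.range' 0 l).map fun q => decide (q ∈ S)) = List.ofFn (readBits l 0 S) := by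
  refine List.ext_getElem (by simp) fun i h1 h2 => ?_
  simp [readBits]

/-! ### The program -/

namespace AKRProgram

open Program

/-- Read the input into the registers `2` (label length), `3` (answer length), `5` (number of
rounds), `4` (number of gates), and compute the registers `7` (position of the first gate in the
input) and `9` (size of the answer block). -/
def readHeader : Program :=
  block [.const 1 1, .read 2 0, .read 3 1, .const 10 2, .read 5 10, .add 5 5 2, .const 10 3,
    .read 4 10, .const 10 4, .add 7 10 2, .add 9 3 1, .add 6 0 2, .add 10 7 0]

/-- Increase register `6` by the address of a qubit and by one. -/
def scanAddress : Program := block [.add 10 10 1, .read 14 10, .add 6 6 14, .add 6 6 1]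

/-- Compute the registers `6` (an address beyond those of the circuit) and `8` (the position
after the last gate in the input). -/
def scanCircuit : Program :=
  block [.loop 4 (block [scanAddress, scanAddress, .add 10 10 1]), .add 8 10 0]

/-- Read the gate at input position `10` into the registers `13`, `14`, `15`. -/
def loadGate : Program :=
  block [.read 13 10, .add 12 10 1, .read 14 12, .add 12 12 1, .read 15 12]

/-- Write the label of the trivial character into the first qubits. -/
def writeLabel : Program :=
  block [.const 11 0, .const 10 4, .loop 2
    (block [.read 12 10, .ifZero 12 .skip (.flip 11), .add 10 10 1, .add 11 11 1])]

/-- Apply the inverse of the circuit. -/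
def applyInverse : Program :=
  block [.add 10 8 0, .loop 4
    (block [.const 16 3, .sub 10 10 16, loadGate, .gateInv 13 14 15])]

/-- Apply the circuit. -/
def applyForward : Program :=
  block [.add 10 7 0, .loop 4
    (block [loadGate, .gate 13 14 15, .const 16 3, .add 10 10 16])]

/-- Measure and reset the first qubits and write the results on the output tape. -/
def measureLabel : Program :=
  block [.const 11 0, .loop 2 (block [measureQubit 11, .add 11 11 1])]

/-- Reset the qubits of the circuit. -/
def resetCircuit : Program :=
  block [.add 10 7 0, .loop 4
    (block [loadGate, resetQubit 14, resetQubit 15, .const 16 3, .add 10 10 16])]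

/-- Reset the answer block. -/
def resetAnswer : Program :=
  block [.add 11 6 0, .loop 9 (block [resetQubit 11, .add 11 11 1])]

/-- One round of AKR sampling. -/
def round : Program :=
  block [writeLabel, applyInverse, .query 0 6, applyForward, measureLabel, resetCircuit,
    resetAnswer]

/-- The part of the program after reading the header. -/
def main : Program := block [scanCircuit, .loop 5 round]

/-- The program that solves the hidden subhypergroup problem. -/
def program : Program := .seq readHeader main

/-! ### Correctness of the parts of the program -/

section

variable {env : Environment} {S t b : ℕ}

/-- The contents of the permanent registers after the initialization. -/
def Ready (env : Environment) (S t b : ℕ) (ρ : ℕ → ℕ) : Prop :=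
  ρ 0 = 0 ∧ ρ 1 = 1 ∧ ρ 2 = env.l ∧ ρ 4 = S ∧ ρ 5 = t ∧ ρ 6 = b ∧ ρ 7 = 4 + env.l ∧
    ρ 8 = 4 + env.l + 3 * S ∧ ρ 9 = env.m + 1

theorem Ready.update {ρ : ℕ → ℕ} (h : Ready env S t b ρ) {r : ℕ} (hr : 9 < r) (v : ℕ) :
    Ready env S t b (Function.update ρ r v) := by
  have hne : ∀ i ≤ 9, Function.update ρ r v i = ρ i := fun i hi =>
    Function.update_of_ne (by omega) _ _
  unfold Ready
  rw [hne 0 (by omega), hne 1 (by omega), hne 2 (by omega), hne 4 (by omega), hne 5 (by omega),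
    hne 6 (by omega), hne 7 (by omega), hne 8 (by omega), hne 9 (by omega)]
  exact h

/-- The gate `g` is stored in the input at position `p`. -/
def GateAt (env : Environment) (p : ℕ) (g : ℕ × ℕ × ℕ) : Prop :=
  env.input.getD p 0 = g.1 ∧ env.input.getD (p + 1) 0 = g.2.1 ∧ env.input.getD (p + 2) 0 = g.2.2

/-- The gates of the circuit `C` are stored in the input from position `p` on. -/
def GatesAt (env : Environment) (p : ℕ) : Circuit → Prop
  | [] => True
  | g :: C => GateAt env p g ∧ GatesAt env (p + 3) C

/-- The gates of the circuit `C` are stored in the input in reverse order before position `p`. -/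
def GatesBefore (env : Environment) (p : ℕ) : Circuit → Prop
  | [] => True
  | g :: C => GateAt env (p - 3) g ∧ GatesBefore env (p - 3) C

theorem gatesBefore_append {p : ℕ} {C D : Circuit} (hC : GatesBefore env p C)
    (hD : GatesBefore env (p - 3 * C.length) D) : GatesBefore env p (C ++ D) := by
  induction C generalizing p with
  | nil => simpa using hD
  | cons g C ih =>
    refine ⟨hC.1, ih hC.2 ?_⟩
    rw [List.length_cons] at hD
    rwa [show p - 3 - 3 * C.length = p - 3 * (C.length + 1) by omega]

theorem GatesAt.reverse {p : ℕ} {C : Circuit} (h : GatesAt env p C) :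
    GatesBefore env (p + 3 * C.length) C.reverse := by
  induction C generalizing p with
  | nil => trivial
  | cons g C ih =>
    rw [List.reverse_cons]
    refine gatesBefore_append ?_ ?_
    · rw [List.length_cons, show p + 3 * (C.length + 1) = p + 3 + 3 * C.length by omega]
      exact ih h.2
    · rw [List.length_reverse, List.length_cons,
        show p + 3 * (C.length + 1) - 3 * C.length = p + 3 by omega]
      exact ⟨by simpa using h.1, trivial⟩

theorem implements_loadGate {A : (ℕ → ℕ) → Prop} {p : ℕ} {g : ℕ × ℕ × ℕ} (hg : GateAt env p g)
    (hA : ∀ ρ, A ρ → ρ 1 = 1 ∧ ρ 10 = p)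
    (hu : ∀ ρ r v, A ρ → 11 < r → A (Function.update ρ r v)) :
    Implements env A (fun ρ => A ρ ∧ ρ 13 = g.1 ∧ ρ 14 = g.2.1 ∧ ρ 15 = g.2.2) loadGate
      fun F => F := fun Φ F hΦ s hs => by
  obtain ⟨h1, h2⟩ := hA _ hs
  obtain ⟨hg1, hg2, hg3⟩ := hg
  simp only [loadGate, block, List.foldr, branchSum_seq, branchSum_read, branchSum_add,
    branchSum_skip, Branch.tick_reg, Branch.set_reg]
  rw [hΦ]
  · rfl
  refine ⟨?_, ?_⟩
  · simp only [Branch.tick_reg, Branch.set_reg]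
    exact hu _ _ _ (hu _ _ _ (hu _ _ _ (hu _ _ _ (hu _ _ _ hs (by omega)) (by omega)) (by omega))
      (by omega)) (by omega)
  · simp only [Branch.tick_reg, Branch.set_reg]
    simp [Function.update, h1, h2, hg1, hg2, hg3, -List.getD_eq_getElem?_getD]

theorem foldr_pairs {α β V : Type*} (h : α → List β) (τ : β → V → V) (F : V) (L : List α) :
    L.foldr (fun x F => (h x).foldr τ F) F = (L.flatMap h).foldr τ F := by
  induction L with
  | nil => rfl
  | cons x L ih => rw [List.foldr_cons, ih, List.flatMap_cons, List.foldr_append]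

/-- The gates of `C` are stored in the input from the position in register `10` on. -/
def Forward (env : Environment) (S t b : ℕ) (C : Circuit) (ρ : ℕ → ℕ) : Prop :=
  Ready env S t b ρ ∧ GatesAt env (ρ 10) C

/-- The position in register `10` is `p`. -/
def AtPosition (env : Environment) (S t b p : ℕ) (ρ : ℕ → ℕ) : Prop :=
  Ready env S t b ρ ∧ ρ 10 = p

/-- The gate at position `p` has been read. -/
def Loaded (env : Environment) (S t b p : ℕ) (g : ℕ × ℕ × ℕ) (ρ : ℕ → ℕ) : Prop :=
  AtPosition env S t b p ρ ∧ ρ 13 = g.1 ∧ ρ 14 = g.2.1 ∧ ρ 15 = g.2.2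

theorem AtPosition.update {ρ : ℕ → ℕ} {p : ℕ} (h : AtPosition env S t b p ρ) {r : ℕ}
    (hr : 10 < r) (v : ℕ) : AtPosition env S t b p (Function.update ρ r v) :=
  ⟨h.1.update (by omega) v, by rw [Function.update_of_ne (by omega)]; exact h.2⟩

theorem implements_load {p : ℕ} {g : ℕ × ℕ × ℕ} (hg : GateAt env p g) :
    Implements env (AtPosition env S t b p) (Loaded env S t b p g) loadGate fun F => F :=
  implements_loadGate hg (fun _ h => ⟨h.1.2.1, h.2⟩) fun _ _ v h hr => h.update (by omega) v

theorem Loaded.update {ρ : ℕ → ℕ} {p : ℕ} {g : ℕ × ℕ × ℕ} (h : Loaded env S t b p g ρ) (v : ℕ) :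
    Loaded env S t b p g (Function.update ρ 12 v) :=
  ⟨h.1.update (by omega) v, by simpa [Function.update] using h.2⟩

theorem implements_advance {p : ℕ} {C : Circuit} {g : ℕ × ℕ × ℕ}
    (hC : GatesAt env (p + 3) C) : Implements env (Loaded env S t b p g) (Forward env S t b C)
      (block [.const 16 3, .add 10 10 16]) fun F => F := by
  have h1 : Implements env (Loaded env S t b p g)
      (fun ρ => AtPosition env S t b p ρ ∧ ρ 16 = 3) (.const 16 3) fun F => F :=
    Implements.const fun ρ h => ⟨h.1.update (by omega) _, by simp⟩
  have h2 : Implements env (fun ρ => AtPosition env S t b p ρ ∧ ρ 16 = 3)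
      (Forward env S t b C) (.add 10 10 16) fun F => F :=
    Implements.add fun ρ h => ⟨h.1.1.update (by omega) _, by simpa [h.1.2, h.2] using hC⟩
  exact h1.block_cons (h2.block_cons Implements.block_nil)

theorem implements_startForward {C : Circuit} (hC : GatesAt env (4 + env.l) C)
    (hS : C.length = S) : Implements env (Ready env S t b)
      (fun ρ => Forward env S t b C ρ ∧ ρ 4 = C.length) (.add 10 7 0) fun F => F :=
  Implements.add fun ρ h => ⟨⟨h.update (by omega) _, by
    simpa [h.1, h.2.2.2.2.2.2.1] using hC⟩, by simp [h.2.2.2.1, hS]⟩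

/-- A qubit used by several gates is reset several times, which does no harm. -/
theorem implements_resetCircuit {C : Circuit} (hC : GatesAt env (4 + env.l) C) (hS : C.length = S) :
    Implements env (Ready env S t b) (Ready env S t b) resetCircuit
      fun F => C.qubits.foldr resetEffect F := by
  simp only [Circuit.qubits, ← foldr_pairs]
  refine Implements.init_loop C (implements_startForward hC hS)
    (fun g C => Implements.of_forall fun ρ h => ⟨AtPosition env S t b (ρ 10), ⟨h.1, rfl⟩, ?_⟩) fun ρ h => h.1
  have h1 := implements_load (S := S) (t := t) (b := b) h.2.1
  have h2 : Implements env (Loaded env S t b (ρ 10) g) (Loaded env S t b (ρ 10) g) (resetQubit 14)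
      (resetEffect g.2.1) :=
    implements_resetQubit (by norm_num) (fun _ h => h.2.2.1) fun _ v h => h.update v
  have h3 : Implements env (Loaded env S t b (ρ 10) g) (Loaded env S t b (ρ 10) g) (resetQubit 15)
      (resetEffect g.2.2) :=
    implements_resetQubit (by norm_num) (fun _ h => h.2.2.2) fun _ v h => h.update v
  exact h1.block_cons (h2.block_cons (h3.block_cons (implements_advance h.2.2)))

theorem foldr_gate (lib : GateLibrary) (C : Circuit) (F : Valuation) :
    C.foldr (fun g F out ψ => F out (applyGate (lib g.1) g.2.1 g.2.2 ψ)) F =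
      fun out ψ => F out (C.toLin lib ψ) := by
  induction C with
  | nil => rfl
  | cons g C ih => rw [List.foldr_cons, ih]; rfl

theorem foldr_gateInv (lib : GateLibrary) (C : Circuit) (F : Valuation) :
    C.reverse.foldr (fun g F out ψ => F out (applyGate (lib g.1)⁻¹ g.2.1 g.2.2 ψ)) F =
      fun out ψ => F out (C.toLinInv lib ψ) := by
  induction C generalizing F with
  | nil => rfl
  | cons g C ih => rw [List.reverse_cons, List.foldr_append, ih]; rfl

theorem implements_applyForward {C : Circuit} (hC : GatesAt env (4 + env.l) C)
    (hS : C.length = S) : Implements env (Ready env S t b) (Ready env S t b) applyForward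
      fun F out ψ => F out (C.toLin env.lib ψ) := by
  have h : Implements env (Ready env S t b) (Ready env S t b) applyForward
      fun F => C.foldr (fun g F out ψ => F out (applyGate (env.lib g.1) g.2.1 g.2.2 ψ)) F := by
    refine Implements.init_loop C (implements_startForward hC hS)
      (fun g C => Implements.of_forall fun ρ h => ⟨AtPosition env S t b (ρ 10), ⟨h.1, rfl⟩, ?_⟩) fun ρ h => h.1
    have h1 := implements_load (S := S) (t := t) (b := b) h.2.1
    have h2 := Implements.gate (env := env) (A := Loaded env S t b (ρ 10) g) (g := 13) (a := 14)
      (b := 15) fun _ h => h.2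
    exact h1.block_cons (h2.block_cons (implements_advance h.2.2))
  simpa only [foldr_gate] using h

/-- Register 10 starts just after the last gate and steps back by 3 before each load, so the inverse
gates are applied in reverse order. -/
theorem implements_applyInverse {C : Circuit} (hC : GatesAt env (4 + env.l) C)
    (hS : C.length = S) : Implements env (Ready env S t b) (Ready env S t b) applyInverse
      fun F out ψ => F out (C.toLinInv env.lib ψ) := by
  have h : Implements env (Ready env S t b) (Ready env S t b) applyInverse fun F =>
      C.reverse.foldr (fun g F out ψ => F out (applyGate (env.lib g.1)⁻¹ g.2.1 g.2.2 ψ)) F := by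
    have h0 : Implements env (Ready env S t b) (fun ρ => (Ready env S t b ρ ∧
        GatesBefore env (ρ 10) C.reverse) ∧ ρ 4 = C.reverse.length) (.add 10 8 0) fun F => F :=
      Implements.add fun ρ h => ⟨⟨h.update (by omega) _, by
        simpa [h.1, h.2.2.2.2.2.2.2.1, hS] using hC.reverse⟩, by simp [h.2.2.2.1, hS]⟩
    refine Implements.init_loop
      (I := fun C ρ => Ready env S t b ρ ∧ GatesBefore env (ρ 10) C) C.reverse h0
      (fun g C => Implements.of_forall fun ρ h => ⟨AtPosition env S t b (ρ 10), ⟨h.1, rfl⟩, ?_⟩)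
      fun ρ h => h.1
    have h1 : Implements env (AtPosition env S t b (ρ 10))
        (fun ρ' => AtPosition env S t b (ρ 10) ρ' ∧ ρ' 16 = 3) (.const 16 3) fun F => F :=
      Implements.const fun ρ h => ⟨h.update (by omega) _, by simp⟩
    have h2 : Implements env (fun ρ' => AtPosition env S t b (ρ 10) ρ' ∧ ρ' 16 = 3)
        (AtPosition env S t b (ρ 10 - 3)) (.sub 10 10 16) fun F => F :=
      Implements.sub fun ρ h => ⟨h.1.1.update (by omega) _, by simp [h.1.2, h.2]⟩
    have h3 := implements_load (S := S) (t := t) (b := b) h.2.1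
    have h4 := (Implements.gateInv (env := env) (A := Loaded env S t b (ρ 10 - 3) g) (g := 13)
      (a := 14) (b := 15) fun _ h => h.2).weaken (fun _ h => h)
      (B' := fun ρ => Ready env S t b ρ ∧ GatesBefore env (ρ 10) C)
      fun _ h' => ⟨h'.1.1, h'.1.2 ▸ h.2.2⟩
    exact h1.block_cons (h2.block_cons (h3.block_cons (h4.block_cons Implements.block_nil)))
  simpa only [foldr_gateInv] using h

/-- Register `11` runs through the interval `xs`. -/
def Running (env : Environment) (S t b : ℕ) (xs : List ℕ) (ρ : ℕ → ℕ) : Prop :=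
  Ready env S t b ρ ∧ xs = List.range' (ρ 11) xs.length

theorem implements_running {P : Program} {τ : ℕ → Valuation → Valuation}
    (h : ∀ q, Implements env (fun ρ => Ready env S t b ρ ∧ ρ 11 = q)
      (fun ρ => Ready env S t b ρ ∧ ρ 11 = q) P (τ q)) (q : ℕ) (xs : List ℕ) :
    Implements env (Running env S t b (q :: xs)) (Running env S t b xs)
      (block [P, .add 11 11 1]) (τ q) := by
  refine Implements.of_forall fun ρ hρ => ⟨fun ρ => Ready env S t b ρ ∧ ρ 11 = q, ?_, ?_⟩
  · have := hρ.2
    rw [List.length_cons, List.range'_succ, List.cons.injEq] at this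
    exact ⟨hρ.1, this.1.symm⟩
  have h1 : Implements env (fun ρ => Ready env S t b ρ ∧ ρ 11 = q) (Running env S t b xs)
      (.add 11 11 1) fun F => F := Implements.add fun ρ' h' => ⟨h'.1.update (by omega) _, by
    have := hρ.2
    rw [List.length_cons, List.range'_succ, List.cons.injEq] at this
    rw [Function.update_self, h'.2, h'.1.2.1, this.1]
    exact this.2⟩
  exact (h q).block_cons (h1.block_cons Implements.block_nil)

theorem implements_resetAnswer :
    Implements env (Ready env S t b) (Ready env S t b) resetAnswer
      fun F => (List.range' b (env.m + 1)).foldr resetEffect F := by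
  have h0 : Implements env (Ready env S t b) (fun ρ => Running env S t b
      (List.range' b (env.m + 1)) ρ ∧ ρ 9 = (List.range' b (env.m + 1)).length) (.add 11 6 0)
      fun F => F :=
    Implements.add fun ρ h => ⟨⟨h.update (by omega) _, by simp [h.1, h.2.2.2.2.2.1]⟩, by
      simp [h.2.2.2.2.2.2.2.2]⟩
  exact Implements.init_loop _ h0 (implements_running fun q =>
    implements_resetQubit (by norm_num) (fun _ h => h.2) fun ρ v h =>
      ⟨h.1.update (by omega) _, by simpa [Function.update] using h.2⟩) fun _ h => h.1

theorem implements_measureLabel :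
    Implements env (Ready env S t b) (Ready env S t b) measureLabel
      fun F => (List.range' 0 env.l).foldr measureEffect F := by
  have h0 : Implements env (Ready env S t b) (fun ρ => Running env S t b
      (List.range' 0 env.l) ρ ∧ ρ 2 = (List.range' 0 env.l).length) (.const 11 0)
      fun F => F :=
    Implements.const fun ρ h => ⟨⟨h.update (by omega) _, by simp⟩, by simp [h.2.2.1]⟩
  exact Implements.init_loop _ h0 (implements_running fun q =>
    implements_measureQubit (by norm_num) (fun _ h => h.2) fun ρ v h =>
      ⟨h.1.update (by omega) _, by simpa [Function.update] using h.2⟩) fun _ h => h.1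

/-- Flip qubit `q` if the bit `q` of the label of the trivial character is `1`. -/
noncomputable def writeEffect (env : Environment) (q : ℕ) : Valuation → Valuation :=
  if env.input.getD (4 + q) 0 = 0 then fun F => F else fun F out ψ => F out (flipSet {q} ψ)

theorem implements_writeLabel :
    Implements env (Ready env S t b) (Ready env S t b) writeLabel
      fun F => (List.range' 0 env.l).foldr (writeEffect env) F := by
  have h0 : Implements env (Ready env S t b) (fun ρ => Ready env S t b ρ ∧ ρ 11 = 0)
      (.const 11 0) fun F => F :=
    Implements.const fun ρ h => ⟨h.update (by omega) _, by simp⟩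
  have h1 : Implements env (fun ρ => Ready env S t b ρ ∧ ρ 11 = 0) (fun ρ => (Running env S t b
      (List.range' 0 env.l) ρ ∧ ρ 10 = 4 + ρ 11) ∧ ρ 2 = (List.range' 0 env.l).length)
      (.const 10 4) fun F => F :=
    Implements.const fun ρ h => ⟨⟨⟨h.1.update (by omega) _, by simp [h.2]⟩, by simp [h.2]⟩,
      by simp [h.1.2.2.1]⟩
  refine h0.block_cons (Implements.init_loop
    (I := fun xs ρ => Running env S t b xs ρ ∧ ρ 10 = 4 + ρ 11) _ h1
    (fun q xs => Implements.of_forall fun ρ hρ => ?_) fun ρ h => h.1.1)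
  obtain ⟨⟨hρ1, hρ2⟩, hρ3⟩ := hρ
  rw [List.length_cons, List.range'_succ, List.cons.injEq] at hρ2
  let A : (ℕ → ℕ) → Prop := fun ρ => Ready env S t b ρ ∧ ρ 11 = q ∧ ρ 10 = 4 + q
  refine ⟨A, ⟨hρ1, hρ2.1.symm, by rw [hρ3, ← hρ2.1]⟩, ?_⟩
  have h2 : Implements env A (fun ρ => A ρ ∧ ρ 12 = env.input.getD (4 + q) 0) (.read 12 10)
      fun F => F := Implements.read fun ρ h =>
    ⟨⟨h.1.update (by omega) _, by simpa [Function.update] using h.2⟩,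
      by rw [Function.update_self, h.2.2]⟩
  -- The branch depends on the input alone, so the effect can be selected by a proposition about the
  -- input.
  have h3 : Implements env (fun ρ => A ρ ∧ ρ 12 = env.input.getD (4 + q) 0) A
      (.ifZero 12 .skip (.flip 11)) (writeEffect env q) :=
    Implements.ifZero (env.input.getD (4 + q) 0 = 0) (fun ρ h => by rw [h.2])
      (fun _ => Implements.skip.weaken (fun _ h => h) fun _ h => h.1)
      (fun _ => (Implements.flip fun _ h => h.1.2.1).weaken (fun _ h => h) fun _ h => h.1)
  have h4 : Implements env A (fun ρ => Ready env S t b ρ ∧ ρ 11 = q ∧ ρ 10 = 4 + (q + 1))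
      (.add 10 10 1) fun F => F := Implements.add fun ρ h =>
    ⟨h.1.update (by omega) _, by simpa [Function.update] using h.2.1, by
      rw [Function.update_self, h.1.2.1, h.2.2, add_assoc]⟩
  have h5 : Implements env (fun ρ => Ready env S t b ρ ∧ ρ 11 = q ∧ ρ 10 = 4 + (q + 1))
      (fun ρ => Running env S t b xs ρ ∧ ρ 10 = 4 + ρ 11) (.add 11 11 1) fun F => F :=
    Implements.add fun ρ' h => ⟨⟨h.1.update (by omega) _, by
      rw [Function.update_self, h.2.1, h.1.2.1, hρ2.1]; exact hρ2.2⟩, by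
      simp [h.2.1, h.2.2, h.1.2.1]⟩
  exact h2.block_cons (h3.block_cons (h4.block_cons (h5.block_cons Implements.block_nil)))

/-- The effect of a round. -/
noncomputable def roundEffect (env : Environment) (C : Circuit) (b : ℕ) (F : Valuation) :
    Valuation :=
  (List.range' 0 env.l).foldr (writeEffect env) fun out ψ =>
    (List.range' 0 env.l).foldr measureEffect
      (C.qubits.foldr resetEffect ((List.range' b (env.m + 1)).foldr resetEffect F)) out
      (C.toLin env.lib (applyQuery env 0 b (C.toLinInv env.lib ψ)))

theorem implements_round {C : Circuit} (hC : GatesAt env (4 + env.l) C) (hS : C.length = S) :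
    Implements env (Ready env S t b) (Ready env S t b) round (roundEffect env C b) := by
  have h : Implements env (Ready env S t b) (Ready env S t b) (.query 0 6)
      fun F out ψ => F out (applyQuery env 0 b ψ) :=
    Implements.query fun _ h => ⟨h.1, h.2.2.2.2.2.1⟩
  have h' := (implements_writeLabel (env := env) (S := S) (t := t) (b := b)).block_cons
    ((implements_applyInverse hC hS).block_cons (h.block_cons
    ((implements_applyForward hC hS).block_cons (implements_measureLabel.block_cons
    ((implements_resetCircuit hC hS).block_cons (implements_resetAnswer.block_cons
    Implements.block_nil))))))
  exact h'

/-- An address beyond those of the circuit. -/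
def freeAddress (l : ℕ) (C : Circuit) : ℕ := l + (C.qubits.map (· + 1)).sum

theorem le_freeAddress (l : ℕ) (C : Circuit) : l ≤ freeAddress l C := Nat.le_add_right _ _

/-- A sum of all `q + 1` exceeds each `q`, and unlike a maximum it is computed by additions alone.
-/
theorem lt_freeAddress (l : ℕ) {C : Circuit} {q : ℕ} (hq : q ∈ C.qubits) :
    q < freeAddress l C := by
  have := List.single_le_sum (l := C.qubits.map (· + 1)) (by simp) (q + 1)
    (List.mem_map_of_mem hq)
  unfold freeAddress
  omega

/-- The contents of the registers while the circuit is scanned. -/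
def Scanning (env : Environment) (S t b n p v : ℕ) (ρ : ℕ → ℕ) : Prop :=
  ρ 0 = 0 ∧ ρ 1 = 1 ∧ ρ 2 = env.l ∧ ρ 4 = S ∧ ρ 5 = t ∧ ρ 6 + v = b ∧ ρ 7 = 4 + env.l ∧
    ρ 10 = p ∧ p + 3 * n = 4 + env.l + 3 * S ∧ ρ 9 = env.m + 1

/-- The invariant is that register 6 plus the contribution of the unscanned gates equals the free
address, and that register 10 plus three times their number is the end of the gate list. -/
theorem implements_scanCircuit {C : Circuit} (hC : GatesAt env (4 + env.l) C)
    (hS : C.length = S) :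
    Implements env (Scanning env S t (freeAddress env.l C) S (4 + env.l)
      (C.qubits.map (· + 1)).sum) (Ready env S t (freeAddress env.l C)) scanCircuit fun F => F := by
  have h0 : ∀ (F : Valuation), C.foldr (fun _ F => F) F = F := by
    intro F
    induction C with
    | nil => rfl
    | cons g C ih => simp
  set b := freeAddress env.l C
  have h1 := Implements.block_cons (env := env) (P := .loop 4
      (block [scanAddress, scanAddress, .add 10 10 1])) (L := [.add 8 10 0])
    (A := Scanning env S t b S (4 + env.l) (C.qubits.map (· + 1)).sum) (D := Ready env S t b)
    (Implements.loop (I := fun C ρ => GatesAt env (ρ 10) C ∧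
      Scanning env S t b C.length (ρ 10) (Circuit.qubits C |>.map (· + 1)).sum ρ)
      (τ := fun _ F => F) (fun g C => ?_) C (fun ρ h => ?_))
    (Implements.block_cons (Implements.add (B := Ready env S t b) fun ρ h => ?_)
      Implements.block_nil)
  · simp only [h0] at h1
    exact h1
  · refine fun Φ F hΦ s hs => ?_
    obtain ⟨⟨⟨hg1, hg2, hg3⟩, hC⟩, h0, h1, h2, h4, h5, h6, h7, -, h8, h9⟩ := hs
    simp only [scanAddress, block, List.foldr, branchSum_seq, branchSum_read, branchSum_add,
      branchSum_skip, Branch.tick_reg, Branch.set_reg]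
    rw [hΦ]
    · rfl
    simp only [Branch.tick_reg, Branch.set_reg]
    simp only [Circuit.qubits, List.flatMap_cons, List.map_append, List.sum_append, List.map_cons,
      List.map_nil, List.sum_cons, List.sum_nil, List.length_cons] at h6 h8
    refine ⟨?_, ?_⟩
    · simpa [Function.update, h1] using hC
    · simp only [Scanning]
      change _ + (_ + (Circuit.qubits C |>.map (· + 1)).sum) = _ at h6
      generalize (Circuit.qubits C |>.map (· + 1)).sum = w at h6 ⊢
      simp [Function.update, h0, h1, h2, h4, h5, h7, h9, hg2, hg3,
        -List.getD_eq_getElem?_getD]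
      constructor <;> omega
  · obtain ⟨h0, h1, h2, h4, h5, h6, h7, h10, h8, h9⟩ := h
    exact ⟨⟨h10 ▸ hC, h0, h1, h2, h4, h5, h6, h7, rfl, by rw [hS, h10], h9⟩, by rw [h4, hS]⟩
  · obtain ⟨-, h0, h1, h2, h4, h5, h6, h7, -, h8, h9⟩ := h
    simp only [Circuit.qubits, List.flatMap_nil, List.map_nil, List.sum_nil, List.length_nil] at h6 h8
    simp only [Ready]
    simp [Function.update, h0, h1, h2, h4, h5, h7, h9]
    omega

end

end AKRProgram

/-! ### Running times -/

namespace Program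

/-- A bound for the running time of a program with given numbers of repetitions of the loops and
given costs of queries. -/
def cost (n : ℕ → ℕ) (q : ℕ) : Program → ℕ
  | .seq c d => c.cost n q + d.cost n q
  | .ifZero _ c d => 1 + (c.cost n q + d.cost n q)
  | .loop r c => 1 + n r * c.cost n q
  | .query _ _ => q
  | _ => 1

/-- The program does not write to the registers in `D`, and its loops are controlled by them. -/
def Keeps (D : ℕ → Prop) : Program → Prop
  | .seq c d => c.Keeps D ∧ d.Keeps D
  | .ifZero _ c d => c.Keeps D ∧ d.Keeps D
  | .loop r c => D r ∧ c.Keeps D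
  | .const r _ => ¬ D r
  | .add r _ _ => ¬ D r
  | .sub r _ _ => ¬ D r
  | .read r _ => ¬ D r
  | .measure _ r => ¬ D r
  | _ => True

/-- As the registers in `D` never change, all loop counts are known in advance, and the bound holds
on every branch whatever the measurement outcomes. -/
theorem time_le_cost (env : Environment) {D : ℕ → Prop} {n : ℕ → ℕ} (P : Program)
    (hP : P.Keeps D) (s : Branch) (hs : ∀ r, D r → s.reg r = n r) :
    ∀ s' ∈ P.run env s, (∀ r, D r → s'.reg r = n r) ∧
      s'.time ≤ s.time + P.cost n (env.l + env.m + 1) := by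
  have hset : ∀ (s : Branch) {r v : ℕ}, ¬ D r → (∀ r, D r → s.reg r = n r) →
      ∀ i, D i → Function.update s.reg r v i = n i := by
    intro s r v hr hs i hi
    rw [Function.update_of_ne (fun h : i = r => hr (h ▸ hi))]
    exact hs i hi
  induction P generalizing s with
  | skip => simpa [run, Branch.tick, cost] using hs
  | seq c d ihc ihd =>
    intro s' hs'
    obtain ⟨s₁, h₁, h₂⟩ := List.mem_flatMap.1 (by simpa only [run] using hs')
    obtain ⟨a₁, b₁⟩ := ihc hP.1 s hs s₁ h₁
    obtain ⟨a₂, b₂⟩ := ihd hP.2 s₁ a₁ s' h₂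
    refine ⟨a₂, ?_⟩
    simp only [cost]
    omega
  | const r v => simpa [run, Branch.tick, Branch.set, cost] using hset s hP hs
  | add r a b => simpa [run, Branch.tick, Branch.set, cost] using hset s hP hs
  | sub r a b => simpa [run, Branch.tick, Branch.set, cost] using hset s hP hs
  | read r a => simpa [run, Branch.tick, Branch.set, cost] using hset s hP hs
  | ifZero r c d ihc ihd =>
    intro s' hs'
    simp only [run] at hs'
    simp only [cost]
    split_ifs at hs'
    · obtain ⟨a₁, b₁⟩ := ihc hP.1 (s.tick 1) hs s' hs'
      refine ⟨a₁, ?_⟩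
      simp only [Branch.tick] at b₁
      omega
    · obtain ⟨a₁, b₁⟩ := ihd hP.2 (s.tick 1) hs s' hs'
      refine ⟨a₁, ?_⟩
      simp only [Branch.tick] at b₁
      omega
  | loop r c ih =>
    have key : ∀ k, ∀ s' ∈ (fun L : List Branch => L.flatMap (c.run env))^[k] [s.tick 1],
        (∀ r, D r → s'.reg r = n r) ∧
          s'.time ≤ s.time + 1 + k * c.cost n (env.l + env.m + 1) := by
      intro k
      induction k with
      | zero =>
        intro s' hs'
        rw [Function.iterate_zero, id, List.mem_singleton] at hs'
        subst hs'
        exact ⟨hs, by simp [Branch.tick]⟩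
      | succ k ihk =>
        intro s' hs'
        rw [Function.iterate_succ_apply'] at hs'
        obtain ⟨s₁, h₁, h₂⟩ := List.mem_flatMap.1 hs'
        obtain ⟨a₁, b₁⟩ := ihk s₁ h₁
        obtain ⟨a₂, b₂⟩ := ih hP.2 s₁ a₁ s' h₂
        refine ⟨a₂, ?_⟩
        rw [Nat.succ_mul]
        omega
    intro s' hs'
    obtain ⟨a, b⟩ := key _ s' (by simpa only [run] using hs')
    refine ⟨a, ?_⟩
    simp only [cost, ← hs r hP.1]
    omega
  | gate g a b => simpa [run, Branch.tick, cost] using hs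
  | gateInv g a b => simpa [run, Branch.tick, cost] using hs
  | flip a => simpa [run, Branch.tick, cost] using hs
  | query a b => simpa [run, Branch.tick, cost] using hs
  | measure a r =>
    have := hset s (v := 0) hP hs
    have := hset s (v := 1) hP hs
    simp only [run, List.mem_cons, List.not_mem_nil, or_false]
    rintro s' (rfl | rfl) <;> exact ⟨by assumption, le_rfl⟩
  | output r => simpa [run, Branch.tick, cost] using hs

end Program

namespace AKRProgram

open Program

/-- The registers that control loops. -/
def loopRegister (r : ℕ) : Prop := r = 2 ∨ r = 4 ∨ r = 5 ∨ r = 9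

theorem main_keeps : main.Keeps loopRegister := by
  simp [main, scanCircuit, scanAddress, round, writeLabel, applyInverse, applyForward,
    measureLabel, resetCircuit, resetAnswer, loadGate, measureQubit, resetQubit, block, Keeps,
    loopRegister]

theorem cost_main_le (n : ℕ → ℕ) (q : ℕ) : main.cost n q ≤
    100 * ((n 4 + 1) + n 5 * (n 2 + n 4 + n 9 + q + 1)) := by
  simp only [main, scanCircuit, scanAddress, round, writeLabel, applyInverse, applyForward,
    measureLabel, resetCircuit, resetAnswer, loadGate, measureQubit, resetQubit, block, cost,
    List.foldr]
  ring_nf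
  nlinarith [Nat.zero_le (n 5 * n 2), Nat.zero_le (n 5 * n 4), Nat.zero_le (n 5 * n 9),
    Nat.zero_le (n 5 * q)]

/-- The bound for the running time. -/
noncomputable def timeBound : Polynomial ℕ := 700 * (Polynomial.X + 1) ^ 2

/-- The input of `env` describes the number `k`, the circuit `C` and the label `x`. -/
structure Encodes (env : Environment) (k : ℕ) (C : Circuit) (x : Fin env.l → Bool) : Prop where
  l : env.input.getD 0 0 = env.l
  m : env.input.getD 1 0 = env.m
  k : env.input.getD 2 0 = k
  length : env.input.getD 3 0 = C.length
  label : ∀ i : Fin env.l, env.input.getD (4 + i) 0 = (x i).toNat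
  gates : GatesAt env (4 + env.l) C

variable {env : Environment} {k : ℕ} {C : Circuit} {x : Fin env.l → Bool}

theorem implements_readHeader (h : Encodes env k C x) :
    Implements env (fun ρ => ρ = fun _ => 0) (Scanning env C.length (env.l + k)
      (freeAddress env.l C) C.length (4 + env.l) (C.qubits.map (· + 1)).sum) readHeader
      fun F => F := fun Φ F hΦ s hs => by
  simp only [readHeader, block, List.foldr, branchSum_seq, branchSum_read, branchSum_add,
    branchSum_const, branchSum_skip, Branch.tick_reg, Branch.set_reg]
  rw [hΦ]
  · rfl
  simp only [Branch.tick_reg, Branch.set_reg, Scanning]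
  simp [Function.update, hs, h.l, h.m, h.k, h.length, -List.getD_eq_getElem?_getD, freeAddress]
  omega

/-- With `y = l + m + k + S + 1`, the left side is at most `14 + 100 * y + 300 * y ^ 2`; the
constant 700 is generous. -/
theorem linear_cost_le_sq (l m k S : ℕ) :
    14 + 100 * (S + 1 + (l + k) * (l + S + (m + 1) + (l + m + 1) + 1)) ≤
      700 * (l + m + k + S + 1) ^ 2 := by
  have h1 : l + S + (m + 1) + (l + m + 1) + 1 ≤ 3 * (l + m + k + S + 1) := by omega
  have h2 : (l + k) * (l + S + (m + 1) + (l + m + 1) + 1) ≤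
      (l + m + k + S + 1) * (3 * (l + m + k + S + 1)) := Nat.mul_le_mul (by omega) h1
  have h3 : l + m + k + S + 1 ≤ (l + m + k + S + 1) ^ 2 := Nat.le_self_pow two_ne_zero _
  nlinarith

theorem time_le (h : Encodes env k C x) : ∀ s ∈ program.branches env,
    s.time ≤ timeBound.eval (env.l + env.m + k + C.length) := by
  intro s hs
  rw [Program.branches, program, run] at hs
  obtain ⟨s₁, h₁, h₂⟩ := List.mem_flatMap.1 hs
  simp only [readHeader, block, List.foldr, run, List.flatMap_cons, List.flatMap_nil,
    List.append_nil, List.mem_singleton] at h₁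
  let n : ℕ → ℕ := fun r => if r = 2 then env.l else if r = 4 then C.length else
    if r = 5 then env.l + k else env.m + 1
  -- The header sets the loop registers, so it is run explicitly: 13 commands and the `skip` that
  -- ends the block.
  have h3 : (∀ r, loopRegister r → s₁.reg r = n r) ∧ s₁.time = 14 := by
    subst h₁
    constructor
    · rintro r (rfl | rfl | rfl | rfl) <;>
      simp [n, Branch.tick, Branch.set, Function.update, h.l, h.m, h.k, h.length,
        -List.getD_eq_getElem?_getD, add_comm]
    · simp [Branch.tick, Branch.set]
  have h4 := (time_le_cost env main main_keeps s₁ h3.1 s h₂).2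
  have h5 := cost_main_le n (env.l + env.m + 1)
  rw [h3.2] at h4
  simp only [n] at h4 h5
  simp only [timeBound, Polynomial.eval_mul, Polynomial.eval_pow, Polynomial.eval_add,
    Polynomial.eval_X, Polynomial.eval_one, Polynomial.eval_ofNat]
  norm_num at h5
  exact h4.trans ((Nat.add_le_add_left h5 _).trans (linear_cost_le_sq _ _ _ _))

/-! ### The output distribution -/

theorem statesOn_mono {A A' : Set ℕ} (h : A ⊆ A') : statesOn A ≤ statesOn A' := fun _ hψ _ hS =>
  (hψ hS).trans h

theorem flipSet_flipSet (R R' : Finset ℕ) (ψ : QState) :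
    flipSet R (flipSet R' ψ) = flipSet (symmDiff R' R) ψ := by
  rw [← LinearMap.comp_apply]
  refine LinearMap.congr_fun (qstate_lhom_ext fun S => ?_) ψ
  rw [LinearMap.comp_apply, flipSet_ket, flipSet_ket, flipSet_ket, symmDiff_assoc]

theorem foldr_writeEffect (i n : ℕ) (F : Valuation) (out : List Bool) (ψ : QState) :
    (List.range' i n).foldr (writeEffect env) F out ψ =
      F out (flipSet ((Finset.Ico i (i + n)).filter fun q => env.input.getD (4 + q) 0 ≠ 0) ψ) := by
  induction n generalizing i ψ with
  | zero =>
    have : flipSet ∅ = LinearMap.id := qstate_lhom_ext fun S => by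
      rw [flipSet_ket, LinearMap.id_apply]
      congr 1
      exact symmDiff_bot S
    simp [this]
  | succ n ih =>
    have h : Finset.Ico i (i + (n + 1)) = insert i (Finset.Ico (i + 1) (i + 1 + n)) := by
      ext q
      simp only [Finset.mem_Ico, Finset.mem_insert]
      omega
    rw [List.range'_succ, List.foldr_cons, writeEffect, h, Finset.filter_insert]
    by_cases h0 : env.input.getD (4 + i) 0 = 0
    · rw [if_pos h0, if_neg (not_not.2 h0)]
      exact ih (i + 1) ψ
    · rw [if_neg h0, if_pos h0]
      refine (ih (i + 1) _).trans ?_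
      rw [flipSet_flipSet]
      congr 3
      ext q
      simp only [Finset.mem_symmDiff, Finset.mem_singleton, Finset.mem_filter, Finset.mem_Ico,
        Finset.mem_insert]
      by_cases hq : q = i
      · subst hq; simp
      · simp [hq]

theorem Encodes.filter_eq (h : Encodes env k C x) :
    (Finset.Ico 0 (0 + env.l)).filter (fun q => env.input.getD (4 + q) 0 ≠ 0) = bitsToSet x := by
  ext q
  simp only [bitsToSet, Finset.mem_filter, Finset.mem_Ico, Finset.mem_map, Finset.mem_univ,
    true_and, Fin.valEmbedding_apply, zero_add, zero_le]
  constructor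
  · rintro ⟨hq, h1⟩
    have := h.label ⟨q, hq⟩
    rw [this] at h1
    exact ⟨⟨q, hq⟩, by simpa using h1, rfl⟩
  · rintro ⟨i, hi, rfl⟩
    exact ⟨i.2, by rw [h.label i, hi]; simp⟩

/-- The expected value after a round that appends its outcome to the output. -/
noncomputable def roundMean (env : Environment) (C : Circuit) (x : Fin env.l → Bool)
    (κ : List Bool → ℝ) (out : List Bool) : ℝ :=
  expect (roundState env C (freeAddress env.l C) x) fun S =>
    κ (out ++ List.ofFn (readBits env.l 0 S))

theorem eq_smul_ket_of_mem_statesOn_empty {ψ : QState} (hψ : ψ ∈ statesOn ∅) :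
    ψ = ψ ∅ • ket ∅ := by
  rw [← single_eq_smul_ket, ← Finsupp.support_subset_singleton]
  intro S hS
  have := hψ hS
  rw [Set.mem_ofPred_eq, Set.subset_empty_iff, Finset.coe_eq_empty] at this
  rw [this, Finset.mem_singleton]

/-- A round touches only the label, circuit and answer qubits and resets them all. It starts and
ends on multiples of `ket ∅`, so nothing but the output passes from one round to the next. -/
theorem roundEffect_eq (h : Encodes env k C x) {F : Valuation} {κ : List Bool → ℝ}
    (hF : ∀ out, ∀ ψ ∈ statesOn ∅, F out ψ = normSq ψ * κ out) (out : List Bool) {ψ : QState}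
    (hψ : ψ ∈ statesOn ∅) :
    roundEffect env C (freeAddress env.l C) F out ψ = normSq ψ * roundMean env C x κ out := by
  set b := freeAddress env.l C
  have hb : env.l ≤ b := le_freeAddress _ _
  let A : Set ℕ := {q | q ∈ List.range' 0 env.l} ∪ ({q | q ∈ C.qubits} ∪
    {q | q ∈ List.range' b (env.m + 1)})
  have hA : roundState env C b x ∈ statesOn A :=
    roundState_mem_statesOn env hb x (fun q hq => Or.inl (by simpa using hq))
      (fun q hq => Or.inr (Or.inl hq)) fun q h1 h2 => Or.inr (Or.inr (List.mem_range'_1.2 ⟨h1, h2⟩))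
  rw [eq_smul_ket_of_mem_statesOn_empty hψ, normSq_smul, normSq_ket, mul_one, roundEffect,
    foldr_writeEffect, h.filter_eq, map_smul, flipSet_ket]
  have h0 : symmDiff ∅ (bitsToSet x) = bitsToSet x := bot_symmDiff _
  rw [h0, map_smul, map_smul, map_smul]
  change _ = _ * expect _ _
  rw [← expect_smul]
  refine (foldr_measureEffect (κ := κ) 0 env.l (A := A) (fun out ψ hψ => ?_) out
    (Submodule.smul_mem _ _ hA)).trans ?_
  · refine foldr_resetEffect _ (fun out ψ hψ => ?_) out hψ
    refine foldr_resetEffect _ (fun out ψ hψ => hF out ψ (statesOn_mono ?_ hψ)) out hψ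
    -- A surviving qubit of `A` would belong to one of the three blocks, each of which has been
    -- cleared.
    rintro q ⟨⟨⟨h1 | h1 | h1, h2⟩, h3⟩, h4⟩
    exacts [h2 h1, h3 h1, h4 h1]
  · simp_rw [map_range'_eq_ofFn_readBits]
    rfl

theorem implements_main (h : Encodes env k C x) :
    Implements env (Scanning env C.length (env.l + k) (freeAddress env.l C) C.length (4 + env.l)
      (C.qubits.map (· + 1)).sum) (fun _ => True) main
      fun F => (List.replicate (env.l + k) ()).foldr
        (fun _ => roundEffect env C (freeAddress env.l C)) F := by
  have h1 : Implements env (Ready env C.length (env.l + k) (freeAddress env.l C)) (fun _ => True)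
      (.loop 5 round) fun F => (List.replicate (env.l + k) ()).foldr
        (fun _ => roundEffect env C (freeAddress env.l C)) F :=
    (Implements.loop (I := fun _ => Ready env C.length (env.l + k) (freeAddress env.l C))
      (fun _ _ => implements_round h.gates rfl) _
      fun ρ h => ⟨h, by rw [h.2.2.2.2.1, List.length_replicate]⟩).weaken
      (fun _ h => h) fun _ _ => trivial
  exact (implements_scanCircuit h.gates rfl).block_cons (h1.block_cons Implements.block_nil)

theorem foldr_roundEffect (h : Encodes env k C x) {F : Valuation} {κ : List Bool → ℝ}
    (hF : ∀ out, ∀ ψ ∈ statesOn ∅, F out ψ = normSq ψ * κ out) (n : ℕ) (out : List Bool)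
    {ψ : QState} (hψ : ψ ∈ statesOn ∅) : (List.replicate n ()).foldr
      (fun _ => roundEffect env C (freeAddress env.l C)) F out ψ =
      normSq ψ * (roundMean env C x)^[n] κ out := by
  induction n generalizing out ψ with
  | zero => exact hF out ψ hψ
  | succ n ih =>
    rw [List.replicate_succ, List.foldr_cons, Function.iterate_succ_apply']
    exact roundEffect_eq h (fun out ψ hψ => ih out hψ) out hψ

open scoped Classical in
theorem prob_eq (h : Encodes env k C x) (E : Set (List Bool)) : program.prob env E =
    (roundMean env C x)^[env.l + k] (fun out => if out ∈ E then 1 else 0) [] := by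
  have h1 := (implements_readHeader h).seq (implements_main h)
    (fun s => if s.out ∈ E then normSq s.ψ else 0)
    (fun out ψ => if out ∈ E then normSq ψ else 0) (fun _ _ => rfl)
    { reg := fun _ => 0, out := [], ψ := ket ∅, time := 0 } rfl
  refine Eq.trans h1 ((foldr_roundEffect h (κ := fun out => if out ∈ E then 1 else 0)
    (fun out ψ _ => by split_ifs <;> simp) _ _ (ket_mem_statesOn (by simp))).trans ?_)
  rw [normSq_ket, one_mul]

end AKRProgram

/-! ### Independent rounds -/

section Rounds

variable {T : Type*} [Fintype T] {H : AbelianHypergroup T} {l : ℕ}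
  (encX : H.Dual ↪ (Fin l → Bool)) {L : Type*} (f : T → L)

/-- The expected value after a round of AKR sampling that appends its outcome to the output. -/
noncomputable def akrMean (κ : List Bool → ℝ) (out : List Bool) : ℝ :=
  ∑ X, H.akrProb f X * κ (out ++ List.ofFn (encX X))

theorem labels_cons {t : ℕ} (Y : H.Dual) (X : Fin t → H.Dual) :
    labels encX (Fin.cons Y X : Fin (t + 1) → H.Dual) = List.ofFn (encX Y) ++ labels encX X := by
  simp [labels, List.ofFn_succ]

/-- All labels have the same length `l`, so their concatenation can be cut apart again. -/
theorem labels_injective (t : ℕ) :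
    Function.Injective fun X : Fin t → H.Dual => labels encX X := by
  induction t with
  | zero => exact fun X Y _ => Subsingleton.elim X Y
  | succ t ih =>
    intro X Y h
    obtain ⟨Y₀, Y₁, rfl⟩ : ∃ a v, Y = Fin.cons a v := ⟨_, _, (Fin.cons_self_tail Y).symm⟩
    obtain ⟨X₀, X₁, rfl⟩ : ∃ a v, X = Fin.cons a v := ⟨_, _, (Fin.cons_self_tail X).symm⟩
    simp only [labels_cons] at h
    obtain ⟨h1, h2⟩ := List.append_inj h (by simp)
    rw [encX.injective (List.ofFn_injective h1), ih h2]

theorem iterate_akrMean (κ : List Bool → ℝ) (t : ℕ) (out : List Bool) :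
    (akrMean encX f)^[t] κ out =
      ∑ X : Fin t → H.Dual, (∏ i, H.akrProb f (X i)) * κ (out ++ labels encX X) := by
  induction t generalizing out with
  | zero => simp [labels]
  | succ t ih =>
    rw [Function.iterate_succ_apply', akrMean,
      ← (Fin.consEquiv fun _ => H.Dual).sum_comp, Fintype.sum_prod_type]
    refine Finset.sum_congr rfl fun Y _ => ?_
    rw [ih, Finset.mul_sum]
    refine Finset.sum_congr rfl fun X _ => ?_
    change _ = (∏ i, H.akrProb f ((Fin.cons Y X : Fin (t + 1) → H.Dual) i)) *
      κ (out ++ labels encX (Fin.cons Y X : Fin (t + 1) → H.Dual))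
    rw [labels_cons, Fin.prod_univ_succ, List.append_assoc]
    simp only [Fin.cons_zero, Fin.cons_succ]
    ring

open scoped Classical in
theorem iterate_akrMean_labels {t : ℕ} (S : Set (Fin t → H.Dual)) :
    (akrMean encX f)^[t] (fun out => if out ∈ labels encX '' S then 1 else 0) [] =
      H.akrLaw f S := by
  rw [iterate_akrMean, AbelianHypergroup.akrLaw]
  refine Finset.sum_congr rfl fun X _ => ?_
  rw [List.nil_append, (labels_injective encX t).mem_set_image, Set.indicator_apply]
  split_ifs <;> simp

theorem abs_expect_le {ψ : QState} {g : Finset ℕ → ℝ} (hg : ∀ S, |g S| ≤ 1) :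
    |expect ψ g| ≤ normSq ψ := by
  rw [expect, normSq, Finsupp.sum, Finsupp.sum]
  refine (Finset.abs_sum_le_sum_abs _ _).trans (Finset.sum_le_sum fun S _ => ?_)
  rw [abs_mul, abs_of_nonneg (by positivity)]
  exact mul_le_of_le_one_right (by positivity) (hg S)

/-- A hybrid argument: exchange `σ` for `τ` one application at a time. Each exchange costs `δ`,
since `σ` keeps functions bounded by 1, and applying `τ` does not enlarge the uniform distance
accumulated so far. -/
theorem abs_iterate_sub_iterate_le {α : Type*} {σ τ : (α → ℝ) → α → ℝ} {δ : ℝ}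
    (hσ : ∀ κ, (∀ a, |κ a| ≤ 1) → ∀ a, |σ κ a| ≤ 1)
    (hτ : ∀ κ κ' c, (∀ a, |κ a - κ' a| ≤ c) → ∀ a, |τ κ a - τ κ' a| ≤ c)
    (h : ∀ κ, (∀ a, |κ a| ≤ 1) → ∀ a, |σ κ a - τ κ a| ≤ δ) {κ : α → ℝ} (hκ : ∀ a, |κ a| ≤ 1)
    (n : ℕ) (a : α) : |σ^[n] κ a - τ^[n] κ a| ≤ n * δ := by
  have h1 : ∀ n a, |σ^[n] κ a| ≤ 1 := by
    intro n
    induction n with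
    | zero => exact hκ
    | succ n ih =>
      rw [Function.iterate_succ_apply']
      exact hσ _ ih
  induction n generalizing a with
  | zero => simp
  | succ n ih =>
    rw [Function.iterate_succ_apply', Function.iterate_succ_apply']
    refine (abs_sub_le _ (τ (σ^[n] κ) a) _).trans ?_
    have := add_le_add (h _ (h1 n) a) (hτ _ _ _ ih a)
    push_cast
    linarith

theorem abs_akrMean_sub_le (κ κ' : List Bool → ℝ) (c : ℝ) (h : ∀ out, |κ out - κ' out| ≤ c)
    (out : List Bool) : |akrMean encX f κ out - akrMean encX f κ' out| ≤ c := by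
  rw [akrMean, akrMean, ← Finset.sum_sub_distrib]
  refine (Finset.abs_sum_le_sum_abs _ _).trans ?_
  calc _ ≤ ∑ X, H.akrProb f X * c := Finset.sum_le_sum fun X _ => by
        rw [← mul_sub, abs_mul, abs_of_nonneg (H.akrProb_nonneg f X)]
        exact mul_le_mul_of_nonneg_left (h _) (H.akrProb_nonneg f X)
    _ = c := by rw [← Finset.sum_mul, H.sum_akrProb, one_mul]

end Rounds

/-! ### Distance of the program's output from the AKR law, and the input format. -/

namespace AKRProgram

section

variable {T : Type*} [Fintype T] {H : AbelianHypergroup T} {env : Environment}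
  {encT : T ↪ (Fin env.l → Bool)} {encX : H.Dual ↪ (Fin env.l → Bool)} {C : Circuit} {ε : ℝ}
  {f : T → List Bool} {k : ℕ}

theorem abs_prob_sub_akrLaw_le (h : Encodes env k C (encX H.trivialChar)) (hε : 0 ≤ ε)
    (hC : ComputesQFT H encT encX env.lib C ε) (hf : ∀ a, env.oracle (encT a) = f a)
    (hm : ∀ a, (f a).length ≤ env.m) (S : Set (Fin (env.l + k) → H.Dual)) :
    |program.prob env (labels encX '' S) - H.akrLaw f S| ≤ 4 * (env.l + k) * ε := by
  classical
  rw [prob_eq h, ← iterate_akrMean_labels encX f S]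
  refine (abs_iterate_sub_iterate_le (δ := 4 * ε) (fun κ hκ out => ?_)
    (abs_akrMean_sub_le encX f) (fun κ hκ out => ?_) (fun out => ?_) _ _).trans_eq ?_
  · exact (abs_expect_le fun S => hκ _).trans_eq
      (normSq_roundState env (le_freeAddress _ _) _)
  · exact abs_expect_roundState_sub_le env hε hC hf hm (le_freeAddress _ _)
      (fun q hq => lt_freeAddress _ hq) (h := fun x => κ (out ++ List.ofFn x)) fun x => hκ _
  · split_ifs <;> simp
  · push_cast
    ring

end

theorem gatesAt_of_input {env : Environment} (pre : List ℕ) (C : Circuit)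
    (h : env.input = pre ++ C.flatMap fun g => [g.1, g.2.1, g.2.2]) :
    GatesAt env pre.length C := by
  induction C generalizing pre with
  | nil => trivial
  | cons g C ih =>
    refine ⟨?_, ?_⟩
    · rw [GateAt, h, List.getD_append_right _ _ _ _ le_rfl,
        List.getD_append_right _ _ _ _ (Nat.le_add_right _ _),
        List.getD_append_right _ _ _ _ (Nat.le_add_right _ _), Nat.sub_self,
        Nat.add_sub_cancel_left, Nat.add_sub_cancel_left]
      exact ⟨rfl, rfl, rfl⟩
    · have := ih (pre ++ [g.1, g.2.1, g.2.2]) (by rw [h, List.flatMap_cons, List.append_assoc])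
      rwa [List.length_append] at this

theorem encodes_problemInput {T : Type*} [Fintype T] {H : AbelianHypergroup T} {l : ℕ}
    (encX : H.Dual ↪ (Fin l → Bool)) (lib : GateLibrary) (m k : ℕ) (C : Circuit)
    (oracle : (Fin l → Bool) → List Bool) :
    Encodes { lib := lib, input := problemInput encX m k C, l := l, m := m, oracle := oracle } k C
      (encX H.trivialChar) where
  l := rfl
  m := rfl
  k := rfl
  length := rfl
  label i := by
    simp only [problemInput, List.append_assoc]
    rw [List.getD_append_right _ _ _ _ (by simp)]
    rw [List.getD_append _ _ _ _ (by simp), List.getD_eq_getElem _ _ (by simp)]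
    simp
  gates := by
    have := gatesAt_of_input (env := ⟨lib, problemInput encX m k C, l, m, oracle⟩) ([l, m, k, C.length] ++
        (List.ofFn (encX H.trivialChar)).map Bool.toNat) C rfl
    rwa [List.length_append, List.length_map, List.length_ofFn] at this

end AKRProgram

end HSHP

theorem mainTheorem8 :
    -- one program and one polynomial for all groups, labelings, gate libraries and oracles
    ∃ (P : HSHP.Program) (p : Polynomial ℕ),
      ∀ (G : Type*) [Group G] [Finite G] [Fintype (ConjClasses G)]
        -- labels of conjugacy classes and of characters of the class hypergroup
        (l : ℕ) (encC : ConjClasses G ↪ (Fin l → Bool))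
        (encX : (HSHP.classHypergroup G).Dual ↪ (Fin l → Bool))
        -- a circuit for the QFT over the class hypergroup, with accuracy `ε`
        (lib : HSHP.GateLibrary) (C : HSHP.Circuit) (ε : ℝ) (_ : 0 ≤ ε)
        (_ : HSHP.ComputesQFT (HSHP.classHypergroup G) encC encX lib C ε)
        -- a normal subgroup with abelian quotient
        (N : Subgroup G) [N.Normal] (_ : ∀ x y : G ⧸ N, x * y = y * x)
        -- a function that hides the corresponding subhypergroup
        (f : ConjClasses G → List Bool)
        (_ : (HSHP.classHypergroup G).Hides f (HSHP.normalClasses N))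
        (m : ℕ) (_ : ∀ c, (f c).length ≤ m)
        -- an oracle for this function, with arbitrary answers to strings that are not labels
        (oracle : (Fin l → Bool) → List Bool) (_ : ∀ c, oracle (encC c) = f c)
        -- the confidence parameter
        (k : ℕ),
        let env : HSHP.Environment :=
          { lib := lib, input := HSHP.problemInput encX m k C, l := l, m := m, oracle := oracle }
        -- the running time is polynomial
        (∀ s ∈ P.branches env, s.time ≤ p.eval (l + m + k + C.length)) ∧
        -- the program carries out `l + k` rounds of AKR
        (∀ S : Set (Fin (l + k) → (HSHP.classHypergroup G).Dual),
          |P.prob env (HSHP.labels encX '' S) - (HSHP.classHypergroup G).akrLaw f S|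
            ≤ 4 * (l + k) * ε) ∧
        -- AKR finds the hidden subhypergroup
        (1 - (1 / 2 : ℝ) ^ k ≤ (HSHP.classHypergroup G).akrLaw f
          {X : Fin (l + k) → (HSHP.classHypergroup G).Dual |
            (HSHP.classHypergroup G).commonKernel X = HSHP.normalClasses N}) ∧
        -- the program finds the hidden subhypergroup
        1 - (1 / 2 : ℝ) ^ k - 4 * (l + k) * ε ≤ P.prob env (HSHP.labels encX ''
          {X : Fin (l + k) → (HSHP.classHypergroup G).Dual |
            (HSHP.classHypergroup G).commonKernel X = HSHP.normalClasses N}) := by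

  refine ⟨HSHP.AKRProgram.program, HSHP.AKRProgram.timeBound, ?_⟩
  intro G _ _ _ l encC encX lib C ε hε hC N _ hN f hf m hm oracle ho k env
  have h := HSHP.AKRProgram.encodes_problemInput encX lib m k C oracle
  have h1 : ∀ S : Set (Fin (l + k) → (HSHP.classHypergroup G).Dual),
      |HSHP.AKRProgram.program.prob env (HSHP.labels encX '' S) -
        (HSHP.classHypergroup G).akrLaw f S| ≤ 4 * (l + k) * ε := fun S =>
    HSHP.AKRProgram.abs_prob_sub_akrLaw_le h hε hC ho hm S
  have h2 := HSHP.one_sub_le_akrLaw_normalClasses hN encC hf k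
  refine ⟨HSHP.AKRProgram.time_le h, h1, h2, ?_⟩
  linarith [(abs_le.1 (h1 {X | (HSHP.classHypergroup G).commonKernel X = HSHP.normalClasses N})).1]
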